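/- **Setting.** For every sample size $n$ there are independent responses $y_1,\dots,y_n$, fixed covariates $x_i=x_{n,i}\in\mathbb R^p$ and vectors $z_i=z_{n,i}=(z_{i1}^\top,\dots,z_{iq}^\top)^\top\in\mathbb R^d$ of basis functions of the $q\ge1$ smooths, where $z_{ij}\in\mathbb R^{d_j}$, $d_j=d_j(n)\ge1$ and $d=d(n)=\sum_j d_j$; $p$ and $q$ are fixed. With respect to a fixed dominating measure the response $y_i$ has the density $$f(y_i\mid\theta)=\exp\{\phi^{-1}(y_i\omega_i-b(\omega_i))+c(y_i,\phi)\},\qquad g(b'(\omega_i))=\eta_i=x_i^\top\kappa+z_i^\top\beta ,$$ where $b,c$ and the link $g$ are known and do not depend on $n$, and every $\eta_i\in\mathbb R$ is admissible. Here $\theta=(\Psi,\beta)$ with $\Psi=(\kappa,\phi)$ if the dispersion $\phi$ is unknown, and $\Psi=\kappa$ if it is known. The parameter space $\Theta=\Theta_n$ consists of all $\theta$ with $\kappa\in\mathbb R^p$, $\beta\in\mathbb R^d$ and $\phi$ in a given set of positive numbers. The true parameter is $\theta^0=\theta^0_n=(\Psi^0,\beta^0_n)$, where $\kappa^0$ and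 $\phi^0$ do not depend on $n$. Let $S_j=S_{n,j}$ be the positive definite $d_j\times d_j$ matrix $(D_jQ_j)^\top D_jQ_j$ of a difference penalty, where $D_j$ is a difference matrix whose order does not depend on $n$ and $Q_j$ has orthonormal columns (coordinates after centering), and let $\lambda_j=\lambda_{n,j}>0$ be smoothing parameters. The variational log-likelihood is $$\underline\ell(\Psi,a,A)=\int\sum_{i=1}^n\ln f(y_i\mid\Psi,\beta)\,h(\beta\mid a,A)\,d\beta+\frac12\sum_{j=1}^q\{d_j\ln\lambda_j-\lambda_ja_j^\top S_ja_j-\lambda_j\operatorname{tr}(S_jA_j)\}+\frac12\ln\det A,$$ where $h(\cdot\mid a,A)$ is the $\mathcal N_d(a,A)$ density, $a=(a_1^\top,\dots,a_q^\top)^\top\in\mathbb R^d$, $A$ is a positive definite $d\times d$ matrix and $A_j$ is its $j$-th diagonal block; the integrals are assumed to exist. Variational (VA) estimates $\hat\theta=(\hat\Psi,\hat a)$, $\hat A$ are local maximizers of $\underline\ell$ over $(\Psi,a)\in\Theta$ and positive definite $A$. **Conditions** (all constants are independent of $n$, $i$ and of the indices $r,s,t$ of the coordinates of $\theta$; $\operatorname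 E$ is the expectation under $\theta^0$): * (C1) The densities have common support and $f(y_i\mid\theta)$ is three times continuously differentiable in $\theta$ in the interior of $\Theta$. For all large $n$ the model is identifiable: different $\theta,\theta'\in\Theta$ give different laws of $(y_1,\dots,y_n)$. * (C2) $\|(x_i^\top,z_i^\top)\|_\infty<C_1$ for all $i$. * (C3) $\theta^0$ is in the interior of $\Theta$; $\operatorname E\{\partial\ln f(y_i\mid\theta^0)/\partial\theta\}=0$ for all $i$; and $|\eta_i|<C_2$ at $\theta^0$ for all $i$. * (C4) The Fisher information per observation $\mathcal I(\theta^0)=n^{-1}\sum_{i=1}^n\operatorname E\{-\partial^2\ln f(y_i\mid\theta^0)/\partial\theta\,\partial\theta^\top\}$ is finite, and for all large $n$ its smallest eigenvalue is at least a constant $c>0$. * (C5) There are open sets $\Theta_s=\Theta_{s,n}\subseteq\Theta$ containing $\theta^0$ such that, for every $C$, $\Theta_s$ contains the ball of radius $C(d/n)^{1/2}$ around $\theta^0$ for all large $n$, and there are functions $F_{rs},G_{rst}$ of $y_i$ with $|\partial^2\ln f(y_i\mid\theta)/\partial\theta_r\partial\theta_s|\le F_{rs}(y_i)$ and $|\partial^3\ln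 f(y_i\mid\theta)/\partial\theta_r\partial\theta_s\partial\theta_t|\le G_{rst}(y_i)$ for all $\theta\in\Theta_s$, and $\operatorname E F_{rs}^2(y_i)<C_3$, $\operatorname E G_{rst}^2(y_i)<C_4$. * (C6) $d=o(n^{1/4})$. **Theorem.** Assume (C1)–(C6) and $\lambda_j=o(n^{1/2})$ for $j=1,\dots,q$. Then there are VA estimates with $$\|\hat\theta-\theta^0\|=O_p(d^{1/2}n^{-1/2}).$$ That is, there are functions $(\hat\theta,\hat A)$ of the sample that are VA estimates with probability tending to one, such that for every $\varepsilon>0$ there is a $C$ with $P(\|\hat\theta-\theta^0\|>C d^{1/2}n^{-1/2})\le\varepsilon$ for all large $n$. -/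

import Mathlib

open MeasureTheory ProbabilityTheory Filter Asymptotics Topology
open scoped Matrix

noncomputable section

namespace GAM

/-- An exponential dispersion family with a link function.  With respect to the dominating measure
`base`, the response with canonical parameter `w` and dispersion `phi` has the density
`exp (phi⁻¹ * (y * w - b w) + c y phi)`.  The mean is `b' w`, the link function maps the mean to the
linear predictor, and `omega eta` is the canonical parameter that belongs to the linear predictor
`eta`.  The set `dispSpace` holds the possible values of the dispersion (it may be a single point,
such as `{1}` for Poisson and Bernoulli responses). -/
structure ExpFamily where
  base : Measure ℝ
  b : ℝ → ℝ
  c : ℝ → ℝ → ℝ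
  link : ℝ → ℝ
  omega : ℝ → ℝ
  dispSpace : Set ℝ
  disp_pos : ∀ phi ∈ dispSpace, 0 < phi
  measurable_c : ∀ phi ∈ dispSpace, Measurable fun y => c y phi
  differentiableAt_b : ∀ eta, DifferentiableAt ℝ b (omega eta)
  link_mean : ∀ eta, link (deriv b (omega eta)) = eta
  lintegral_density : ∀ phi ∈ dispSpace, ∀ eta,
    ∫⁻ y, ENNReal.ofReal (Real.exp (phi⁻¹ * (y * omega eta - b (omega eta)) + c y phi)) ∂base = 1

/-- The log-density of a response, in terms of the dispersion and the linear predictor. -/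
def ExpFamily.logDensity (E : ExpFamily) (y phi eta : ℝ) : ℝ :=
  phi⁻¹ * (y * E.omega eta - E.b (E.omega eta)) + E.c y phi

/-- The index set of the smoothing coefficients: `D j` of them for the `j`-th smooth. -/
abbrev BasisIdx {q : ℕ} (D : Fin q → ℕ) : Type := Σ j : Fin q, Fin (D j)

/-- The index set of the full parameter: `p` regression coefficients, `e` free dispersion parameters
(`e = 1` if the dispersion is unknown, `e = 0` if it is known), and the smoothing coefficients. -/
abbrev ParamIdx (p e : ℕ) {q : ℕ} (D : Fin q → ℕ) : Type := Fin p ⊕ (Fin e ⊕ BasisIdx D)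

/-- The full parameter `theta = (Psi, beta)`, with `Psi = (kappa, phi)`, and its Euclidean norm. -/
abbrev Param (p e : ℕ) {q : ℕ} (D : Fin q → ℕ) : Type := EuclideanSpace ℝ (ParamIdx p e D)

/-- The coefficients `beta` of the smooths. -/
abbrev Coef {q : ℕ} (D : Fin q → ℕ) : Type := EuclideanSpace ℝ (BasisIdx D)

section Param

variable {p e q : ℕ} {D : Fin q → ℕ}

/-- The parameter with given parts `kappa`, `phi` and `beta`. -/
def mkParam (kappa : Fin p → ℝ) (phi : ℝ) (beta : BasisIdx D → ℝ) : Param p e D :=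
  WithLp.toLp 2 (Sum.elim kappa (Sum.elim (fun _ => phi) beta))

/-- The smoothing coefficients contained in a parameter. -/
def coef (theta : Param p e D) : Coef D := WithLp.toLp 2 fun k => theta (Sum.inr (Sum.inr k))

/-- The parameter `(Psi, beta)`, where `Psi` is the parametric part of `theta`. -/
def withCoef (theta : Param p e D) (beta : Coef D) : Param p e D :=
  WithLp.toLp 2 (Sum.elim (fun j => theta (Sum.inl j))
    (Sum.elim (fun l => theta (Sum.inr (Sum.inl l))) fun k => beta k))

/-- The dispersion: a coordinate of the parameter if it is unknown, otherwise the known `phi0`. -/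
def dispersion (phi0 : ℝ) (theta : Param p e D) : ℝ :=
  if h : 0 < e then theta (Sum.inr (Sum.inl ⟨0, h⟩)) else phi0

/-- The linear predictor `xᵀ kappa + zᵀ beta`. -/
def linPred (x : Fin p → ℝ) (z : BasisIdx D → ℝ) (theta : Param p e D) : ℝ :=
  ∑ j, x j * theta (Sum.inl j) + ∑ k, z k * theta (Sum.inr (Sum.inr k))

/-- Partial derivative with respect to the `r`-th coordinate of the parameter. -/
def partialDeriv (r : ParamIdx p e D) (F : Param p e D → ℝ) (theta : Param p e D) : ℝ :=
  fderiv ℝ F theta (EuclideanSpace.single r 1)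

end Param

/-- The matrix of `r`-th order differences of `m` consecutive numbers. -/
def diffMatrix (r m : ℕ) : Matrix (Fin (m - r)) (Fin m) ℝ := fun i k =>
  if (i : ℕ) ≤ k then (-1) ^ (r + ((k : ℕ) - i)) * (r.choose ((k : ℕ) - i) : ℝ) else 0

/-- `S` is the full rank matrix of an `r`-th order difference penalty: the coefficients of `m` basis
functions are restricted by centering to a subspace with the orthonormal coordinates `Q`, and
`bᵀ S b` is the sum of the squared `r`-th order differences of `Q b`. -/
def IsDifferencePenalty (r : ℕ) {k : ℕ} (S : Matrix (Fin k) (Fin k) ℝ) : Prop :=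
  S.PosDef ∧ ∃ (m : ℕ) (Q : Matrix (Fin m) (Fin k) ℝ), Qᵀ * Q = 1 ∧
    S = (diffMatrix r m * Q)ᵀ * (diffMatrix r m * Q)

/-- A sequence of generalized additive models, one for each sample size `n`, with `p` parametric
covariates and `q` smooths: the numbers of basis functions, the fixed covariates `x` and values `z`
of the basis functions, the penalty matrices, the smoothing parameters, and the true parameters. -/
structure GAMSeq (p q : ℕ) where
  fam : ExpFamily
  dim : ℕ → Fin q → ℕ
  x : ∀ n, Fin n → Fin p → ℝ
  z : ∀ n, Fin n → BasisIdx (dim n) → ℝ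
  S : ∀ n j, Matrix (Fin (dim n j)) (Fin (dim n j)) ℝ
  lam : ℕ → Fin q → ℝ
  kappa0 : Fin p → ℝ
  phi0 : ℝ
  beta0 : ∀ n, BasisIdx (dim n) → ℝ

namespace GAMSeq

variable {p q : ℕ} (M : GAMSeq p q) (e n : ℕ)

/-- The total number `d` of basis functions. -/
def d : ℕ := ∑ j, M.dim n j

/-- The true parameter. -/
def theta0 : Param p e (M.dim n) := mkParam M.kappa0 M.phi0 (M.beta0 n)

/-- The parameter space. -/
def paramSpace : Set (Param p e (M.dim n)) := {theta | dispersion M.phi0 theta ∈ M.fam.dispSpace}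

variable {e n}

/-- The log-density `ln f(y | theta)` of the `i`-th response. -/
def logf (i : Fin n) (y : ℝ) (theta : Param p e (M.dim n)) : ℝ :=
  M.fam.logDensity y (dispersion M.phi0 theta) (linPred (M.x n i) (M.z n i) theta)

/-- The density `f(y | theta)` of the `i`-th response. -/
def f (i : Fin n) (y : ℝ) (theta : Param p e (M.dim n)) : ℝ := Real.exp (M.logf i y theta)

variable (e n)

/-- The law of the `i`-th response under the true parameter. -/
def trueLaw (i : Fin n) : Measure ℝ :=
  M.fam.base.withDensity fun y => ENNReal.ofReal (M.f i y (M.theta0 e n))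

/-- The law of the sample of `n` independent responses under the true parameter. -/
def sampleLaw : Measure (Fin n → ℝ) := Measure.pi (M.trueLaw e n)

/-- The Fisher information per observation at the true parameter. -/
def fisherInfo : Matrix (ParamIdx p e (M.dim n)) (ParamIdx p e (M.dim n)) ℝ := fun r s =>
  (n : ℝ)⁻¹ * ∑ i : Fin n,
    ∫ y, -partialDeriv r (partialDeriv s (M.logf i y)) (M.theta0 e n) ∂(M.trueLaw e n i)

/-- The densities have common support (they are positive), are three times continuously
differentiable in the parameter, and the model for the sample is identifiable for large `n`. -/
def CondC1 : Prop :=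
  (∀ n (i : Fin n), ∀ᵐ y ∂M.fam.base, ContDiffOn ℝ 3 (M.f i y) (interior (M.paramSpace e n))) ∧
  ∀ᶠ n in atTop, ∀ theta ∈ M.paramSpace e n, ∀ theta' ∈ M.paramSpace e n,
    (∀ i : Fin n, (fun y => M.f i y theta) =ᵐ[M.fam.base] fun y => M.f i y theta') →
      theta = theta'

/-- The covariates and the basis functions are uniformly bounded. -/
def CondC2 : Prop :=
  ∃ C1 : ℝ, ∀ n (i : Fin n), (∀ j, |M.x n i j| < C1) ∧ ∀ k, |M.z n i k| < C1

/-- The true parameter is an interior point, the expected score vanishes there, and the true linear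
predictors are uniformly bounded. -/
def CondC3 : Prop :=
  (∀ n, M.theta0 e n ∈ interior (M.paramSpace e n)) ∧
  (∀ n (i : Fin n) (r : ParamIdx p e (M.dim n)),
    Integrable (fun y => partialDeriv r (M.logf i y) (M.theta0 e n)) (M.trueLaw e n i) ∧
    ∫ y, partialDeriv r (M.logf i y) (M.theta0 e n) ∂(M.trueLaw e n i) = 0) ∧
  ∃ C2 : ℝ, ∀ n (i : Fin n), |linPred (M.x n i) (M.z n i) (M.theta0 e n)| < C2

/-- The Fisher information at the true parameter is finite, and its smallest eigenvalue is bounded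
away from zero for large `n`. -/
def CondC4 : Prop :=
  (∀ n (i : Fin n) (r s : ParamIdx p e (M.dim n)),
    Integrable (fun y => partialDeriv r (partialDeriv s (M.logf i y)) (M.theta0 e n))
      (M.trueLaw e n i)) ∧
  ∃ c : ℝ, 0 < c ∧ ∀ᶠ n in atTop, ∀ v : ParamIdx p e (M.dim n) → ℝ,
    c * (v ⬝ᵥ v) ≤ v ⬝ᵥ (M.fisherInfo e n *ᵥ v)

/-- On an open neighbourhood `U` of the true parameter the second and third derivatives of the
log-density have envelopes with uniformly bounded second moments.  As the parameter space changes
with `n`, the neighbourhood has to be large enough: it eventually contains every ball whose radius is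
a constant multiple of `(d / n) ^ (1 / 2)`. -/
def CondC5 : Prop :=
  ∃ (U : ∀ n, Set (Param p e (M.dim n))) (C3 C4 : ℝ),
    (∀ n, IsOpen (U n) ∧ M.theta0 e n ∈ U n ∧ U n ⊆ M.paramSpace e n) ∧
    (∀ C : ℝ, ∀ᶠ n in atTop,
      Metric.closedBall (M.theta0 e n) (C * Real.sqrt ((M.d n : ℝ) / n)) ⊆ U n) ∧
    ∀ n (i : Fin n), ∀ r s t : ParamIdx p e (M.dim n), ∃ F G : ℝ → ℝ,
      MemLp F 2 (M.trueLaw e n i) ∧ MemLp G 2 (M.trueLaw e n i) ∧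
      ∫ y, F y ^ 2 ∂(M.trueLaw e n i) < C3 ∧ ∫ y, G y ^ 2 ∂(M.trueLaw e n i) < C4 ∧
      ∀ᵐ y ∂M.fam.base, ∀ theta ∈ U n,
        |partialDeriv r (partialDeriv s (M.logf i y)) theta| ≤ F y ∧
        |partialDeriv r (partialDeriv s (partialDeriv t (M.logf i y))) theta| ≤ G y

/-- The growth condition `d = o(n ^ (1 / 4))`. -/
def CondC6 : Prop :=
  (fun n => (M.d n : ℝ)) =o[atTop] fun n : ℕ => (n : ℝ) ^ (1 / 4 : ℝ)

/-- The integrals in the variational log-likelihood exist: the log-density is integrable for every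
normal law of the smoothing coefficients. -/
def VariationalIntegrable : Prop :=
  ∀ n (i : Fin n) (y : ℝ), ∀ theta ∈ M.paramSpace e n,
    ∀ A : Matrix (BasisIdx (M.dim n)) (BasisIdx (M.dim n)) ℝ, A.PosDef →
      Integrable (fun beta => M.logf i y (withCoef theta beta))
        (multivariateGaussian (coef theta) A)

variable {e n}

/-- The variational log-likelihood of the sample `y` at the parametric part `Psi` and the variational
mean `a`, put together in `theta = (Psi, a)`, and the variational covariance matrix `A`.  Constants
that do not depend on `(Psi, a, A)` and on the smoothing parameters are omitted. -/
def varLogLik (y : Fin n → ℝ) (theta : Param p e (M.dim n))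
    (A : Matrix (BasisIdx (M.dim n)) (BasisIdx (M.dim n)) ℝ) : ℝ :=
  (∫ beta, ∑ i, M.logf i (y i) (withCoef theta beta) ∂(multivariateGaussian (coef theta) A))
    + 2⁻¹ * ∑ j : Fin q,
      ((M.dim n j : ℝ) * Real.log (M.lam n j)
        - M.lam n j *
          ((fun k => coef theta ⟨j, k⟩) ⬝ᵥ (M.S n j *ᵥ fun k => coef theta ⟨j, k⟩))
        - M.lam n j * (M.S n j * A.submatrix (Sigma.mk j) (Sigma.mk j)).trace)
    + 2⁻¹ * Real.log A.det

/-- `(theta, A)` is a variational estimate for the sample `y`: a local maximizer of the variational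
log-likelihood over the parameter space and the positive definite matrices. -/
def IsVAEstimate (y : Fin n → ℝ) (theta : Param p e (M.dim n))
    (A : Matrix (BasisIdx (M.dim n)) (BasisIdx (M.dim n)) ℝ) : Prop :=
  theta ∈ M.paramSpace e n ∧ A.PosDef ∧
  IsLocalMaxOn (fun w : Param p e (M.dim n) × Matrix (BasisIdx (M.dim n)) (BasisIdx (M.dim n)) ℝ =>
    M.varLogLik y w.1 w.2) (M.paramSpace e n ×ˢ {B | B.PosDef}) (theta, A)

end GAMSeq

end GAM

end

/-! The estimate arises as an interior maximum over a compact set: the pairs with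
$\|\theta-\theta^0\|\le\rho=C(d/n)^{1/2}$ and $A$ positive semidefinite with
$\operatorname{tr}A\le\tau=k^2d/n$. There, at positive definite $A$, the variational log-likelihood
is the log-likelihood at $\theta=(\Psi,a)$ plus a smoothing term, the penalty and $\frac12\ln\det A$
(`varLogLik_eq`). The determinant keeps a maximizer nonsingular. Hence it suffices that the value
increases from the sphere $\|\theta-\theta^0\|=\rho$ by moving to $\theta^0$ with $A$ kept, and from
the face $\operatorname{tr}A=\tau$ by halving $A$ (`exists_isLocalMaxOn_of_boundary`).

The smoothing term sees $A$ only through the variances $v_i=z_i^\top Az_i=O(d^2/n)$ of the linear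
predictors. A $C^3$ function $g$, integrable for all normal laws, has the mean $g(m)+\frac
v2g''(m)+O(v^{3/2})$ under $N(m,v)$ (`exists_gaussExcess_bound`), and linear predictors move by
$O(dn^{-1/2})$ in the ball. So the smoothing term is half the sum of $v_i$ times the curvature of
the $i$-th log-density at $\theta^0$, up to $O(d^3n^{-1/2})$. This main term does not depend on
$\theta$.

On the sphere the score contributes at most $Cgd$ with high probability and the information at most
$-\frac c4C^2d$. The cubic remainder and the smoothing error are $O(d^3n^{-1/2})$, which is $o(d)$
exactly because $d=o(n^{1/4})$; the penalty contributes $\rho\,o(n^{1/2})=o(d^{1/2})$. A large $C$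
wins (`logLik_sub_le`, `penalty_sub_le`). On the face the curvature sum is the inner product of $A$
with a block of the Hessian and is at most $-\frac{nc}2\tau$ (`sum_linVar_curv_le`). Halving $A$
gains $\frac18ck^2d$ and costs $\frac12d\ln2$, up to $o(d)$, so a large $k$ wins.

Several ingredients are not assumed but derived: smoothness and Gaussian integrability of the
canonical parameter and the cumulant function (`regular_of_conditions`), bounded first moments of
the responses (`exists_abs_moment_bound`), bounded second moments of the score
(`score_second_moment`) and a bounded norm of $\beta^0$ (`exists_coef_bound`). Since $C$ depends on
the tolerated error probability, one estimator for all levels is obtained by nearly minimizing the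
distance to $\theta^0$ among the VA estimates (`exists_select`). -/

noncomputable section

namespace GAM

/-! ### Taylor bounds on the unit interval. -/

section Taylor

variable {g g₁ g₂ g₃ : ℝ → ℝ} {C : ℝ}

theorem abs_sub_le_of_hasDerivAt (h : ∀ t ∈ Set.Icc (0 : ℝ) 1, HasDerivAt g (g₁ t) t)
    (hC : ∀ t ∈ Set.Icc (0 : ℝ) 1, |g₁ t| ≤ C) {t : ℝ} (ht : t ∈ Set.Icc (0 : ℝ) 1) :
    |g t - g 0| ≤ C := by
  have hC0 : 0 ≤ C := (abs_nonneg _).trans (hC 0 (by simp))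
  have := norm_image_sub_le_of_norm_deriv_le_segment' (f := g) (f' := g₁) (C := C)
    (fun x hx => (h x hx).hasDerivWithinAt) (fun x hx => hC x ⟨hx.1, hx.2.le⟩) t ht
  rw [Real.norm_eq_abs] at this
  nlinarith [ht.1, ht.2]

/-- The bound of lower order is applied to the function minus its Taylor polynomial. The factorials
in the remainder are given up, since only orders of magnitude matter later. -/
theorem taylor_one_bound (h₁ : ∀ t ∈ Set.Icc (0 : ℝ) 1, HasDerivAt g (g₁ t) t)
    (h₂ : ∀ t ∈ Set.Icc (0 : ℝ) 1, HasDerivAt g₁ (g₂ t) t)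
    (hC : ∀ t ∈ Set.Icc (0 : ℝ) 1, |g₂ t| ≤ C) {t : ℝ} (ht : t ∈ Set.Icc (0 : ℝ) 1) :
    |g t - g 0 - t * g₁ 0| ≤ C := by
  have := abs_sub_le_of_hasDerivAt (g := fun t => g t - t * g₁ 0) (g₁ := fun t => g₁ t - g₁ 0)
    (C := C) (fun t ht => ?_) (fun t ht => abs_sub_le_of_hasDerivAt h₂ hC ht) ht
  · simpa [sub_right_comm] using this
  · have := (h₁ t ht).sub ((hasDerivAt_id t).mul_const (g₁ 0))
    rw [one_mul] at this
    exact this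

theorem taylor_two_bound (h₁ : ∀ t ∈ Set.Icc (0 : ℝ) 1, HasDerivAt g (g₁ t) t)
    (h₂ : ∀ t ∈ Set.Icc (0 : ℝ) 1, HasDerivAt g₁ (g₂ t) t)
    (h₃ : ∀ t ∈ Set.Icc (0 : ℝ) 1, HasDerivAt g₂ (g₃ t) t)
    (hC : ∀ t ∈ Set.Icc (0 : ℝ) 1, |g₃ t| ≤ C) :
    |g 1 - g 0 - g₁ 0 - g₂ 0 / 2| ≤ C := by
  have := abs_sub_le_of_hasDerivAt (g := fun t => g t - t * g₁ 0 - t ^ 2 / 2 * g₂ 0)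
    (g₁ := fun t => g₁ t - g₁ 0 - t * g₂ 0)
    (C := C) (fun t ht => ?_) (fun t ht => taylor_one_bound h₂ h₃ hC ht)
    (t := 1) (by simp)
  · convert this using 2
    ring
  · have := ((h₁ t ht).sub ((hasDerivAt_id t).mul_const (g₁ 0))).sub
      ((((hasDerivAt_id t).pow 2).div_const 2).mul_const (g₂ 0))
    refine this.congr_deriv ?_
    simp only [id_eq]
    ring

end Taylor

/-! ### Gaussian averages of functions on the line. -/

/-- Integrability with respect to all nondegenerate normal laws on the line. -/
def GaussIntegrable (g : ℝ → ℝ) : Prop :=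
  ∀ (m : ℝ) (v : NNReal), v ≠ 0 → Integrable g (gaussianReal m v)

/-- The difference between the mean of `g` under the normal law with mean `m` and variance `v`, and
the value of `g` at `m`. -/
def gaussExcess (g : ℝ → ℝ) (m v : ℝ) : ℝ := ∫ x, g x ∂(gaussianReal m v.toNNReal) - g m

theorem GaussIntegrable.integrable {g : ℝ → ℝ} (hg : GaussIntegrable g) (m : ℝ) (v : NNReal) :
    Integrable g (gaussianReal m v) := by
  rcases eq_or_ne v 0 with rfl | hv
  · rw [gaussianReal_zero_var]
    exact integrable_dirac (by simp)
  · exact hg m v hv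

/-- The exponent is split in halves. One half is at most $-1/(4v)$, and its exponential is $O(v^2)$;
the other is at most $-(x-m)^2\le m^2-x^2/2$ because $4v\le1$. Tails are thus compared with one
fixed normal law, so integrability replaces any growth condition on the integrand. -/
theorem gaussianPDFReal_le_of_one_le {m v R x : ℝ} (hm : |m| ≤ R) (hv : 0 < v) (hv' : v ≤ 1 / 4)
    (hx : 1 ≤ |x - m|) :
    gaussianPDFReal m v.toNNReal x ≤
      32 * Real.exp (R ^ 2) * (v * √v) * gaussianPDFReal 0 1 x := by
  have hR : m ^ 2 ≤ R ^ 2 := by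
    rw [← sq_abs m]; gcongr
  have hx2 : 1 ≤ (x - m) ^ 2 := by
    rw [← sq_abs]; nlinarith
  have hsv : 0 < √v := Real.sqrt_pos.2 hv
  have key : -(x - m) ^ 2 / (2 * v) ≤ -(1 / (4 * v)) + (R ^ 2 + -x ^ 2 / 2) := by
    have e1 : -(x - m) ^ 2 / (2 * v) = -((x - m) ^ 2 / (4 * v)) - (x - m) ^ 2 / (4 * v) := by
      field_simp; ring
    have e2 : 1 / (4 * v) ≤ (x - m) ^ 2 / (4 * v) := by gcongr
    have e3 : (x - m) ^ 2 ≤ (x - m) ^ 2 / (4 * v) := by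
      rw [le_div_iff₀ (by positivity)]
      nlinarith
    rw [e1]
    nlinarith [sq_nonneg (x - 2 * m)]
  have hexp : Real.exp (-(1 / (4 * v))) ≤ 32 * v ^ 2 := by
    rw [Real.exp_neg]
    have h1 : (1 / (4 * v)) ^ 2 / 2 ≤ Real.exp (1 / (4 * v)) := by
      have := Real.quadratic_le_exp_of_nonneg (x := 1 / (4 * v)) (by positivity)
      have : 0 ≤ 1 / (4 * v) := by positivity
      linarith
    calc (Real.exp (1 / (4 * v)))⁻¹ ≤ ((1 / (4 * v)) ^ 2 / 2)⁻¹ := by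
          gcongr
      _ = 32 * v ^ 2 := by field_simp; norm_num
  rw [gaussianPDFReal, gaussianPDFReal, Real.coe_toNNReal _ hv.le]
  have e0 : √(2 * Real.pi * v) = √(2 * Real.pi) * √v := Real.sqrt_mul (by positivity) _
  have hp : 0 < √(2 * Real.pi) := by positivity
  calc (√(2 * Real.pi * v))⁻¹ * Real.exp (-(x - m) ^ 2 / (2 * v))
      ≤ (√(2 * Real.pi) * √v)⁻¹ *
          (Real.exp (-(1 / (4 * v))) * (Real.exp (R ^ 2) * Real.exp (-x ^ 2 / 2))) := by
        rw [e0, ← Real.exp_add, ← Real.exp_add]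
        gcongr
    _ ≤ (√(2 * Real.pi) * √v)⁻¹ *
          ((32 * v ^ 2) * (Real.exp (R ^ 2) * Real.exp (-x ^ 2 / 2))) := by gcongr
    _ = _ := by
        have : v ^ 2 = v * √v * √v := by rw [mul_assoc, Real.mul_self_sqrt hv.le]; ring
        rw [this]
        simp
        field_simp

/-- The variance $4v_0$, twice the largest admissible one, absorbs the shift of the mean. The result
is a common integrable majorant for dominated convergence near $(m_0,v_0)$. -/
theorem gaussianPDFReal_le_of_near {m₀ v₀ m v : ℝ} (x : ℝ) (hv₀ : 0 < v₀) (hm : |m - m₀| ≤ 1)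
    (hv : v₀ / 2 ≤ v) (hv' : v ≤ 2 * v₀) :
    gaussianPDFReal m v.toNNReal x ≤
      (√(2 * Real.pi * (v₀ / 2)))⁻¹ * Real.exp (1 / (4 * v₀)) * √(2 * Real.pi * (4 * v₀)) *
        gaussianPDFReal m₀ (4 * v₀).toNNReal x := by
  have hvp : 0 < v := by linarith
  rw [gaussianPDFReal, gaussianPDFReal, Real.coe_toNNReal _ hvp.le,
    Real.coe_toNNReal _ (by positivity)]
  have hp : 0 < √(2 * Real.pi * (4 * v₀)) := by positivity
  have hm2 : (m - m₀) ^ 2 ≤ 1 := by rw [← sq_abs]; nlinarith [abs_nonneg (m - m₀)]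
  have key : -(x - m) ^ 2 / (2 * v) ≤ 1 / (4 * v₀) + -(x - m₀) ^ 2 / (2 * (4 * v₀)) := by
    have e1 : (x - m) ^ 2 / (4 * v₀) ≤ (x - m) ^ 2 / (2 * v) := by
      exact div_le_div_of_nonneg_left (sq_nonneg _) (by positivity) (by linarith)
    have e2 : ((x - m₀) ^ 2 / 2 - 1) / (4 * v₀) ≤ (x - m) ^ 2 / (4 * v₀) := by
      gcongr
      nlinarith [sq_nonneg ((x - m) - (m - m₀))]
    have e3 : ((x - m₀) ^ 2 / 2 - 1) / (4 * v₀) =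
        -(1 / (4 * v₀) + -(x - m₀) ^ 2 / (2 * (4 * v₀))) := by
      field_simp; ring
    rw [neg_div]
    linarith
  calc (√(2 * Real.pi * v))⁻¹ * Real.exp (-(x - m) ^ 2 / (2 * v))
      ≤ (√(2 * Real.pi * (v₀ / 2)))⁻¹ *
          Real.exp (1 / (4 * v₀) + -(x - m₀) ^ 2 / (2 * (4 * v₀))) := by gcongr
    _ = _ := by
        rw [Real.exp_add]
        field_simp

theorem continuousAt_integral_gaussianReal {g : ℝ → ℝ} (hc : Continuous g)
    (hg : GaussIntegrable g) {m₀ v₀ : ℝ} (hv₀ : 0 < v₀) :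
    ContinuousAt (fun w : ℝ × ℝ => ∫ x, g x ∂(gaussianReal w.1 w.2.toNNReal)) (m₀, v₀) := by
  have hpos : ∀ᶠ w : ℝ × ℝ in 𝓝 (m₀, v₀), |w.1 - m₀| ≤ 1 ∧ v₀ / 2 ≤ w.2 ∧ w.2 ≤ 2 * v₀ := by
    have h1 : ∀ᶠ w : ℝ × ℝ in 𝓝 (m₀, v₀), |w.1 - m₀| < 1 :=
      (by fun_prop : Continuous fun w : ℝ × ℝ => |w.1 - m₀|).continuousAt.eventually_lt
        continuousAt_const (by simp)
    have h2 : ∀ᶠ w : ℝ × ℝ in 𝓝 (m₀, v₀), v₀ / 2 < w.2 :=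
      continuousAt_const.eventually_lt continuous_snd.continuousAt (by simp; linarith)
    have h3 : ∀ᶠ w : ℝ × ℝ in 𝓝 (m₀, v₀), w.2 < 2 * v₀ :=
      continuous_snd.continuousAt.eventually_lt continuousAt_const (by simp; linarith)
    filter_upwards [h1, h2, h3] with w a b c using ⟨a.le, b.le, c.le⟩
  have heq : (fun w : ℝ × ℝ => ∫ x, g x ∂(gaussianReal w.1 w.2.toNNReal)) =ᶠ[𝓝 (m₀, v₀)]
      fun w => ∫ x, gaussianPDFReal w.1 w.2.toNNReal x • g x := by
    filter_upwards [hpos] with w hw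
    exact integral_gaussianReal_eq_integral_smul (by
      simp only [ne_eq, Real.toNNReal_eq_zero, not_le]; linarith [hw.2.1])
  refine ContinuousAt.congr ?_ heq.symm
  set K := (√(2 * Real.pi * (v₀ / 2)))⁻¹ * Real.exp (1 / (4 * v₀)) * √(2 * Real.pi * (4 * v₀))
  have h4 : (4 * v₀).toNNReal ≠ 0 := by
    simp only [ne_eq, Real.toNNReal_eq_zero, not_le]; positivity
  refine continuousAt_of_dominated
    (bound := fun x => K * ‖gaussianPDFReal m₀ (4 * v₀).toNNReal x • g x‖) ?_ ?_ ?_ ?_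
  · exact Eventually.of_forall fun w =>
      ((measurable_gaussianPDFReal _ _).smul hc.measurable).aestronglyMeasurable
  · filter_upwards [hpos] with w hw
    refine Eventually.of_forall fun x => ?_
    rw [norm_smul, norm_smul, Real.norm_of_nonneg (gaussianPDFReal_nonneg _ _ _),
      Real.norm_of_nonneg (gaussianPDFReal_nonneg _ _ _), ← mul_assoc]
    gcongr
    exact gaussianPDFReal_le_of_near x hv₀ hw.1 hw.2.1 hw.2.2
  · refine Integrable.const_mul ?_ K
    refine Integrable.norm ?_
    have := hg m₀ _ h4
    rw [gaussianReal_of_var_ne_zero _ h4] at this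
    rw [integrable_withDensity_iff_integrable_smul' (measurable_gaussianPDF _ _)
      (Eventually.of_forall fun x => gaussianPDF_lt_top)] at this
    simpa only [toReal_gaussianPDF] using this
  · refine Eventually.of_forall fun x => ?_
    refine ContinuousAt.smul (f := fun w : ℝ × ℝ => gaussianPDFReal w.1 w.2.toNNReal x)
      (g := fun _ => g x) ?_ continuousAt_const
    unfold gaussianPDFReal
    have hcoe : Continuous fun w : ℝ × ℝ => ((w.2.toNNReal : NNReal) : ℝ) := by fun_prop
    have hv0 : ((v₀.toNNReal : NNReal) : ℝ) ≠ 0 := by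
      rw [Real.coe_toNNReal _ hv₀.le]; exact hv₀.ne'
    refine ContinuousAt.mul (ContinuousAt.inv₀ ?_ ?_) (ContinuousAt.rexp (ContinuousAt.div ?_ ?_ ?_))
    · exact (Real.continuous_sqrt.comp (continuous_const.mul hcoe)).continuousAt
    · simp only
      have : 0 < ((v₀.toNNReal : NNReal) : ℝ) := by rw [Real.coe_toNNReal _ hv₀.le]; exact hv₀
      positivity
    · fun_prop
    · exact (continuous_const.mul hcoe).continuousAt
    · simpa using hv0.symm ∘ Eq.symm

end GAM
end

/-! ### Expansion of Gaussian averages for small variance. -/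

noncomputable section

namespace GAM

theorem ContDiff.hasDerivAt_three {g : ℝ → ℝ} (hg : ContDiff ℝ 3 g) (x : ℝ) :
    HasDerivAt g (deriv g x) x ∧ HasDerivAt (deriv g) (deriv (deriv g) x) x ∧
      HasDerivAt (deriv (deriv g)) (deriv (deriv (deriv g)) x) x := by
  have h3 : ContDiff ℝ ((2 : ℕ∞) + 1) g := by exact_mod_cast hg
  have h2 : ContDiff ℝ 2 (deriv g) := (contDiff_succ_iff_deriv.1 h3).2.2
  have h2' : ContDiff ℝ ((1 : ℕ∞) + 1) (deriv g) := by exact_mod_cast h2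
  have h1 : ContDiff ℝ 1 (deriv (deriv g)) := (contDiff_succ_iff_deriv.1 h2').2.2
  exact ⟨(hg.differentiable (by norm_num) x).hasDerivAt,
    (h2.differentiable (by norm_num) x).hasDerivAt, (h1.differentiable (by norm_num) x).hasDerivAt⟩

theorem ContDiff.continuous_deriv_three {g : ℝ → ℝ} (hg : ContDiff ℝ 3 g) :
    Continuous (deriv g) ∧ Continuous (deriv (deriv g)) ∧
      Continuous (deriv (deriv (deriv g))) := by
  have h3 : ContDiff ℝ ((2 : ℕ∞) + 1) g := by exact_mod_cast hg
  have h2 : ContDiff ℝ 2 (deriv g) := (contDiff_succ_iff_deriv.1 h3).2.2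
  have h2' : ContDiff ℝ ((1 : ℕ∞) + 1) (deriv g) := by exact_mod_cast h2
  have h1 : ContDiff ℝ 1 (deriv (deriv g)) := (contDiff_succ_iff_deriv.1 h2').2.2
  exact ⟨h2.continuous, h1.continuous, h1.continuous_deriv le_rfl⟩

theorem exists_bound_of_continuous {g : ℝ → ℝ} (hg : Continuous g) (R : ℝ) :
    ∃ K, 0 ≤ K ∧ ∀ x, |x| ≤ R → |g x| ≤ K := by
  obtain ⟨K, hK⟩ := (isCompact_Icc (a := -R) (b := R)).exists_bound_of_continuousOn
    hg.continuousOn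
  refine ⟨max K 0, le_max_right _ _, fun x hx => le_max_of_le_left ?_⟩
  simpa using hK x (abs_le.1 hx)

theorem exists_lipschitz_of_continuous_deriv {g g' : ℝ → ℝ} (h : ∀ x, HasDerivAt g (g' x) x)
    (hg' : Continuous g') (R : ℝ) :
    ∃ K, 0 ≤ K ∧ ∀ x y, |x| ≤ R → |y| ≤ R → |g x - g y| ≤ K * |x - y| := by
  obtain ⟨K, hK0, hK⟩ := exists_bound_of_continuous hg' R
  refine ⟨K, hK0, fun x y hx hy => ?_⟩
  have := Convex.norm_image_sub_le_of_norm_hasDerivWithin_le (f := g) (f' := g') (C := K)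
    (s := Set.Icc (-R) R) (fun z _ => (h z).hasDerivWithinAt)
    (fun z hz => hK z (abs_le.2 hz)) (convex_Icc _ _) (abs_le.1 hy) (abs_le.1 hx)
  simpa using this

theorem taylor_three_le {g : ℝ → ℝ} (hg : ContDiff ℝ 3 g) {m x C : ℝ}
    (hC : ∀ z, |z - m| ≤ |x - m| → |deriv (deriv (deriv g)) z| ≤ C) :
    |g x - g m - deriv g m * (x - m) - deriv (deriv g) m / 2 * (x - m) ^ 2| ≤ C * |x - m| ^ 3 := by
  have hd := ContDiff.hasDerivAt_three hg
  have hl : ∀ t, HasDerivAt (fun t : ℝ => m + t * (x - m)) (x - m) t := fun t => by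
    simpa using ((hasDerivAt_id t).mul_const (x - m)).const_add m
  have := taylor_two_bound (g := fun t => g (m + t * (x - m)))
    (g₁ := fun t => deriv g (m + t * (x - m)) * (x - m))
    (g₂ := fun t => deriv (deriv g) (m + t * (x - m)) * (x - m) * (x - m))
    (g₃ := fun t => deriv (deriv (deriv g)) (m + t * (x - m)) * (x - m) * (x - m) * (x - m))
    (C := C * |x - m| ^ 3)
    (fun t _ => (hd (m + t * (x - m))).1.comp t (hl t))
    (fun t _ => ((hd (m + t * (x - m))).2.1.comp t (hl t)).mul_const _)
    (fun t _ => (((hd (m + t * (x - m))).2.2.comp t (hl t)).mul_const _).mul_const _)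
    (fun t ht => ?_)
  · convert this using 2
    simp
    ring
  · rw [abs_mul, abs_mul, abs_mul]
    have := hC (m + t * (x - m)) (by
      rw [add_sub_cancel_left, abs_mul, abs_of_nonneg ht.1]
      nlinarith [abs_nonneg (x - m), ht.2])
    calc _ ≤ C * |x - m| * |x - m| * |x - m| := by gcongr
      _ = _ := by ring

theorem integrable_sub_pow_gaussianReal (m : ℝ) (v : NNReal) (k : ℕ) :
    Integrable (fun x => |x - m| ^ k) (gaussianReal m v) := by
  have h : MemLp (fun x : ℝ => x - m) k (gaussianReal m v) :=
    (memLp_id_gaussianReal' (μ := m) (v := v) k (by simp)).sub (memLp_const m)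
  exact h.integrable_norm_pow'

theorem integral_abs_sub_pow_gaussianReal (m : ℝ) {v : ℝ} (hv : 0 ≤ v) (k : ℕ) :
    ∫ x, |x - m| ^ k ∂(gaussianReal m v.toNNReal) =
      √v ^ k * ∫ x, |x| ^ k ∂(gaussianReal 0 1) := by
  have h : gaussianReal m v.toNNReal = (gaussianReal 0 1).map (fun x => m + √v * x) := by
    have h1 := gaussianReal_map_const_mul (μ := 0) (v := 1) (√v)
    have h2 := gaussianReal_map_const_add (μ := √v * 0) (v := ⟨√v ^ 2, sq_nonneg _⟩ * 1) m
    erw [← h1, Measure.map_map (by fun_prop) (by fun_prop)] at h2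
    rw [show (fun x => m + √v * x) = (fun x => m + x) ∘ (fun x => √v * x) from rfl, h2]
    congr 1
    · simp
    · refine NNReal.eq ?_
      rw [Real.coe_toNNReal _ hv]
      change v = √v ^ 2 * 1
      rw [mul_one, Real.sq_sqrt hv]
  rw [h, integral_map (by fun_prop) (by fun_prop), ← integral_const_mul]
  refine integral_congr_ae (Eventually.of_forall fun x => ?_)
  simp only [add_sub_cancel_left, abs_mul, abs_of_nonneg (Real.sqrt_nonneg v)]
  ring

theorem integral_indicator_tail_le {g : ℝ → ℝ} (hg : GaussIntegrable g)
    {m v R : ℝ} (hm : |m| ≤ R) (hv : 0 < v) (hv' : v ≤ 1 / 4) :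
    ∫ x, Set.indicator {x | 1 ≤ |x - m|} (fun x => |g x|) x ∂(gaussianReal m v.toNNReal) ≤
      32 * Real.exp (R ^ 2) * (v * √v) * ∫ x, |g x| ∂(gaussianReal 0 1) := by
  have hv0 : v.toNNReal ≠ 0 := by simpa using hv
  have hset : MeasurableSet {x : ℝ | 1 ≤ |x - m|} := measurableSet_le (by fun_prop) (by fun_prop)
  rw [integral_gaussianReal_eq_integral_smul hv0,
    integral_gaussianReal_eq_integral_smul one_ne_zero, ← integral_const_mul]
  have hi : ∀ (m : ℝ) (v : NNReal), v ≠ 0 → ∀ f : ℝ → ℝ, Integrable f (gaussianReal m v) →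
      Integrable (fun x => gaussianPDFReal m v x • f x) := fun m v hv f hf => by
    rw [gaussianReal_of_var_ne_zero _ hv] at hf
    rw [integrable_withDensity_iff_integrable_smul' (measurable_gaussianPDF _ _)
      (Eventually.of_forall fun x => gaussianPDF_lt_top)] at hf
    simpa only [toReal_gaussianPDF] using hf
  refine integral_mono (hi _ _ hv0 _ ((hg _ _ hv0).abs.indicator hset))
    ((hi _ _ one_ne_zero _ (hg _ _ one_ne_zero).abs).const_mul _) fun x => ?_
  simp only [smul_eq_mul]
  by_cases hx : 1 ≤ |x - m|
  · rw [Set.indicator_of_mem (by exact hx), ← mul_assoc]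
    gcongr
    exact gaussianPDFReal_le_of_one_le hm hv hv' hx
  · rw [Set.indicator_of_notMem (by exact hx), mul_zero]
    have := gaussianPDFReal_nonneg 0 1 x
    positivity

/-- The linear Taylor term has mean zero and the quadratic one has mean $\frac v2g''(m)$. Within
distance 1 of $m$ the remainder is cubic, and the third absolute moment is of order $v^{3/2}$.
Farther away the Taylor polynomial is dominated by $|x-m|^3$, and $g$ itself is handled by the tail
comparison. -/
theorem exists_gaussExcess_bound {g : ℝ → ℝ} (hc : ContDiff ℝ 3 g) (hg : GaussIntegrable g)
    (R : ℝ) : ∃ K, 0 ≤ K ∧ ∀ m v, |m| ≤ R → 0 ≤ v → v ≤ 1 / 4 →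
      |gaussExcess g m v - v / 2 * deriv (deriv g) m| ≤ K * (v * √v) := by
  obtain ⟨c1, c2, c3⟩ := ContDiff.continuous_deriv_three hc
  obtain ⟨K0, hK0, hK0'⟩ := exists_bound_of_continuous hc.continuous R
  obtain ⟨K1, hK1, hK1'⟩ := exists_bound_of_continuous c1 R
  obtain ⟨K2, hK2, hK2'⟩ := exists_bound_of_continuous c2 R
  -- The radius is `R + 1` because the Taylor remainder is used at points within distance 1 of a
  -- mean in $[-R,R]$.
  obtain ⟨K3, hK3, hK3'⟩ := exists_bound_of_continuous c3 (R + 1)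
  set M3 := ∫ x, |x| ^ 3 ∂(gaussianReal 0 1)
  set N := ∫ x, |g x| ∂(gaussianReal 0 1)
  have hM3 : 0 ≤ M3 := integral_nonneg fun x => by positivity
  have hN : 0 ≤ N := integral_nonneg fun x => by positivity
  refine ⟨(K3 + (K0 + K1 + K2)) * M3 + 32 * Real.exp (R ^ 2) * N, by positivity,
    fun m v hm hv hv' => ?_⟩
  rcases hv.eq_or_lt with rfl | hv0
  · simp [gaussExcess]
  set ν := gaussianReal m v.toNNReal with hν
  have hset : MeasurableSet {x : ℝ | 1 ≤ |x - m|} := measurableSet_le (by fun_prop) (by fun_prop)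
  have ig : Integrable g ν := hg.integrable _ _
  have i3 : Integrable (fun x => |x - m| ^ 3) ν := integrable_sub_pow_gaussianReal m _ 3
  have i2 : Integrable (fun x => (x - m) ^ 2) ν := by
    simpa using integrable_sub_pow_gaussianReal m v.toNNReal 2
  have iid : Integrable (fun x => x) ν := by
    exact (memLp_id_gaussianReal' (μ := m) (v := v.toNNReal) 1 (by simp)).integrable le_rfl
  have i1 : Integrable (fun x => x - m) ν := iid.sub (integrable_const m)
  have e1 : ∫ x, (x - m) ∂ν = 0 := by
    rw [integral_sub iid (integrable_const m), hν, integral_id_gaussianReal]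
    simp
  have e2 : ∫ x, (x - m) ^ 2 ∂ν = v := by
    have := variance_fun_id_gaussianReal (μ := m) (v := v.toNNReal)
    rw [variance_eq_integral (by fun_prop), integral_id_gaussianReal,
      Real.coe_toNNReal _ hv] at this
    exact this
  set h : ℝ → ℝ := fun x =>
    g x - g m - deriv g m * (x - m) - deriv (deriv g) m / 2 * (x - m) ^ 2 with hh
  have eh : ∫ x, h x ∂ν = gaussExcess g m v - v / 2 * deriv (deriv g) m := by
    have j1 : Integrable (fun x => g x - g m) ν := ig.sub (integrable_const _)
    have j2 : Integrable (fun x => g x - g m - deriv g m * (x - m)) ν := j1.sub (i1.const_mul _)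
    simp only [hh]
    rw [integral_sub j2 (i2.const_mul _), integral_sub j1 (i1.const_mul _),
      integral_sub ig (integrable_const _), integral_const_mul, integral_const_mul, e1, e2,
      gaussExcess]
    simp
    ring
  have hb : ∀ x, |h x| ≤ (K3 + (K0 + K1 + K2)) * |x - m| ^ 3 +
      Set.indicator {x | 1 ≤ |x - m|} (fun x => |g x|) x := fun x => by
    by_cases hx : 1 ≤ |x - m|
    · rw [Set.indicator_of_mem (by exact hx)]
      have p1 : |x - m| ≤ |x - m| ^ 3 := by
        nlinarith [mul_nonneg (sub_nonneg.2 hx) (abs_nonneg (x - m))]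
      have p2 : |x - m| ^ 2 ≤ |x - m| ^ 3 := by nlinarith [sq_nonneg |x - m|]
      have p0 : 1 ≤ |x - m| ^ 3 := hx.trans p1
      have := hK0' m hm
      have := hK1' m hm
      have := hK2' m hm
      calc |h x| ≤ |g x| + |g m| + |deriv g m| * |x - m| + |deriv (deriv g) m| / 2 * |x - m| ^ 2 := by
            have a1 := abs_sub (g x - g m - deriv g m * (x - m)) (deriv (deriv g) m / 2 * (x - m) ^ 2)
            have a2 := abs_sub (g x - g m) (deriv g m * (x - m))
            have a3 := abs_sub (g x) (g m)
            simp only [abs_mul, abs_div, abs_pow, abs_two] at a1 a2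
            simp only [hh]
            linarith
        _ ≤ |g x| + K0 * |x - m| ^ 3 + K1 * |x - m| ^ 3 + K2 * |x - m| ^ 3 := by
            gcongr
            · nlinarith
            · nlinarith [abs_nonneg (deriv (deriv g) m)]
        _ ≤ _ := by nlinarith [mul_nonneg hK3 (zero_le_one.trans p0)]
    · rw [Set.indicator_of_notMem (by exact hx), add_zero]
      push Not at hx
      refine (taylor_three_le hc (C := K3) fun z hz => hK3' z ?_).trans ?_
      · have := abs_add_le (z - m) m
        rw [sub_add_cancel] at this
        linarith
      · gcongr
        linarith
  rw [← eh]
  calc |∫ x, h x ∂ν| ≤ ∫ x, |h x| ∂ν := abs_integral_le_integral_abs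
    _ ≤ ∫ x, ((K3 + (K0 + K1 + K2)) * |x - m| ^ 3 +
          Set.indicator {x | 1 ≤ |x - m|} (fun x => |g x|) x) ∂ν := by
        refine integral_mono_of_nonneg (Eventually.of_forall fun x => abs_nonneg _)
          ((i3.const_mul _).add (ig.abs.indicator hset)) (Eventually.of_forall hb)
    _ ≤ (K3 + (K0 + K1 + K2)) * (√v ^ 3 * M3) + 32 * Real.exp (R ^ 2) * (v * √v) * N := by
        rw [integral_add (i3.const_mul _) (ig.abs.indicator hset), integral_const_mul,
          integral_abs_sub_pow_gaussianReal m hv]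
        gcongr
        exact integral_indicator_tail_le hg hm hv0 hv'
    _ = _ := by
        have : √v ^ 3 = v * √v := by rw [pow_succ, Real.sq_sqrt hv]
        rw [this]; ring

/-- The variance 0 must be included, since the compact set of matrices contains singular ones. There
the normal law degenerates to a point mass and the expansion in $v$ gives continuity; at positive
variance it is dominated convergence. -/
theorem continuousOn_gaussExcess {g : ℝ → ℝ} (hc : ContDiff ℝ 3 g) (hg : GaussIntegrable g) :
    ContinuousOn (fun w : ℝ × ℝ => gaussExcess g w.1 w.2) {w | 0 ≤ w.2} := by
  rintro ⟨m₀, v₀⟩ (hv₀ : 0 ≤ v₀)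
  rcases hv₀.eq_or_lt with rfl | hv
  · obtain ⟨K, hK, hb⟩ := exists_gaussExcess_bound hc hg (|m₀| + 1)
    obtain ⟨K2, hK2, hb2⟩ := exists_bound_of_continuous
      (ContDiff.continuous_deriv_three hc).2.1 (|m₀| + 1)
    have h0 : gaussExcess g m₀ 0 = 0 := by simp [gaussExcess]
    rw [ContinuousWithinAt, h0]
    have hlim : Tendsto (fun w : ℝ × ℝ => |w.2| / 2 * K2 + K * (|w.2| * √w.2)) (𝓝 (m₀, 0))
        (𝓝 0) := by
      have : Continuous fun w : ℝ × ℝ => |w.2| / 2 * K2 + K * (|w.2| * √w.2) := by fun_prop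
      simpa using this.tendsto (m₀, 0)
    refine squeeze_zero_norm' ?_ (hlim.mono_left nhdsWithin_le_nhds)
    have n1 : ∀ᶠ w : ℝ × ℝ in 𝓝 (m₀, 0), |w.1| < |m₀| + 1 :=
      (by fun_prop : Continuous fun w : ℝ × ℝ => |w.1|).continuousAt.eventually_lt
        continuousAt_const (by simp)
    have n2 : ∀ᶠ w : ℝ × ℝ in 𝓝 (m₀, 0), w.2 < 1 / 4 :=
      continuous_snd.continuousAt.eventually_lt continuousAt_const (by simp)
    filter_upwards [self_mem_nhdsWithin, mem_nhdsWithin_of_mem_nhds n1,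
      mem_nhdsWithin_of_mem_nhds n2] with w (w0 : 0 ≤ w.2) w1 w2
    have e := hb w.1 w.2 (le_of_lt w1) w0 (le_of_lt w2)
    have e2 := hb2 w.1 (le_of_lt w1)
    rw [Real.norm_eq_abs, abs_of_nonneg w0]
    have e3 := abs_add_le (gaussExcess g w.1 w.2 - w.2 / 2 * deriv (deriv g) w.1)
      (w.2 / 2 * deriv (deriv g) w.1)
    rw [sub_add_cancel, abs_mul (w.2 / 2), abs_of_nonneg (by positivity : 0 ≤ w.2 / 2)] at e3
    have : w.2 / 2 * |deriv (deriv g) w.1| ≤ w.2 / 2 * K2 := by gcongr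
    linarith
  · refine ContinuousAt.continuousWithinAt ?_
    exact (continuousAt_integral_gaussianReal hc.continuous hg hv).sub
      (hc.continuous.comp continuous_fst).continuousAt

end GAM
end

/-! ### Linear predictors, partial derivatives and Taylor expansions in the parameter. -/

noncomputable section

namespace GAM

section Param

variable {p e q : ℕ} {D : Fin q → ℕ}

/-- The coefficients of the linear predictor in the full parameter. -/
def design (x : Fin p → ℝ) (z : BasisIdx D → ℝ) : ParamIdx p e D → ℝ :=
  Sum.elim x (Sum.elim (fun _ => 0) z)

theorem linPred_eq_sum (x : Fin p → ℝ) (z : BasisIdx D → ℝ) (θ : Param p e D) :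
    linPred x z θ = ∑ r, design x z r * θ r := by
  simp [linPred, design, Fintype.sum_sum_type]

/-- The linear predictor as a continuous linear map. -/
def linPredL (x : Fin p → ℝ) (z : BasisIdx D → ℝ) : Param p e D →L[ℝ] ℝ :=
  ∑ r, design x z r • EuclideanSpace.proj r

theorem linPredL_apply (x : Fin p → ℝ) (z : BasisIdx D → ℝ) (θ : Param p e D) :
    linPredL x z θ = linPred x z θ := by
  simp [linPredL, linPred_eq_sum]

theorem linPred_add_smul (x : Fin p → ℝ) (z : BasisIdx D → ℝ) (θ v : Param p e D) (t : ℝ) :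
    linPred x z (θ + t • v) = linPred x z θ + t * linPred x z v := by
  simp [← linPredL_apply]

theorem linPred_single (x : Fin p → ℝ) (z : BasisIdx D → ℝ) (r : ParamIdx p e D) :
    linPred x z (EuclideanSpace.single r 1) = design x z r := by
  simp [linPred_eq_sum]

theorem dispersion_add {φ₀ : ℝ} {v : Param p e D} (hv : ∀ l, v (Sum.inr (Sum.inl l)) = 0)
    (θ : Param p e D) : dispersion φ₀ (θ + v) = dispersion φ₀ θ := by
  unfold dispersion
  split_ifs with h
  · simp [hv]
  · rfl

theorem continuous_dispersion (φ₀ : ℝ) : Continuous (dispersion φ₀ : Param p e D → ℝ) := by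
  unfold dispersion
  split_ifs with h
  · fun_prop
  · fun_prop

theorem abs_dispersion_sub_le (φ₀ : ℝ) (θ θ' : Param p e D) :
    |dispersion φ₀ θ - dispersion φ₀ θ'| ≤ ‖θ - θ'‖ := by
  unfold dispersion
  split_ifs with h
  · exact PiLp.norm_apply_le (θ - θ') _
  · simp

theorem dispersion_withCoef (φ₀ : ℝ) (θ : Param p e D) (β : Coef D) :
    dispersion φ₀ (withCoef θ β) = dispersion φ₀ θ := rfl

theorem linPred_withCoef (x : Fin p → ℝ) (z : BasisIdx D → ℝ) (θ : Param p e D) (β : Coef D) :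
    linPred x z (withCoef θ β) = ∑ j, x j * θ (Sum.inl j) + ∑ k, z k * β k := rfl

/-- This reduces each integral over $\mathbb R^d$ in the variational log-likelihood to an integral
on the line. -/
theorem map_linPred_multivariateGaussian (x : Fin p → ℝ) (z : BasisIdx D → ℝ) (θ : Param p e D)
    {A : Matrix (BasisIdx D) (BasisIdx D) ℝ} (hA : A.PosSemidef) :
    (multivariateGaussian (coef θ) A).map (fun β => linPred x z (withCoef θ β)) =
      gaussianReal (linPred x z θ) (z ⬝ᵥ A *ᵥ z).toNNReal := by
  set L : StrongDual ℝ (Coef D) := innerSL ℝ (WithLp.toLp 2 z) with hL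
  have hLa : ∀ β : Coef D, L β = ∑ k, z k * β k := fun β => by
    simp [hL, PiLp.inner_apply, mul_comm]
  have h1 : (multivariateGaussian (coef θ) A).map L =
      gaussianReal (L (coef θ)) (z ⬝ᵥ A *ᵥ z).toNNReal := by
    rw [IsGaussian.map_eq_gaussianReal L]
    congr 2
    · rw [L.integral_comp_id_comm IsGaussian.integrable_id, integral_id_multivariateGaussian]
    · rw [← covariance_self (by fun_prop)]
      have h2 := covarianceBilin_apply_eq_cov (μ := multivariateGaussian (coef θ) A)
        IsGaussian.memLp_two_id (WithLp.toLp 2 z) (WithLp.toLp 2 z)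
      rw [covarianceBilin_multivariateGaussian hA] at h2
      exact h2.symm
  have h2 := gaussianReal_map_const_add (μ := L (coef θ)) (v := (z ⬝ᵥ A *ᵥ z).toNNReal)
    (∑ j, x j * θ (Sum.inl j))
  rw [← h1, Measure.map_map (by fun_prop) (by fun_prop)] at h2
  convert h2 using 2
  · ext β
    simp [linPred_withCoef, hLa]
  · rw [hLa]
    simp only [linPred, coef]
    ring

theorem fderiv_apply_of_hasDerivAt {F : Param p e D → ℝ} {θ v : Param p e D} {d : ℝ}
    (hF : DifferentiableAt ℝ F θ) (h : HasDerivAt (fun t : ℝ => F (θ + t • v)) d 0) :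
    fderiv ℝ F θ v = d :=
  (hF.hasFDerivAt.hasLineDerivAt v).unique h

theorem hasDerivAt_line {F : Param p e D → ℝ} {θ v : Param p e D} {t : ℝ}
    (hF : DifferentiableAt ℝ F (θ + t • v)) :
    HasDerivAt (fun t : ℝ => F (θ + t • v)) (∑ r, v r * partialDeriv r F (θ + t • v)) t := by
  have hl : HasDerivAt (fun t : ℝ => θ + t • v) v t := by
    simpa using ((hasDerivAt_id t).smul_const v).const_add θ
  have h := hF.hasFDerivAt.comp_hasDerivAt t hl
  have hv : v = ∑ r, v r • EuclideanSpace.single r (1 : ℝ) := by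
    ext s
    simp [-Fintype.sum_sum_type, Pi.single_apply]
  have e : fderiv ℝ F (θ + t • v) v = ∑ r, v r * partialDeriv r F (θ + t • v) := by
    conv_lhs => arg 2; rw [hv]
    rw [map_sum]
    simp [partialDeriv, -Fintype.sum_sum_type]
  rw [e] at h
  exact h

theorem contDiffOn_partialDeriv {F : Param p e D → ℝ} {O : Set (Param p e D)} {m : ℕ}
    (hF : ContDiffOn ℝ (m + 1 : ℕ) F O) (hO : IsOpen O) (r : ParamIdx p e D) :
    ContDiffOn ℝ m (partialDeriv r F) O :=
  (hF.fderiv_of_isOpen hO (by norm_cast)).clm_apply contDiffOn_const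

theorem ContDiffOn.differentiableAt_three {F : Param p e D → ℝ} {O : Set (Param p e D)}
    (hF : ContDiffOn ℝ 3 F O) (hO : IsOpen O) {θ : Param p e D} (hθ : θ ∈ O)
    (r s : ParamIdx p e D) : DifferentiableAt ℝ F θ ∧ DifferentiableAt ℝ (partialDeriv r F) θ ∧
      DifferentiableAt ℝ (partialDeriv s (partialDeriv r F)) θ := by
  have h3 : ContDiffOn ℝ (2 + 1 : ℕ) F O := by exact_mod_cast hF
  have h2 := contDiffOn_partialDeriv h3 hO r
  have h1 := contDiffOn_partialDeriv (m := 1) h2 hO s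
  exact ⟨(h3.contDiffAt (hO.mem_nhds hθ)).differentiableAt (by norm_num),
    (h2.contDiffAt (hO.mem_nhds hθ)).differentiableAt (by norm_num),
    (h1.contDiffAt (hO.mem_nhds hθ)).differentiableAt (by norm_num)⟩

/-- Restriction to the segment from $\theta$ to $\theta+u$. The indices of `G` appear reversed
because the derivative taken last stands outermost; symmetry of the partial derivatives is never
used. -/
theorem abs_taylor_two_le {F : Param p e D → ℝ} {O : Set (Param p e D)} (hF : ContDiffOn ℝ 3 F O)
    (hO : IsOpen O) {θ u : Param p e D} (hu : ∀ t ∈ Set.Icc (0 : ℝ) 1, θ + t • u ∈ O)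
    {G : ParamIdx p e D → ParamIdx p e D → ParamIdx p e D → ℝ}
    (hG : ∀ r s t, ∀ ϑ ∈ O, |partialDeriv r (partialDeriv s (partialDeriv t F)) ϑ| ≤ G r s t) :
    |F (θ + u) - F θ - ∑ r, u r * partialDeriv r F θ
      - (∑ r, ∑ s, u r * u s * partialDeriv s (partialDeriv r F) θ) / 2| ≤
      ∑ r, ∑ s, ∑ t, |u r| * |u s| * |u t| * G t s r := by
  have hd := fun t (ht : t ∈ Set.Icc (0 : ℝ) 1) r s =>
    ContDiffOn.differentiableAt_three hF hO (hu t ht) r s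
  have := taylor_two_bound (g := fun t : ℝ => F (θ + t • u))
    (g₁ := fun t => ∑ r, u r * partialDeriv r F (θ + t • u))
    (g₂ := fun t => ∑ r, ∑ s, u r * u s * partialDeriv s (partialDeriv r F) (θ + t • u))
    (g₃ := fun t => ∑ r, ∑ s, ∑ k, u r * u s * u k *
      partialDeriv k (partialDeriv s (partialDeriv r F)) (θ + t • u))
    (C := ∑ r, ∑ s, ∑ t, |u r| * |u s| * |u t| * G t s r) ?_ ?_ ?_ ?_
  · simpa only [one_smul, zero_smul, add_zero] using this
  · intro t ht
    refine hasDerivAt_line ?_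
    exact (hF.contDiffAt (hO.mem_nhds (hu t ht))).differentiableAt (by norm_num)
  · intro t ht
    refine HasDerivAt.fun_sum fun r _ => ?_
    have := (hasDerivAt_line (hd t ht r r).2.1).const_mul (u r)
    simpa only [Finset.mul_sum, mul_assoc] using this
  · intro t ht
    refine HasDerivAt.fun_sum fun r _ => HasDerivAt.fun_sum fun s _ => ?_
    have := (hasDerivAt_line (hd t ht r s).2.2).const_mul (u r * u s)
    simpa only [Finset.mul_sum, mul_assoc] using this
  · intro t ht
    refine (Finset.abs_sum_le_sum_abs _ _).trans (Finset.sum_le_sum fun r _ => ?_)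
    refine (Finset.abs_sum_le_sum_abs _ _).trans (Finset.sum_le_sum fun s _ => ?_)
    refine (Finset.abs_sum_le_sum_abs _ _).trans (Finset.sum_le_sum fun k _ => ?_)
    rw [abs_mul, abs_mul, abs_mul]
    gcongr
    exact hG k s r _ (hu t ht)

theorem abs_taylor_one_le {F : Param p e D → ℝ} {O : Set (Param p e D)} (hF : ContDiffOn ℝ 3 F O)
    (hO : IsOpen O) {θ : Param p e D} {r : ParamIdx p e D} {h K : ℝ}
    (hu : ∀ t ∈ Set.Icc (0 : ℝ) 1, θ + t • EuclideanSpace.single r h ∈ O)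
    (hK : ∀ ϑ ∈ O, |partialDeriv r (partialDeriv r F) ϑ| ≤ K) :
    |F (θ + EuclideanSpace.single r h) - F θ - h * partialDeriv r F θ| ≤ h ^ 2 * K := by
  have hd := fun t (ht : t ∈ Set.Icc (0 : ℝ) 1) =>
    ContDiffOn.differentiableAt_three hF hO (hu t ht) r r
  have := taylor_one_bound (g := fun t : ℝ => F (θ + t • EuclideanSpace.single r h))
    (g₁ := fun t => h * partialDeriv r F (θ + t • EuclideanSpace.single r h))
    (g₂ := fun t => h * (h * partialDeriv r (partialDeriv r F) (θ + t • EuclideanSpace.single r h)))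
    (C := h ^ 2 * K) ?_ ?_ ?_ (t := 1) (by simp)
  · simpa using this
  · intro t ht
    simpa [Pi.single_apply] using hasDerivAt_line (hd t ht).1
  · intro t ht
    simpa [Pi.single_apply] using (hasDerivAt_line (hd t ht).2.1).const_mul h
  · intro t ht
    rw [← mul_assoc, abs_mul, ← sq, abs_of_nonneg (sq_nonneg h)]
    gcongr
    exact hK _ (hu t ht)

end Param

end GAM
end

/-! ### Regularity of the family and the splitting of the variational log-likelihood. -/

noncomputable section

namespace GAM

namespace GAMSeq

variable {p q : ℕ} (M : GAMSeq p q) {e n : ℕ}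

/-- The cumulant function of the family in terms of the linear predictor. -/
def cumul (eta : ℝ) : ℝ := M.fam.b (M.fam.omega eta)

/-- The linear predictor of the `i`-th observation. -/
def eta (i : Fin n) (θ : Param p e (M.dim n)) : ℝ := linPred (M.x n i) (M.z n i) θ

theorem logf_eq (i : Fin n) (y : ℝ) (θ : Param p e (M.dim n)) :
    M.logf i y θ = (dispersion M.phi0 θ)⁻¹ * (y * M.fam.omega (M.eta i θ) - M.cumul (M.eta i θ))
      + M.fam.c y (dispersion M.phi0 θ) := rfl

theorem dispersion_theta0 : dispersion M.phi0 (M.theta0 e n) = M.phi0 := by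
  unfold dispersion theta0 mkParam
  split_ifs with h <;> rfl

theorem phi0_mem (h : M.theta0 e n ∈ M.paramSpace e n) : M.phi0 ∈ M.fam.dispSpace := by
  have h' : dispersion M.phi0 (M.theta0 e n) ∈ M.fam.dispSpace := h
  rwa [dispersion_theta0] at h'

theorem paramSpace_translate {v : Param p e (M.dim n)}
    (hv : ∀ l, v (Sum.inr (Sum.inl l)) = 0) {θ : Param p e (M.dim n)} :
    θ + v ∈ M.paramSpace e n ↔ θ ∈ M.paramSpace e n := by
  simp [paramSpace, dispersion_add hv]

theorem add_mem_interior_paramSpace {v : Param p e (M.dim n)}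
    (hv : ∀ l, v (Sum.inr (Sum.inl l)) = 0) {θ : Param p e (M.dim n)}
    (hθ : θ ∈ interior (M.paramSpace e n)) : θ + v ∈ interior (M.paramSpace e n) := by
  have h := (Homeomorph.addRight v).preimage_interior (M.paramSpace e n)
  have h2 : (Homeomorph.addRight v) ⁻¹' (M.paramSpace e n) = M.paramSpace e n := by
    ext θ
    exact M.paramSpace_translate hv
  rw [h2] at h
  rw [← h] at hθ
  exact hθ

theorem contDiffOn_logf {i : Fin n} {y : ℝ} {O : Set (Param p e (M.dim n))}
    (h : ContDiffOn ℝ 3 (M.f i y) O) : ContDiffOn ℝ 3 (M.logf i y) O := by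
  refine (h.log fun θ _ => (Real.exp_pos _).ne').congr fun θ _ => ?_
  simp [f]

/-- Different parameters give different laws of the sample of size `n`. -/
def IsIdentifiable (e n : ℕ) : Prop :=
  ∀ theta ∈ M.paramSpace e n, ∀ theta' ∈ M.paramSpace e n,
    (∀ i : Fin n, (fun y => M.f i y theta) =ᵐ[M.fam.base] fun y => M.f i y theta') →
      theta = theta'

theorem add_single_ne {θ : Param p e (M.dim n)} (r : ParamIdx p e (M.dim n)) {t : ℝ} (ht : t ≠ 0) :
    θ ≠ θ + t • EuclideanSpace.single r 1 := by
  intro h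
  have := congrArg (fun w : Param p e (M.dim n) => w r) h
  simp [ht] at this

theorem single_basis_disp (k : BasisIdx (M.dim n)) (t : ℝ) (l : Fin e) :
    (t • EuclideanSpace.single (Sum.inr (Sum.inr k)) 1 : Param p e (M.dim n))
      (Sum.inr (Sum.inl l)) = 0 := by
  simp

/-- If the `k`-th basis function vanished at all observations, a change of its coefficient would
leave every density unchanged. -/
theorem IsIdentifiable.exists_basis_ne_zero (h : M.IsIdentifiable e n)
    (h0 : M.theta0 e n ∈ M.paramSpace e n) (k : BasisIdx (M.dim n)) :
    ∃ i, M.z n i k ≠ 0 := by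
  by_contra! hz
  refine M.add_single_ne (θ := M.theta0 e n) (Sum.inr (Sum.inr k)) one_ne_zero
    (h _ h0 _ ((M.paramSpace_translate (M.single_basis_disp k 1)).2 h0) fun i => ?_)
  refine Eventually.of_forall fun y => ?_
  simp only [f, logf, dispersion_add (M.single_basis_disp k 1), linPred_add_smul, linPred_single]
  simp [design, hz]

/-- The parameter with the dispersion of `θ` and the linear predictor `t` at the `i`-th observation
that is obtained from `θ` by a change of the `k`-th coefficient. -/
def moveEta (θ : Param p e (M.dim n)) (i : Fin n) (k : BasisIdx (M.dim n)) (t : ℝ) :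
    Param p e (M.dim n) :=
  θ + ((t - M.eta i θ) / M.z n i k) • EuclideanSpace.single (Sum.inr (Sum.inr k)) 1

theorem eta_moveEta (θ : Param p e (M.dim n)) {i : Fin n} {k : BasisIdx (M.dim n)}
    (hz : M.z n i k ≠ 0) (t : ℝ) : M.eta i (M.moveEta θ i k t) = t := by
  unfold moveEta eta
  rw [linPred_add_smul, linPred_single]
  simp only [design, Sum.elim_inr]
  field_simp
  ring

theorem dispersion_moveEta (θ : Param p e (M.dim n)) (i : Fin n) (k : BasisIdx (M.dim n)) (t : ℝ) :
    dispersion M.phi0 (M.moveEta θ i k t) = dispersion M.phi0 θ :=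
  dispersion_add (M.single_basis_disp k _) _

/-- Moving one coefficient lets $\eta_i$ run through the line at fixed dispersion, so $t\mapsto
y\,\omega(t)-b(\omega(t))$ is $C^3$ for almost every $y$. Two different such $y$ separate the two
functions. If only one such $y$ existed, the dominating measure would sit at a single point,
normalization would fix the density there whatever the linear predictor, and identifiability would
fail. -/
theorem contDiff_omega_cumul (h0 : M.theta0 e n ∈ interior (M.paramSpace e n))
    (hid : M.IsIdentifiable e n) (k : BasisIdx (M.dim n))
    (hC : ∀ i : Fin n, ∀ᵐ y ∂M.fam.base, ContDiffOn ℝ 3 (M.f i y) (interior (M.paramSpace e n))) :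
    ContDiff ℝ 3 M.fam.omega ∧ ContDiff ℝ 3 M.cumul := by
  have h0' := interior_subset h0
  have hφm : M.phi0 ∈ M.fam.dispSpace := M.phi0_mem h0'
  have hφ : 0 < M.phi0 := M.fam.disp_pos _ hφm
  obtain ⟨i, hz⟩ := hid.exists_basis_ne_zero M h0' k
  set Y : Set ℝ := {y | ContDiffOn ℝ 3 (M.f i y) (interior (M.paramSpace e n))} with hY
  have hYae : ∀ᵐ y ∂M.fam.base, y ∈ Y := hC i
  have hsm : ∀ y ∈ Y, ContDiff ℝ 3 fun t => y * M.fam.omega t - M.cumul t := fun y hy => by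
    have h1 := M.contDiffOn_logf hy
    have h2 : ContDiff ℝ 3 fun t => M.moveEta (M.theta0 e n) i k t := by
      unfold moveEta
      fun_prop
    have h3 : ContDiff ℝ 3 (M.logf i y ∘ fun t => M.moveEta (M.theta0 e n) i k t) := by
      rw [← contDiffOn_univ]
      exact h1.comp h2.contDiffOn fun t _ =>
        M.add_mem_interior_paramSpace (M.single_basis_disp k _) h0
    have h4 : (fun t => y * M.fam.omega t - M.cumul t) = fun t => M.phi0 *
        ((M.logf i y ∘ fun t => M.moveEta (M.theta0 e n) i k t) t - M.fam.c y M.phi0) := by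
      ext t
      simp only [Function.comp_apply, logf_eq, M.eta_moveEta _ hz, M.dispersion_moveEta,
        dispersion_theta0]
      field_simp
      ring
    rw [h4]
    exact contDiff_const.mul (h3.sub contDiff_const)
  by_cases hex : ∃ y₁ ∈ Y, ∃ y₂ ∈ Y, y₁ ≠ y₂
  · obtain ⟨y₁, hy₁, y₂, hy₂, hne⟩ := hex
    have hω : ContDiff ℝ 3 M.fam.omega := by
      have h5 : M.fam.omega = fun t => (y₁ - y₂)⁻¹ * ((y₁ * M.fam.omega t - M.cumul t) -
          (y₂ * M.fam.omega t - M.cumul t)) := by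
        ext t
        have := sub_ne_zero.2 hne
        field_simp
        ring
      rw [h5]
      exact contDiff_const.mul ((hsm _ hy₁).sub (hsm _ hy₂))
    refine ⟨hω, ?_⟩
    have h6 : M.cumul = fun t => y₁ * M.fam.omega t - (y₁ * M.fam.omega t - M.cumul t) := by
      ext t; ring
    rw [h6]
    exact (contDiff_const.mul hω).sub (hsm _ hy₁)
  · push Not at hex
    exfalso
    have hb : M.fam.base ≠ 0 := fun hb => by
      have := M.fam.lintegral_density _ hφm 0
      simp [hb] at this
    have : (ae M.fam.base).NeBot := ae_neBot.2 hb
    obtain ⟨y₁, hy₁⟩ := hYae.exists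
    have hae : ∀ᵐ y ∂M.fam.base, y = y₁ := hYae.mono fun y hy => hex y hy y₁ hy₁
    have hone : ∀ t, ENNReal.ofReal (Real.exp (M.fam.logDensity y₁ M.phi0 t)) *
        M.fam.base Set.univ = 1 := fun t => by
      rw [← M.fam.lintegral_density _ hφm t, ← lintegral_const]
      refine lintegral_congr_ae (hae.mono fun y hy => ?_)
      simp only [hy, ExpFamily.logDensity]
    have hu0 : M.fam.base Set.univ ≠ 0 := fun h => by simpa [h] using hone 0
    have hut : M.fam.base Set.univ ≠ ⊤ := fun h => by
      have := hone 0
      rw [h, ENNReal.mul_top (by simpa using Real.exp_pos _)] at this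
      simp at this
    have hconst : ∀ s t, M.fam.logDensity y₁ M.phi0 s = M.fam.logDensity y₁ M.phi0 t := by
      intro s t
      have h7 := (hone s).trans (hone t).symm
      rw [ENNReal.mul_left_inj hu0 hut,
        ENNReal.ofReal_eq_ofReal_iff (Real.exp_pos _).le (Real.exp_pos _).le] at h7
      exact Real.exp_injective h7
    refine M.add_single_ne (θ := M.theta0 e n) (Sum.inr (Sum.inr k)) one_ne_zero
      (hid _ h0' _ ((M.paramSpace_translate (M.single_basis_disp k 1)).2 h0') fun i => ?_)
    filter_upwards [hae] with y hy
    simp only [f, logf, dispersion_add (M.single_basis_disp k 1), dispersion_theta0, hy]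
    rw [hconst]

theorem integral_linPred_eq (i : Fin n) (θ : Param p e (M.dim n))
    {A : Matrix (BasisIdx (M.dim n)) (BasisIdx (M.dim n)) ℝ} (hA : A.PosSemidef) {g : ℝ → ℝ}
    (hg : Continuous g) :
    ∫ β, g (M.eta i (withCoef θ β)) ∂(multivariateGaussian (coef θ) A) =
      ∫ t, g t ∂(gaussianReal (M.eta i θ) (M.z n i ⬝ᵥ A *ᵥ M.z n i).toNNReal) := by
  unfold eta
  rw [← map_linPred_multivariateGaussian _ _ _ hA, integral_map _ hg.aestronglyMeasurable]
  simp only [linPred_withCoef]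
  fun_prop

theorem integrable_linPred_iff (i : Fin n) (θ : Param p e (M.dim n))
    {A : Matrix (BasisIdx (M.dim n)) (BasisIdx (M.dim n)) ℝ} (hA : A.PosSemidef) {g : ℝ → ℝ}
    (hg : Continuous g) :
    Integrable g (gaussianReal (M.eta i θ) (M.z n i ⬝ᵥ A *ᵥ M.z n i).toNNReal) ↔
      Integrable (fun β => g (M.eta i (withCoef θ β))) (multivariateGaussian (coef θ) A) := by
  unfold eta
  rw [← map_linPred_multivariateGaussian _ _ _ hA, integrable_map_measure hg.aestronglyMeasurable]
  · rfl
  · simp only [linPred_withCoef]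
    fun_prop

/-- A suitable multiple of the identity gives $\eta_i$ any positive variance, and a shift of one
coefficient gives it any mean. The responses `y = 0` and `y = 1` then separate the two functions. -/
theorem gaussIntegrable_omega_cumul (hint : M.VariationalIntegrable e)
    (h0 : M.theta0 e n ∈ M.paramSpace e n) {i : Fin n} {k : BasisIdx (M.dim n)}
    (hz : M.z n i k ≠ 0) (hω : Continuous M.fam.omega) (hB : Continuous M.cumul) :
    GaussIntegrable M.fam.omega ∧ GaussIntegrable M.cumul := by
  have hφm : M.phi0 ∈ M.fam.dispSpace := M.phi0_mem h0
  have hφ : 0 < M.phi0 := M.fam.disp_pos _ hφm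
  have hz0 : 0 < M.z n i ⬝ᵥ M.z n i := by
    refine lt_of_le_of_ne (Finset.sum_nonneg fun _ _ => mul_self_nonneg _) fun h => hz ?_
    rw [eq_comm, dotProduct_self_eq_zero] at h
    simp [h]
  have key : ∀ (m : ℝ) (v : NNReal), v ≠ 0 → ∀ y,
      Integrable (fun t => y * M.fam.omega t - M.cumul t) (gaussianReal m v) := by
    intro m v hv y
    set θ := M.moveEta (M.theta0 e n) i k m
    have hθ : θ ∈ M.paramSpace e n := (M.paramSpace_translate (M.single_basis_disp k _)).2 h0
    set A : Matrix (BasisIdx (M.dim n)) (BasisIdx (M.dim n)) ℝ :=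
      ((v : ℝ) / (M.z n i ⬝ᵥ M.z n i)) • 1 with hAdef
    have hv0 : 0 < (v : ℝ) := by positivity
    have hA : A.PosDef := Matrix.PosDef.one.smul (by positivity)
    have h1 := hint n i y θ hθ A hA
    have h2 : (M.z n i ⬝ᵥ A *ᵥ M.z n i).toNNReal = v := by
      rw [hAdef, Matrix.smul_mulVec, Matrix.one_mulVec, dotProduct_smul, smul_eq_mul,
        div_mul_cancel₀ _ hz0.ne', Real.toNNReal_coe]
    have h3 := (M.integrable_linPred_iff (g := fun t => y * M.fam.omega t - M.cumul t) i θ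
      hA.posSemidef (by fun_prop)).2 ?_
    · rw [h2, M.eta_moveEta _ hz] at h3
      exact h3
    · have h4 := (h1.sub (integrable_const (M.fam.c y M.phi0))).const_mul M.phi0
      refine h4.congr (Eventually.of_forall fun β => ?_)
      have h5 : dispersion M.phi0 (withCoef θ β) = M.phi0 := by
        rw [dispersion_withCoef, M.dispersion_moveEta, dispersion_theta0]
      simp only [Pi.sub_apply, logf_eq, h5]
      field_simp
      ring
  refine ⟨fun m v hv => ?_, fun m v hv => ?_⟩
  · refine ((key m v hv 1).sub (key m v hv 0)).congr (Eventually.of_forall fun t => ?_)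
    simp
  · refine (key m v hv 0).neg.congr (Eventually.of_forall fun t => ?_)
    simp

/-- The smoothness and integrability of the family that follow from the assumptions. -/
structure Regular : Prop where
  omega : ContDiff ℝ 3 M.fam.omega
  cumul : ContDiff ℝ 3 M.cumul
  int_omega : GaussIntegrable M.fam.omega
  int_cumul : GaussIntegrable M.cumul

theorem regular_of_conditions (hq : 0 < q) (hdim : ∀ n j, 0 < M.dim n j)
    (hint : M.VariationalIntegrable e) (h1 : M.CondC1 e) (h3 : M.CondC3 e) : M.Regular := by
  obtain ⟨n, hn⟩ := h1.2.exists
  have hid : M.IsIdentifiable e n := hn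
  set k : BasisIdx (M.dim n) := ⟨⟨0, hq⟩, ⟨0, hdim n _⟩⟩
  have hs := M.contDiff_omega_cumul (h3.1 n) hid k (h1.1 n)
  obtain ⟨i, hz⟩ := hid.exists_basis_ne_zero M (interior_subset (h3.1 n)) k
  have hi := M.gaussIntegrable_omega_cumul hint (interior_subset (h3.1 n)) hz hs.1.continuous
    hs.2.continuous
  exact ⟨hs.1, hs.2, hi.1, hi.2⟩

/-- The variance of the `i`-th linear predictor under the variational law. -/
def linVar (i : Fin n) (A : Matrix (BasisIdx (M.dim n)) (BasisIdx (M.dim n)) ℝ) : ℝ :=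
  M.z n i ⬝ᵥ A *ᵥ M.z n i

/-- The change of the log-likelihood by averaging over the variational law. -/
def smoothing (y : Fin n → ℝ) (θ : Param p e (M.dim n))
    (A : Matrix (BasisIdx (M.dim n)) (BasisIdx (M.dim n)) ℝ) : ℝ :=
  ∑ i, (dispersion M.phi0 θ)⁻¹ * (y i * gaussExcess M.fam.omega (M.eta i θ) (M.linVar i A)
    - gaussExcess M.cumul (M.eta i θ) (M.linVar i A))

/-- The penalty terms of the variational log-likelihood. -/
def penalty (θ : Param p e (M.dim n))
    (A : Matrix (BasisIdx (M.dim n)) (BasisIdx (M.dim n)) ℝ) : ℝ :=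
  2⁻¹ * ∑ j : Fin q,
    ((M.dim n j : ℝ) * Real.log (M.lam n j)
      - M.lam n j *
        ((fun k => coef θ ⟨j, k⟩) ⬝ᵥ (M.S n j *ᵥ fun k => coef θ ⟨j, k⟩))
      - M.lam n j * (M.S n j * A.submatrix (Sigma.mk j) (Sigma.mk j)).trace)

theorem varLogLik_eq (hM : M.Regular) (hint : M.VariationalIntegrable e) (y : Fin n → ℝ)
    {θ : Param p e (M.dim n)} (hθ : θ ∈ M.paramSpace e n)
    {A : Matrix (BasisIdx (M.dim n)) (BasisIdx (M.dim n)) ℝ} (hA : A.PosDef) :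
    M.varLogLik y θ A = ∑ i, M.logf i (y i) θ + M.smoothing y θ A + M.penalty θ A
      + 2⁻¹ * Real.log A.det := by
  have h1 : ∫ β, ∑ i, M.logf i (y i) (withCoef θ β) ∂(multivariateGaussian (coef θ) A) =
      ∑ i, M.logf i (y i) θ + M.smoothing y θ A := by
    rw [integral_finsetSum _ fun i _ => hint n i (y i) θ hθ A hA, smoothing,
      ← Finset.sum_add_distrib]
    refine Finset.sum_congr rfl fun i _ => ?_
    simp only [logf_eq, dispersion_withCoef]
    have i1 := (M.integrable_linPred_iff i θ hA.posSemidef hM.omega.continuous).1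
      (hM.int_omega.integrable _ _)
    have i2 := (M.integrable_linPred_iff i θ hA.posSemidef hM.cumul.continuous).1
      (hM.int_cumul.integrable _ _)
    have i3 : Integrable (fun β => y i * M.fam.omega (M.eta i (withCoef θ β)) -
        M.cumul (M.eta i (withCoef θ β))) (multivariateGaussian (coef θ) A) :=
      (i1.const_mul _).sub i2
    rw [integral_add (i3.const_mul _) (integrable_const _), integral_const_mul, integral_sub (i1.const_mul _) i2, integral_const_mul,
      M.integral_linPred_eq i θ hA.posSemidef hM.omega.continuous,
      M.integral_linPred_eq i θ hA.posSemidef hM.cumul.continuous]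
    simp [gaussExcess, linVar]
    ring
  rw [varLogLik, h1, penalty]

end GAMSeq

end GAM
end

/-! ### Second moments from likelihood ratios, and Markov bounds for independent sums. -/

noncomputable section

namespace GAM

section Bartlett

theorem tendsto_exp_remainder_div_sq {u h : ℕ → ℝ} {s F : ℝ} (hpos : ∀ k, 0 < h k)
    (h0 : Tendsto h atTop (𝓝 0)) (hle : ∀ k, |u k - h k * s| ≤ h k ^ 2 * F) :
    Tendsto (fun k => (Real.exp (u k) - 1 - u k) / h k ^ 2) atTop (𝓝 (s ^ 2 / 2)) := by
  have t1 : Tendsto (fun k => u k / h k) atTop (𝓝 s) := by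
    rw [tendsto_iff_norm_sub_tendsto_zero]
    have : Tendsto (fun k => h k * F) atTop (𝓝 0) := by simpa using h0.mul_const F
    refine squeeze_zero (fun k => norm_nonneg _) (fun k => ?_) this
    have e : u k / h k - s = (u k - h k * s) / h k := by
      field_simp [(hpos k).ne']
    rw [e, norm_div, Real.norm_eq_abs, Real.norm_of_nonneg (hpos k).le, div_le_iff₀ (hpos k)]
    linarith [hle k, show h k ^ 2 * F = h k * F * h k by ring]
  have t2 : Tendsto u atTop (𝓝 0) := by
    have := t1.mul h0
    rw [mul_zero] at this
    refine this.congr fun k => ?_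
    field_simp [(hpos k).ne']
  have t3 : Tendsto (fun k => (u k / h k) ^ 2 / 2) atTop (𝓝 (s ^ 2 / 2)) := (t1.pow 2).div_const 2
  have t4 : Tendsto (fun k => (u k / h k) ^ 2 * |u k|) atTop (𝓝 0) := by
    simpa using (t1.pow 2).mul t2.abs
  have t5 : Tendsto (fun k => (Real.exp (u k) - 1 - u k) / h k ^ 2 - (u k / h k) ^ 2 / 2) atTop
      (𝓝 0) := by
    refine squeeze_zero_norm' ?_ t4
    have : ∀ᶠ k in atTop, |u k| < 1 := by
      have := t2.abs
      rw [abs_zero] at this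
      exact this.eventually_lt_const one_pos
    filter_upwards [this] with k hk
    have hb := Real.exp_bound hk.le (n := 3) (by norm_num)
    have e : (Real.exp (u k) - 1 - u k) / h k ^ 2 - (u k / h k) ^ 2 / 2 =
        (Real.exp (u k) - ∑ m ∈ Finset.range 3, u k ^ m / m.factorial) / h k ^ 2 := by
      simp [Finset.sum_range_succ, Nat.factorial]
      field_simp [(hpos k).ne']
      ring
    have hh : 0 < h k ^ 2 := pow_pos (hpos k) 2
    rw [e, norm_div, Real.norm_of_nonneg hh.le, div_le_iff₀ hh, Real.norm_eq_abs]
    refine hb.trans ?_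
    have e2 : (u k / h k) ^ 2 * |u k| * h k ^ 2 = |u k| ^ 3 := by
      rw [pow_succ |u k|, sq_abs]
      field_simp [(hpos k).ne']
    rw [e2]
    refine mul_le_of_le_one_right (by positivity) ?_
    norm_num [Nat.factorial]
  simpa using t5.add t3

/-- If the likelihood ratios `exp (u k)` along a path have integral one and `u k` has the derivative
`s` with mean zero and a remainder bounded by `h k ^ 2 * F`, then `s` has a second moment, bounded by
twice the mean of `F`. -/
theorem memLp_two_of_exp_expansion {Ω : Type*} [MeasurableSpace Ω] {μ : Measure Ω}
    [IsProbabilityMeasure μ] {u : ℕ → Ω → ℝ} {h : ℕ → ℝ} {s F : Ω → ℝ}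
    (hu : ∀ k, Measurable (u k)) (hpos : ∀ k, 0 < h k) (h0 : Tendsto h atTop (𝓝 0))
    (hs : Integrable s μ) (hs0 : ∫ y, s y ∂μ = 0) (hF : Integrable F μ)
    (hexp : ∀ k, ∫⁻ y, ENNReal.ofReal (Real.exp (u k y)) ∂μ = 1)
    (hle : ∀ k, ∀ᵐ y ∂μ, |u k y - h k * s y| ≤ h k ^ 2 * F y) :
    MemLp s 2 μ ∧ ∫ y, s y ^ 2 ∂μ ≤ 2 * ∫ y, F y ∂μ := by
  -- The nonnegative function $e^u-1-u$ has the integral $-\int u=-\int(u-hs)\le h^2\int F$, because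
  -- the likelihood ratio integrates to one and $s$ is centered. Divided by $h^2$ it tends to
  -- $s^2/2$ pointwise, and Fatou's lemma concludes.
  have hφ0 : ∀ x : ℝ, 0 ≤ Real.exp x - 1 - x := fun x => by linarith [Real.add_one_le_exp x]
  have hbound : ∀ k, ∫⁻ y, ENNReal.ofReal ((Real.exp (u k y) - 1 - u k y) / h k ^ 2) ∂μ ≤
      ENNReal.ofReal (∫ y, F y ∂μ) := by
    intro k
    have hh : 0 < h k ^ 2 := pow_pos (hpos k) 2
    have ie : Integrable (fun y => Real.exp (u k y)) μ := by
      refine ⟨(hu k).exp.aestronglyMeasurable, ?_⟩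
      rw [hasFiniteIntegral_iff_ofReal (Eventually.of_forall fun y => (Real.exp_pos _).le), hexp k]
      simp
    have e1 : ∫ y, Real.exp (u k y) ∂μ = 1 := by
      rw [integral_eq_lintegral_of_nonneg_ae (Eventually.of_forall fun y => (Real.exp_pos _).le)
        ie.aestronglyMeasurable, hexp k]
      simp
    have ir : Integrable (fun y => u k y - h k * s y) μ :=
      (hF.const_mul (h k ^ 2)).mono'
        ((hu k).aestronglyMeasurable.sub (hs.const_mul _).aestronglyMeasurable) (hle k)
    have iu : Integrable (u k) μ := by
      refine (ir.add (hs.const_mul (h k))).congr (Eventually.of_forall fun y => ?_)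
      simp
    have e2 : ∫ y, u k y ∂μ = ∫ y, (u k y - h k * s y) ∂μ := by
      rw [integral_sub iu (hs.const_mul _), integral_const_mul, hs0]
      simp
    have e3 : -∫ y, (u k y - h k * s y) ∂μ ≤ h k ^ 2 * ∫ y, F y ∂μ := by
      rw [← integral_neg, ← integral_const_mul]
      refine integral_mono_ae ir.neg (hF.const_mul _) ?_
      filter_upwards [hle k] with y hy
      exact (neg_le_abs _).trans hy
    have i1 : Integrable (fun y => Real.exp (u k y) - 1) μ := ie.sub (integrable_const 1)
    have i2 : Integrable (fun y => Real.exp (u k y) - 1 - u k y) μ := i1.sub iu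
    rw [← ofReal_integral_eq_lintegral_ofReal (i2.div_const _)
      (Eventually.of_forall fun y => div_nonneg (hφ0 _) hh.le)]
    refine ENNReal.ofReal_le_ofReal ?_
    rw [integral_div, div_le_iff₀ hh, integral_sub i1 iu, integral_sub ie (integrable_const 1), e1,
      e2]
    simp only [integral_const, probReal_univ, smul_eq_mul, mul_one]
    linarith
  have hfatou : ∫⁻ y, ENNReal.ofReal (s y ^ 2 / 2) ∂μ ≤ ENNReal.ofReal (∫ y, F y ∂μ) := by
    calc ∫⁻ y, ENNReal.ofReal (s y ^ 2 / 2) ∂μ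
        = ∫⁻ y, liminf (fun k => ENNReal.ofReal ((Real.exp (u k y) - 1 - u k y) / h k ^ 2)) atTop
            ∂μ := by
          refine lintegral_congr_ae ?_
          filter_upwards [ae_all_iff.2 hle] with y hy
          exact ((ENNReal.tendsto_ofReal
            (tendsto_exp_remainder_div_sq hpos h0 hy)).liminf_eq).symm
      _ ≤ liminf (fun k => ∫⁻ y, ENNReal.ofReal ((Real.exp (u k y) - 1 - u k y) / h k ^ 2) ∂μ)
            atTop := lintegral_liminf_le fun k => by
          have := hu k
          fun_prop
      _ ≤ liminf (fun _ : ℕ => ENNReal.ofReal (∫ y, F y ∂μ)) atTop :=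
          liminf_le_liminf (Eventually.of_forall hbound)
      _ = _ := liminf_const _
  have hF0 : 0 ≤ ∫ y, F y ∂μ := by
    refine integral_nonneg_of_ae ?_
    filter_upwards [hle 0] with y hy
    have := (abs_nonneg _).trans hy
    exact nonneg_of_mul_nonneg_right this (pow_pos (hpos 0) 2)
  have i1 : Integrable (fun y => s y ^ 2 / 2) μ := by
    refine ⟨((hs.aestronglyMeasurable.pow 2).mul_const 2⁻¹).congr
      (Eventually.of_forall fun y => by simp [div_eq_mul_inv]), ?_⟩
    rw [hasFiniteIntegral_iff_ofReal (Eventually.of_forall fun y => by positivity)]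
    exact hfatou.trans_lt ENNReal.ofReal_lt_top
  refine ⟨(memLp_two_iff_integrable_sq hs.aestronglyMeasurable).2 ?_, ?_⟩
  · refine (i1.const_mul 2).congr (Eventually.of_forall fun y => ?_)
    simp only
    ring
  · have e1 : ∫ y, s y ^ 2 / 2 ∂μ ≤ ∫ y, F y ∂μ := by
      rw [← ofReal_integral_eq_lintegral_ofReal i1 (Eventually.of_forall fun y => by positivity)]
        at hfatou
      exact (ENNReal.ofReal_le_ofReal_iff hF0).1 hfatou
    rw [integral_div] at e1
    linarith

end Bartlett

section Product

variable {ι : Type*} [Fintype ι] {ν : ι → Measure ℝ} [∀ i, IsProbabilityMeasure (ν i)]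

theorem integral_sum_sq_pi_le {X : ι → ℝ → ℝ} (hX : ∀ i, MemLp (X i) 2 (ν i))
    (h0 : ∀ i, ∫ y, X i y ∂(ν i) = 0) {K : ℝ} (hK : ∀ i, ∫ y, X i y ^ 2 ∂(ν i) ≤ K) :
    Integrable (fun y : ι → ℝ => (∑ i, X i (y i)) ^ 2) (Measure.pi ν) ∧
      ∫ y, (∑ i, X i (y i)) ^ 2 ∂(Measure.pi ν) ≤ Fintype.card ι * K := by
  have hm : ∀ i, MemLp (fun y : ι → ℝ => X i (y i)) 2 (Measure.pi ν) := fun i =>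
    (hX i).comp_measurePreserving (measurePreserving_eval ν i)
  have hs : MemLp (∑ i, fun y : ι → ℝ => X i (y i)) 2 (Measure.pi ν) := memLp_finsetSum' _
    fun i _ => hm i
  have hfun : (∑ i, fun y : ι → ℝ => X i (y i)) = fun y => ∑ i, X i (y i) := by
    ext y; simp
  have hmean : ∫ y, (∑ i, fun y : ι → ℝ => X i (y i)) y ∂(Measure.pi ν) = 0 := by
    rw [hfun, integral_finsetSum _ fun i _ => (hm i).integrable (by norm_num)]
    refine Finset.sum_eq_zero fun i _ => ?_
    rw [← h0 i]
    exact integral_comp_eval (hX i).aestronglyMeasurable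
  have hi := hs.integrable_sq
  simp only [Finset.sum_apply] at hi
  refine ⟨hi, ?_⟩
  have hv := variance_sum_pi hX
  rw [variance_of_integral_eq_zero hs.aestronglyMeasurable.aemeasurable hmean, hfun] at hv
  rw [hv]
  calc ∑ i, Var[X i; ν i] ≤ ∑ _i : ι, K := Finset.sum_le_sum fun i _ => by
        rw [variance_of_integral_eq_zero (hX i).aestronglyMeasurable.aemeasurable (h0 i)]
        exact hK i
    _ = _ := by simp

theorem integral_sum_pi_le {X : ι → ℝ → ℝ} (hX : ∀ i, Integrable (X i) (ν i))
    {K : ℝ} (hK : ∀ i, ∫ y, X i y ∂(ν i) ≤ K) :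
    Integrable (fun y : ι → ℝ => ∑ i, X i (y i)) (Measure.pi ν) ∧
      ∫ y, ∑ i, X i (y i) ∂(Measure.pi ν) ≤ Fintype.card ι * K := by
  have hm : ∀ i, Integrable (fun y : ι → ℝ => X i (y i)) (Measure.pi ν) := fun i =>
    integrable_comp_eval (hX i)
  refine ⟨integrable_finsetSum _ fun i _ => hm i, ?_⟩
  rw [integral_finsetSum _ fun i _ => hm i]
  calc _ ≤ ∑ _i : ι, K := Finset.sum_le_sum fun i _ => by
        rw [integral_comp_eval (hX i).aestronglyMeasurable]
        exact hK i
    _ = _ := by simp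

/-- Markov's inequality for a sum of nonnegative random variables. -/
theorem measure_sum_ge_le {Ω κ : Type*} [MeasurableSpace Ω] {μ : Measure Ω}
    [IsProbabilityMeasure μ] (s : Finset κ) {Z : κ → Ω → ℝ} (h0 : ∀ r ω, 0 ≤ Z r ω)
    (hZ : ∀ r ∈ s, Integrable (Z r) μ) {K T δ : ℝ} (hK : ∀ r ∈ s, ∫ ω, Z r ω ∂μ ≤ K)
    (hT : 0 < T) (hδ : s.card * K ≤ δ * T) :
    μ {ω | T ≤ ∑ r ∈ s, Z r ω} ≤ ENNReal.ofReal δ := by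
  have h1 := mul_meas_ge_le_integral_of_nonneg (μ := μ) (f := fun ω => ∑ r ∈ s, Z r ω)
    (Eventually.of_forall fun ω => Finset.sum_nonneg fun r _ => h0 r ω)
    (integrable_finsetSum _ hZ) T
  have h2 : ∫ ω, ∑ r ∈ s, Z r ω ∂μ ≤ δ * T := by
    rw [integral_finsetSum _ hZ]
    refine (Finset.sum_le_sum hK).trans ?_
    simpa using hδ
  rw [← ofReal_measureReal]
  refine ENNReal.ofReal_le_ofReal ?_
  have h3 := h1.trans h2
  nlinarith

end Product

end GAM
end

/-! ### Moments under the true law and derivatives of the log-density. -/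

noncomputable section

namespace GAM

theorem hasDerivAt_comp_affine {g : ℝ → ℝ} {g' m : ℝ} (h : HasDerivAt g g' m) (a : ℝ) :
    HasDerivAt (fun t => g (m + t * a)) (g' * a) 0 := by
  have hl : HasDerivAt (fun t : ℝ => m + t * a) a 0 := by
    simpa using ((hasDerivAt_id (0 : ℝ)).mul_const a).const_add m
  have h' : HasDerivAt g g' ((fun t : ℝ => m + t * a) 0) := by
    beta_reduce; rwa [zero_mul, add_zero]
  exact h'.comp 0 hl

namespace GAMSeq

variable {p q : ℕ} (M : GAMSeq p q) {e n : ℕ}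

theorem measurable_logf (i : Fin n) {θ : Param p e (M.dim n)} (hθ : θ ∈ M.paramSpace e n) :
    Measurable fun y => M.logf i y θ := by
  have := M.fam.measurable_c _ hθ
  simp only [logf_eq]
  fun_prop

theorem isProbabilityMeasure_trueLaw (h0 : M.theta0 e n ∈ M.paramSpace e n) (i : Fin n) :
    IsProbabilityMeasure (M.trueLaw e n i) :=
  ⟨by
    rw [trueLaw, withDensity_apply _ MeasurableSet.univ, setLIntegral_univ]
    exact M.fam.lintegral_density _ h0 _⟩

theorem trueLaw_absolutelyContinuous (i : Fin n) : M.trueLaw e n i ≪ M.fam.base :=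
  withDensity_absolutelyContinuous _ _

theorem lintegral_exp_logf_sub (i : Fin n) (h0 : M.theta0 e n ∈ M.paramSpace e n)
    {θ : Param p e (M.dim n)} (hθ : θ ∈ M.paramSpace e n) :
    ∫⁻ y, ENNReal.ofReal (Real.exp (M.logf i y θ - M.logf i y (M.theta0 e n)))
      ∂(M.trueLaw e n i) = 1 := by
  have m1 := M.measurable_logf i h0
  have m2 := M.measurable_logf i hθ
  have m3 : Measurable fun y => ENNReal.ofReal (M.f i y (M.theta0 e n)) := by
    unfold f
    fun_prop
  have m4 : Measurable fun y =>
      ENNReal.ofReal (Real.exp (M.logf i y θ - M.logf i y (M.theta0 e n))) := by fun_prop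
  rw [trueLaw, lintegral_withDensity_eq_lintegral_mul _ m3 m4,
    ← M.fam.lintegral_density _ hθ (M.eta i θ)]
  refine lintegral_congr fun y => ?_
  rw [Pi.mul_apply, ← ENNReal.ofReal_mul (by exact (Real.exp_pos _).le), f, ← Real.exp_add,
    add_sub_cancel]
  rfl

/-- Exponential tilting: multiplying the true density by this exponential gives, up to the constant
on the right, the density with linear predictor `t`, whose mass is one. -/
theorem lintegral_exp_mul_omega_sub (i : Fin n) (h0 : M.theta0 e n ∈ M.paramSpace e n) (t : ℝ) :
    ∫⁻ y, ENNReal.ofReal (Real.exp (M.phi0⁻¹ *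
        (y * (M.fam.omega t - M.fam.omega (M.eta i (M.theta0 e n)))))) ∂(M.trueLaw e n i) =
      ENNReal.ofReal (Real.exp (M.phi0⁻¹ * (M.cumul t - M.cumul (M.eta i (M.theta0 e n))))) := by
  have m1 := M.measurable_logf i h0
  have m3 : Measurable fun y => ENNReal.ofReal (M.f i y (M.theta0 e n)) := by
    unfold f
    fun_prop
  rw [trueLaw, lintegral_withDensity_eq_lintegral_mul _ m3 (by fun_prop),
    ← mul_one (ENNReal.ofReal (Real.exp (M.phi0⁻¹ * (M.cumul t - _)))),
    ← M.fam.lintegral_density _ (M.phi0_mem h0) t, ← lintegral_const_mul']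
  · refine lintegral_congr fun y => ?_
    rw [Pi.mul_apply, ← ENNReal.ofReal_mul (by exact (Real.exp_pos _).le),
      ← ENNReal.ofReal_mul (by exact (Real.exp_pos _).le), f, ← Real.exp_add, ← Real.exp_add,
      logf_eq, dispersion_theta0]
    congr 2
    simp only [cumul]
    ring
  · exact ENNReal.ofReal_ne_top

theorem omega_injective : Function.Injective M.fam.omega := fun a b h => by
  rw [← M.fam.link_mean a, h, M.fam.link_mean]

theorem mul_abs_le_exp_add_exp {a b y δ : ℝ} (ha : δ ≤ |a|) (hb : δ ≤ |b|)
    (hab : a * b < 0) : δ * |y| ≤ Real.exp (y * a) + Real.exp (y * b) := by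
  have key : δ * |y| ≤ y * a ∨ δ * |y| ≤ y * b := by
    rcases le_total 0 y with hy | hy <;> rcases lt_or_ge 0 a with h | h
    · left; rw [abs_of_pos h] at ha; rw [abs_of_nonneg hy]; nlinarith
    · right
      have hb' : 0 < b := by by_contra h'; push Not at h'; nlinarith
      rw [abs_of_pos hb'] at hb; rw [abs_of_nonneg hy]; nlinarith
    · right
      have hb' : b < 0 := by by_contra h'; push Not at h'; nlinarith
      rw [abs_of_neg hb'] at hb; rw [abs_of_nonpos hy]; nlinarith
    · left; rw [abs_of_nonpos h] at ha; rw [abs_of_nonpos hy]; nlinarith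
  have h1 := Real.add_one_le_exp (y * a)
  have h2 := Real.add_one_le_exp (y * b)
  have h3 := Real.exp_pos (y * a)
  have h4 := Real.exp_pos (y * b)
  rcases key with h | h <;> linarith

/-- Tilting from $\eta$ to $\eta\pm1$ provides exponential moments in both directions. Indeed
$\omega$ is continuous and injective, hence strictly monotone, so its two increments have opposite
signs; by compactness they stay away from zero for $|\eta|\le C_2$. -/
theorem exists_abs_moment_bound (hM : M.Regular) (h3 : M.CondC3 e) :
    ∃ K, 0 ≤ K ∧ ∀ n (i : Fin n), Integrable (fun y => |y|) (M.trueLaw e n i) ∧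
      ∫ y, |y| ∂(M.trueLaw e n i) ≤ K := by
  obtain ⟨C2, hC2⟩ := h3.2.2
  have hω := hM.omega.continuous
  have hB := hM.cumul.continuous
  have h0 := fun n => interior_subset (h3.1 n)
  have hφ : 0 < M.phi0 := M.fam.disp_pos _ (M.phi0_mem (h0 0))
  have hpos : ∃ δ, 0 < δ ∧ ∀ t ∈ Set.Icc (-C2) C2,
      δ ≤ |M.fam.omega (t + 1) - M.fam.omega t| ∧ δ ≤ |M.fam.omega (t - 1) - M.fam.omega t| := by
    have hc : Continuous fun t => min |M.fam.omega (t + 1) - M.fam.omega t|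
        |M.fam.omega (t - 1) - M.fam.omega t| := by fun_prop
    have hne : ∀ t, 0 < min |M.fam.omega (t + 1) - M.fam.omega t|
        |M.fam.omega (t - 1) - M.fam.omega t| := fun t => by
      refine lt_min (abs_pos.2 (sub_ne_zero.2 fun h => ?_)) (abs_pos.2 (sub_ne_zero.2 fun h => ?_))
      · have := M.omega_injective h; linarith
      · have := M.omega_injective h; linarith
    rcases (Set.Icc (-C2) C2).eq_empty_or_nonempty with hemp | hemp
    · exact ⟨1, one_pos, fun t ht => by simp [hemp] at ht⟩
    · obtain ⟨t₀, -, ht₀⟩ := isCompact_Icc.exists_isMinOn hemp hc.continuousOn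
      exact ⟨_, hne t₀, fun t ht => ⟨(ht₀ ht).trans (min_le_left _ _),
        (ht₀ ht).trans (min_le_right _ _)⟩⟩
  obtain ⟨δ, hδ, hδ'⟩ := hpos
  have hsign : ∀ t, (M.fam.omega (t + 1) - M.fam.omega t) *
      (M.fam.omega (t - 1) - M.fam.omega t) < 0 := fun t => by
    rcases hω.strictMono_of_inj M.omega_injective with h | h
    · have a := h (show t < t + 1 by linarith)
      have b := h (show t - 1 < t by linarith)
      nlinarith
    · have a := h (show t < t + 1 by linarith)
      have b := h (show t - 1 < t by linarith)
      nlinarith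
  obtain ⟨K1, hK1, hK1'⟩ := exists_bound_of_continuous
    (g := fun t => Real.exp (M.phi0⁻¹ * (M.cumul (t + 1) - M.cumul t)) +
      Real.exp (M.phi0⁻¹ * (M.cumul (t - 1) - M.cumul t))) (by fun_prop) C2
  have hδφ : 0 < M.phi0⁻¹ * δ := by positivity
  refine ⟨(M.phi0⁻¹ * δ)⁻¹ * K1, by positivity, fun n i => ?_⟩
  set t := M.eta i (M.theta0 e n)
  have ht : |t| ≤ C2 := (hC2 n i).le
  have hle : ∀ y : ℝ, M.phi0⁻¹ * δ * |y| ≤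
      Real.exp (M.phi0⁻¹ * (y * (M.fam.omega (t + 1) - M.fam.omega t))) +
      Real.exp (M.phi0⁻¹ * (y * (M.fam.omega (t - 1) - M.fam.omega t))) := fun y => by
    have hh := hδ' t (abs_le.1 ht)
    have := mul_abs_le_exp_add_exp (y := M.phi0⁻¹ * y) hh.1 hh.2 (hsign t)
    rw [abs_mul, abs_of_pos (inv_pos.2 hφ)] at this
    convert this using 1
    · ring
    · simp only [mul_assoc]
  have hl : ∫⁻ y, ENNReal.ofReal (M.phi0⁻¹ * δ * |y|) ∂(M.trueLaw e n i) ≤ ENNReal.ofReal K1 := by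
    calc _ ≤ ∫⁻ y, (ENNReal.ofReal
            (Real.exp (M.phi0⁻¹ * (y * (M.fam.omega (t + 1) - M.fam.omega t)))) +
          ENNReal.ofReal (Real.exp (M.phi0⁻¹ * (y * (M.fam.omega (t - 1) - M.fam.omega t)))))
            ∂(M.trueLaw e n i) := by
          refine lintegral_mono fun y => ?_
          rw [← ENNReal.ofReal_add (Real.exp_pos _).le (Real.exp_pos _).le]
          exact ENNReal.ofReal_le_ofReal (hle y)
      _ ≤ _ := by
          rw [lintegral_add_left (by fun_prop), M.lintegral_exp_mul_omega_sub i (h0 n),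
            M.lintegral_exp_mul_omega_sub i (h0 n),
            ← ENNReal.ofReal_add (Real.exp_pos _).le (Real.exp_pos _).le]
          exact ENNReal.ofReal_le_ofReal ((le_abs_self _).trans (hK1' t ht))
  have hint : Integrable (fun y => M.phi0⁻¹ * δ * |y|) (M.trueLaw e n i) := by
    refine ⟨by fun_prop, ?_⟩
    rw [hasFiniteIntegral_iff_ofReal (Eventually.of_forall fun y => by positivity)]
    exact hl.trans_lt ENNReal.ofReal_lt_top
  refine ⟨?_, ?_⟩
  · refine (hint.const_mul (M.phi0⁻¹ * δ)⁻¹).congr (Eventually.of_forall fun y => ?_)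
    simp only
    rw [inv_mul_cancel_left₀ hδφ.ne']
  · rw [← ofReal_integral_eq_lintegral_ofReal hint (Eventually.of_forall fun y => by positivity),
      ENNReal.ofReal_le_ofReal_iff hK1, integral_const_mul] at hl
    rw [inv_mul_eq_div, le_div_iff₀ hδφ]
    linarith

/-- The score is only assumed integrable and centered. Likelihood ratios along the `r`-th coordinate
yield the inequality behind Bartlett's identity, $\operatorname E s^2\le2\operatorname EF$, and
$2F\le1+F^2$. -/
theorem score_second_moment {i : Fin n} (h0 : M.theta0 e n ∈ M.paramSpace e n)
    {U : Set (Param p e (M.dim n))} (hU : IsOpen U) (hU0 : M.theta0 e n ∈ U)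
    (hUs : U ⊆ M.paramSpace e n) (hsm : ∀ᵐ y ∂M.fam.base, ContDiffOn ℝ 3 (M.logf i y) U)
    {r : ParamIdx p e (M.dim n)}
    (hs : Integrable (fun y => partialDeriv r (M.logf i y) (M.theta0 e n)) (M.trueLaw e n i))
    (hs0 : ∫ y, partialDeriv r (M.logf i y) (M.theta0 e n) ∂(M.trueLaw e n i) = 0)
    {F : ℝ → ℝ} (hF : MemLp F 2 (M.trueLaw e n i)) {C : ℝ}
    (hFC : ∫ y, F y ^ 2 ∂(M.trueLaw e n i) ≤ C)
    (hle : ∀ᵐ y ∂M.fam.base, ∀ θ ∈ U, |partialDeriv r (partialDeriv r (M.logf i y)) θ| ≤ F y) :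
    MemLp (fun y => partialDeriv r (M.logf i y) (M.theta0 e n)) 2 (M.trueLaw e n i) ∧
      ∫ y, partialDeriv r (M.logf i y) (M.theta0 e n) ^ 2 ∂(M.trueLaw e n i) ≤ 1 + C := by
  have := M.isProbabilityMeasure_trueLaw h0 i
  obtain ⟨ε, hε, hball⟩ := Metric.isOpen_iff.1 hU _ hU0
  set h : ℕ → ℝ := fun k => ε / 2 * (1 / ((k : ℝ) + 1)) with hh
  have hpos : ∀ k, 0 < h k := fun k => by positivity
  have hlt : ∀ k, h k < ε := fun k => by
    have h1 : (1 : ℝ) / ((k : ℝ) + 1) ≤ 1 := by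
      rw [div_le_one (by positivity)]
      linarith [Nat.cast_nonneg (α := ℝ) k]
    have h2 : h k ≤ ε / 2 * 1 := by simp only [hh]; gcongr
    linarith
  have hlim : Tendsto h atTop (𝓝 0) := by
    have := (tendsto_one_div_add_atTop_nhds_zero_nat (𝕜 := ℝ)).const_mul (ε / 2)
    rwa [mul_zero] at this
  have hmem : ∀ k, ∀ t ∈ Set.Icc (0 : ℝ) 1,
      M.theta0 e n + t • EuclideanSpace.single r (h k) ∈ U := fun k t ht => by
    refine hball ?_
    rw [Metric.mem_ball, dist_eq_norm, add_sub_cancel_left, norm_smul, PiLp.norm_single,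
      Real.norm_of_nonneg ht.1, Real.norm_of_nonneg (hpos k).le]
    nlinarith [hlt k, ht.2, hpos k]
  have hmem1 : ∀ k, M.theta0 e n + EuclideanSpace.single r (h k) ∈ M.paramSpace e n := fun k =>
    hUs (by simpa using hmem k 1 (by simp))
  have hac := M.trueLaw_absolutelyContinuous (e := e) i
  have hFi : Integrable F (M.trueLaw e n i) := hF.integrable (by norm_num)
  have key := memLp_two_of_exp_expansion (μ := M.trueLaw e n i)
    (u := fun k y => M.logf i y (M.theta0 e n + EuclideanSpace.single r (h k)) -
      M.logf i y (M.theta0 e n)) (h := h)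
    (fun k => (M.measurable_logf i (hmem1 k)).sub (M.measurable_logf i h0)) hpos hlim hs hs0 hFi
    (fun k => M.lintegral_exp_logf_sub i h0 (hmem1 k)) (fun k => by
      filter_upwards [hac.ae_le hsm, hac.ae_le hle] with y h1 h2
      exact abs_taylor_one_le h1 hU (hmem k) h2)
  refine ⟨key.1, key.2.trans ?_⟩
  have : ∫ y, F y ∂(M.trueLaw e n i) ≤ ∫ y, (1 + F y ^ 2) / 2 ∂(M.trueLaw e n i) := by
    refine integral_mono hFi (((integrable_const 1).add hF.integrable_sq).div_const 2) fun y => ?_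
    simp only
    nlinarith [sq_nonneg (F y - 1)]
  rw [integral_div, integral_add (integrable_const 1) hF.integrable_sq] at this
  simp only [integral_const, probReal_univ, smul_eq_mul, mul_one] at this
  linarith

theorem hessian_second_moment {i : Fin n} (h0 : M.theta0 e n ∈ M.paramSpace e n)
    {r s : ParamIdx p e (M.dim n)}
    (hi : Integrable (fun y => partialDeriv r (partialDeriv s (M.logf i y)) (M.theta0 e n))
      (M.trueLaw e n i))
    {F : ℝ → ℝ} (hF : MemLp F 2 (M.trueLaw e n i)) {C : ℝ}
    (hFC : ∫ y, F y ^ 2 ∂(M.trueLaw e n i) ≤ C)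
    (hle : ∀ᵐ y ∂M.fam.base,
      |partialDeriv r (partialDeriv s (M.logf i y)) (M.theta0 e n)| ≤ F y) :
    MemLp (fun y => partialDeriv r (partialDeriv s (M.logf i y)) (M.theta0 e n) -
        ∫ y, partialDeriv r (partialDeriv s (M.logf i y)) (M.theta0 e n) ∂(M.trueLaw e n i)) 2
        (M.trueLaw e n i) ∧
      ∫ y, (partialDeriv r (partialDeriv s (M.logf i y)) (M.theta0 e n) -
        ∫ y, partialDeriv r (partialDeriv s (M.logf i y)) (M.theta0 e n)
          ∂(M.trueLaw e n i)) ^ 2 ∂(M.trueLaw e n i) ≤ C := by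
  have := M.isProbabilityMeasure_trueLaw h0 i
  have hac := M.trueLaw_absolutelyContinuous (e := e) i
  have hm : MemLp (fun y => partialDeriv r (partialDeriv s (M.logf i y)) (M.theta0 e n)) 2
      (M.trueLaw e n i) := hF.mono' hi.aestronglyMeasurable (hac.ae_le hle)
  refine ⟨hm.sub (memLp_const _), ?_⟩
  rw [← variance_eq_integral hi.aestronglyMeasurable.aemeasurable]
  refine (variance_le_expectation_sq hi.aestronglyMeasurable).trans ?_
  refine le_trans ?_ hFC
  refine integral_mono_ae hm.integrable_sq hF.integrable_sq ?_
  filter_upwards [hac.ae_le hle] with y hy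
  simp only [Pi.pow_apply]
  rw [← sq_abs]
  gcongr

/-- The second derivative of the log-density with respect to the linear predictor. -/
def curv (i : Fin n) (y : ℝ) (θ : Param p e (M.dim n)) : ℝ :=
  (dispersion M.phi0 θ)⁻¹ * (y * deriv (deriv M.fam.omega) (M.eta i θ)
    - deriv (deriv M.cumul) (M.eta i θ))

/-- The coefficients of the `i`-th linear predictor in the full parameter. -/
def coords (e : ℕ) (i : Fin n) : ParamIdx p e (M.dim n) → ℝ := design (M.x n i) (M.z n i)

theorem single_disp {s : ParamIdx p e (M.dim n)} (hs : ∀ l, s ≠ Sum.inr (Sum.inl l)) (t : ℝ)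
    (l : Fin e) : (t • EuclideanSpace.single s 1 : Param p e (M.dim n)) (Sum.inr (Sum.inl l)) = 0 := by
  simp [(hs l).symm]

theorem partialDeriv_logf (hM : M.Regular) {i : Fin n} {y : ℝ} {θ : Param p e (M.dim n)}
    (hd : DifferentiableAt ℝ (M.logf i y) θ) {s : ParamIdx p e (M.dim n)}
    (hs : ∀ l, s ≠ Sum.inr (Sum.inl l)) :
    partialDeriv s (M.logf i y) θ = M.coords e i s * ((dispersion M.phi0 θ)⁻¹ *
      (y * deriv M.fam.omega (M.eta i θ) - deriv M.cumul (M.eta i θ))) := by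
  refine fderiv_apply_of_hasDerivAt hd ?_
  have h1 := hasDerivAt_comp_affine (ContDiff.hasDerivAt_three hM.omega (M.eta i θ)).1
    (M.coords e i s)
  have h2 := hasDerivAt_comp_affine (ContDiff.hasDerivAt_three hM.cumul (M.eta i θ)).1
    (M.coords e i s)
  have h3 := (((h1.const_mul y).sub h2).const_mul (dispersion M.phi0 θ)⁻¹).add_const
    (M.fam.c y (dispersion M.phi0 θ))
  have h4 : (fun t : ℝ => M.logf i y (θ + t • EuclideanSpace.single s 1)) = fun t =>
      (dispersion M.phi0 θ)⁻¹ * (y * M.fam.omega (M.eta i θ + t * M.coords e i s)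
        - M.cumul (M.eta i θ + t * M.coords e i s)) + M.fam.c y (dispersion M.phi0 θ) := by
    ext t
    rw [logf_eq, dispersion_add (M.single_disp hs t), eta, linPred_add_smul, linPred_single]
    rfl
  rw [h4]
  refine h3.congr_deriv ?_
  ring

/-- Off the dispersion coordinate the Hessian of one log-density is a rank-one matrix times `curv`.
This ties the curvature in the smoothing term to the Fisher information. -/
theorem partialDeriv_partialDeriv_logf (hM : M.Regular) {i : Fin n} {y : ℝ}
    {O : Set (Param p e (M.dim n))} (hO : IsOpen O) (hsm : ContDiffOn ℝ 3 (M.logf i y) O)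
    {θ : Param p e (M.dim n)} (hθ : θ ∈ O) {r s : ParamIdx p e (M.dim n)}
    (hr : ∀ l, r ≠ Sum.inr (Sum.inl l)) (hs : ∀ l, s ≠ Sum.inr (Sum.inl l)) :
    partialDeriv r (partialDeriv s (M.logf i y)) θ =
      M.coords e i r * M.coords e i s * M.curv i y θ := by
  refine fderiv_apply_of_hasDerivAt (ContDiffOn.differentiableAt_three hsm hO hθ s s).2.1 ?_
  have h1 := hasDerivAt_comp_affine (ContDiff.hasDerivAt_three hM.omega (M.eta i θ)).2.1
    (M.coords e i r)
  have h2 := hasDerivAt_comp_affine (ContDiff.hasDerivAt_three hM.cumul (M.eta i θ)).2.1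
    (M.coords e i r)
  have h3 := ((((h1.const_mul y).sub h2).const_mul (dispersion M.phi0 θ)⁻¹)).const_mul
    (M.coords e i s)
  have hev : ∀ᶠ t : ℝ in 𝓝 0, θ + t • EuclideanSpace.single r 1 ∈ O := by
    have hc : Continuous fun t : ℝ => θ + t • (EuclideanSpace.single r 1 : Param p e (M.dim n)) := by
      fun_prop
    exact hc.continuousAt.eventually_mem (hO.mem_nhds (by simpa using hθ))
  refine (h3.congr_of_eventuallyEq ?_).congr_deriv ?_
  · filter_upwards [hev] with t ht
    rw [M.partialDeriv_logf hM (ContDiffOn.differentiableAt_three hsm hO ht s s).1 hs,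
      dispersion_add (M.single_disp hr t), eta, linPred_add_smul, linPred_single]
    rfl
  · rw [curv]
    ring

end GAMSeq

end GAM
end

/-! ### Positive semidefinite matrices. -/

noncomputable section

namespace GAM

section PosSemidef

variable {ι : Type*} [Fintype ι] {A : Matrix ι ι ℝ}

theorem quadForm_eq_sum (z : ι → ℝ) : z ⬝ᵥ A *ᵥ z = ∑ k, ∑ l, A k l * (z k * z l) := by
  simp only [dotProduct, Matrix.mulVec, Finset.mul_sum]
  exact Finset.sum_congr rfl fun k _ => Finset.sum_congr rfl fun l _ => by ring

theorem isClosed_posSemidef : IsClosed {A : Matrix ι ι ℝ | A.PosSemidef} := by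
  have h : {A : Matrix ι ι ℝ | A.PosSemidef} =
      {A | Aᵀ = A} ∩ ⋂ v : ι → ℝ, {A | 0 ≤ v ⬝ᵥ (A *ᵥ v)} := by
    ext A
    simp [Matrix.posSemidef_iff_dotProduct_mulVec, Matrix.IsHermitian]
  rw [h]
  refine (isClosed_eq (by fun_prop) continuous_id).inter (isClosed_iInter fun v => ?_)
  exact isClosed_le continuous_const (by fun_prop)

variable [DecidableEq ι]

open scoped MatrixOrder in
theorem PosSemidef.exists_gram (hA : A.PosSemidef) :
    ∃ B : Matrix ι ι ℝ, ∀ k l, A k l = ∑ m, B m k * B m l := by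
  obtain ⟨B, rfl⟩ := CStarAlgebra.nonneg_iff_eq_star_mul_self.mp hA.nonneg
  exact ⟨B, fun k l => by simp [Matrix.star_eq_conjTranspose, Matrix.mul_apply]⟩

/-- In Gram form, Cauchy–Schwarz gives $A_{kl}^2\le A_{kk}A_{ll}$ for each entry. -/
theorem PosSemidef.sum_sq_le (hA : A.PosSemidef) : ∑ k, ∑ l, A k l ^ 2 ≤ A.trace ^ 2 := by
  obtain ⟨B, hB⟩ := PosSemidef.exists_gram hA
  rw [Matrix.trace, sq, Finset.sum_mul_sum]
  refine Finset.sum_le_sum fun k _ => Finset.sum_le_sum fun l _ => ?_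
  rw [Matrix.diag_apply, Matrix.diag_apply, hB, hB, hB]
  refine (Finset.sum_mul_sq_le_sq_mul_sq _ _ _).trans_eq ?_
  simp only [sq]

theorem PosSemidef.abs_apply_le (hA : A.PosSemidef) (k l : ι) : |A k l| ≤ A.trace := by
  refine abs_le_of_sq_le_sq ?_ hA.trace_nonneg
  refine le_trans ?_ (PosSemidef.sum_sq_le hA)
  refine le_trans ?_ (Finset.single_le_sum (f := fun k => ∑ l, A k l ^ 2)
    (fun k _ => Finset.sum_nonneg fun l _ => sq_nonneg _) (Finset.mem_univ k))
  exact Finset.single_le_sum (f := fun l => A k l ^ 2) (fun l _ => sq_nonneg _) (Finset.mem_univ l)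

/-- The Gram form makes $A$ a sum of rank-one matrices, so its pairing with $J$ is a sum of values
of the quadratic form of $J$, which need not be symmetric. It is applied to the information matrix,
to $-zz^\top$ and to the penalty matrix. -/
theorem PosSemidef.le_sum_mul (hA : A.PosSemidef) {J : Matrix ι ι ℝ} {c : ℝ}
    (hJ : ∀ v : ι → ℝ, c * (v ⬝ᵥ v) ≤ v ⬝ᵥ (J *ᵥ v)) :
    c * A.trace ≤ ∑ k, ∑ l, A k l * J k l := by
  obtain ⟨B, hB⟩ := PosSemidef.exists_gram hA
  have h1 : A.trace = ∑ m, B m ⬝ᵥ B m := by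
    simp only [Matrix.trace, Matrix.diag_apply, hB, dotProduct]
    rw [Finset.sum_comm]
  have h2 : ∑ k, ∑ l, A k l * J k l = ∑ m, B m ⬝ᵥ (J *ᵥ B m) := by
    calc ∑ k, ∑ l, A k l * J k l = ∑ k, ∑ m, ∑ l, B m k * (J k l * B m l) := by
          refine Finset.sum_congr rfl fun k _ => ?_
          rw [Finset.sum_comm]
          refine Finset.sum_congr rfl fun l _ => ?_
          rw [hB, Finset.sum_mul]
          exact Finset.sum_congr rfl fun m _ => by ring
      _ = _ := by
          rw [Finset.sum_comm]
          simp only [dotProduct, Matrix.mulVec, Finset.mul_sum]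
  rw [h1, h2, Finset.mul_sum]
  exact Finset.sum_le_sum fun m _ => hJ _

theorem PosSemidef.quadForm_le (hA : A.PosSemidef) (z : ι → ℝ) :
    z ⬝ᵥ A *ᵥ z ≤ (z ⬝ᵥ z) * A.trace := by
  have h := PosSemidef.le_sum_mul hA (J := fun k l => -(z k * z l)) (c := -(z ⬝ᵥ z)) fun v => ?_
  · have e : z ⬝ᵥ A *ᵥ z = -∑ k, ∑ l, A k l * -(z k * z l) := by
      simp only [dotProduct, Matrix.mulVec, Finset.mul_sum, ← Finset.sum_neg_distrib]
      exact Finset.sum_congr rfl fun k _ => Finset.sum_congr rfl fun l _ => by ring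
    rw [e]
    linarith
  · have e : v ⬝ᵥ ((fun k l => -(z k * z l) : Matrix ι ι ℝ) *ᵥ v) = -(z ⬝ᵥ v) ^ 2 := by
      simp only [dotProduct, Matrix.mulVec, Finset.mul_sum, sq, Finset.sum_mul,
        ← Finset.sum_neg_distrib]
      exact Finset.sum_congr rfl fun k _ => Finset.sum_congr rfl fun l _ => by ring
    have h2 := Finset.sum_mul_sq_le_sq_mul_sq Finset.univ z v
    rw [e]
    simp only [dotProduct, ← sq] at h2 ⊢
    linarith

theorem trace_mul_nonneg (hA : A.PosSemidef) {S : Matrix ι ι ℝ} (hS : S.PosSemidef) :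
    0 ≤ (S * A).trace := by
  have h := PosSemidef.le_sum_mul hA (J := S) (c := 0) fun v => by
    simpa using hS.dotProduct_mulVec_nonneg v
  have e : (S * A).trace = ∑ k, ∑ l, A k l * S k l := by
    simp only [Matrix.trace, Matrix.diag_apply, Matrix.mul_apply]
    refine Finset.sum_congr rfl fun k _ => Finset.sum_congr rfl fun l _ => ?_
    have := hA.isHermitian.apply k l
    simp only [star_trivial] at this
    rw [this, mul_comm]
  rw [e]
  linarith

theorem isCompact_posSemidef_trace_le (τ : ℝ) :
    IsCompact {A : Matrix ι ι ℝ | A.PosSemidef ∧ A.trace ≤ τ} := by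
  have hK : IsCompact (Set.pi Set.univ fun _ : ι => Set.pi Set.univ fun _ : ι => Set.Icc (-τ) τ) :=
    isCompact_univ_pi fun _ => isCompact_univ_pi fun _ => isCompact_Icc
  refine IsCompact.of_isClosed_subset (X := Matrix ι ι ℝ) hK ?_ ?_
  · exact isClosed_posSemidef.inter (isClosed_le continuous_id.matrix_trace continuous_const)
  · rintro A ⟨hA, hτ⟩ k - l -
    exact abs_le.1 ((PosSemidef.abs_apply_le hA k l).trans hτ)

end PosSemidef

/-! ### An interior maximum from boundary comparisons. -/

section Maximizer

variable {E ι : Type*} [NormedAddCommGroup E] [ProperSpace E] [Fintype ι] [DecidableEq ι]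
  [Nonempty ι]

/-- A function of a vector `θ` and a positive definite matrix `A` that is the sum of a continuous
function and of `2⁻¹ * log det A` has a local maximizer in the region `‖θ - θ₀‖ ≤ ρ`, `trace A ≤ τ`
if it can be increased at the boundary points, by a move to `θ₀` or to `A / 2`. -/
theorem exists_isLocalMaxOn_of_boundary {Θ : Set E} {θ₀ : E} {ρ τ : ℝ} (hρ : 0 < ρ) (hτ : 0 < τ)
    {ℓ R : E → Matrix ι ι ℝ → ℝ} (hΘ : Metric.closedBall θ₀ ρ ⊆ Θ)
    (hR : ContinuousOn (fun w : E × Matrix ι ι ℝ => R w.1 w.2)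
      (Metric.closedBall θ₀ ρ ×ˢ {A | A.PosSemidef}))
    (hℓ : ∀ θ ∈ Metric.closedBall θ₀ ρ, ∀ A : Matrix ι ι ℝ, A.PosDef →
      ℓ θ A = R θ A + 2⁻¹ * Real.log A.det)
    (hθ : ∀ θ, ‖θ - θ₀‖ = ρ → ∀ A : Matrix ι ι ℝ, A.PosDef → A.trace ≤ τ → ℓ θ A < ℓ θ₀ A)
    (hA : ∀ θ, ‖θ - θ₀‖ ≤ ρ → ∀ A : Matrix ι ι ℝ, A.PosDef → A.trace = τ →
      ℓ θ A < ℓ θ ((1 / 2 : ℝ) • A)) :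
    ∃ θ A, ‖θ - θ₀‖ ≤ ρ ∧ θ ∈ Θ ∧ A.PosDef ∧
      IsLocalMaxOn (fun w : E × Matrix ι ι ℝ => ℓ w.1 w.2) (Θ ×ˢ {B | B.PosDef}) (θ, A) := by
  set K : Set (E × Matrix ι ι ℝ) :=
    Metric.closedBall θ₀ ρ ×ˢ {A | A.PosSemidef ∧ A.trace ≤ τ} with hK
  have hKc : IsCompact K := (isCompact_closedBall _ _).prod (isCompact_posSemidef_trace_le τ)
  -- On positive definite matrices this is $e^{\ell}$, and it extends continuously by zero to
  -- singular ones, where $\ln\det$ would be $-\infty$. Thus a maximum over `K` exists, and its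
  -- value is positive, which forces a nonzero determinant.
  set G : E × Matrix ι ι ℝ → ℝ := fun w => Real.exp (R w.1 w.2) * √w.2.det with hG
  have hGc : ContinuousOn G K := by
    refine ContinuousOn.mul (ContinuousOn.rexp (hR.mono ?_)) ?_
    · exact Set.prod_mono le_rfl fun A hA => hA.1
    · exact (Real.continuous_sqrt.comp (continuous_snd.matrix_det)).continuousOn
  have hGℓ : ∀ θ ∈ Metric.closedBall θ₀ ρ, ∀ A : Matrix ι ι ℝ, A.PosDef →
      G (θ, A) = Real.exp (ℓ θ A) := fun θ hθ A hA => by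
    rw [hℓ θ hθ A hA, Real.exp_add, inv_mul_eq_div, Real.exp_half, Real.exp_log hA.det_pos]
  set A₀ : Matrix ι ι ℝ := (τ / Fintype.card ι) • 1 with hA₀
  have hcard : (0 : ℝ) < Fintype.card ι := by exact_mod_cast Fintype.card_pos
  have hA₀p : A₀.PosDef := Matrix.PosDef.one.smul (by positivity)
  have h0ball : θ₀ ∈ Metric.closedBall θ₀ ρ := Metric.mem_closedBall_self hρ.le
  have h0K : (θ₀, A₀) ∈ K := by
    refine ⟨h0ball, hA₀p.posSemidef, ?_⟩
    simp only [hA₀, Matrix.trace_smul, Matrix.trace_one, smul_eq_mul]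
    rw [div_mul_cancel₀ _ hcard.ne']
  obtain ⟨⟨θ, A⟩, hm, hmax⟩ := hKc.exists_isMaxOn ⟨_, h0K⟩ hGc
  have hmb : θ ∈ Metric.closedBall θ₀ ρ := hm.1
  have hmA : A.PosSemidef ∧ A.trace ≤ τ := hm.2
  have hdet : A.det ≠ 0 := fun h => by
    have h1 : G (θ₀, A₀) ≤ G (θ, A) := hmax h0K
    rw [hGℓ _ h0ball _ hA₀p] at h1
    simp only [hG, h, Real.sqrt_zero, mul_zero] at h1
    exact absurd (Real.exp_pos _) (not_lt.2 h1)
  have hAp : A.PosDef := hmA.1.posDef_iff_det_ne_zero.2 hdet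
  have hmax' : ∀ θ' ∈ Metric.closedBall θ₀ ρ, ∀ A' : Matrix ι ι ℝ, A'.PosDef → A'.trace ≤ τ →
      ℓ θ' A' ≤ ℓ θ A := fun θ' h1 A' h2 h3 => by
    have h4 : G (θ', A') ≤ G (θ, A) := hmax (show (θ', A') ∈ K from ⟨h1, h2.posSemidef, h3⟩)
    rwa [hGℓ _ h1 _ h2, hGℓ _ hmb _ hAp, Real.exp_le_exp] at h4
  have hmn : ‖θ - θ₀‖ ≤ ρ := by rwa [← dist_eq_norm, ← Metric.mem_closedBall]
  have hlt1 : ‖θ - θ₀‖ < ρ := lt_of_le_of_ne hmn fun h =>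
    absurd (hθ θ h A hAp hmA.2) (not_lt.2 (hmax' _ h0ball _ hAp hmA.2))
  have hlt2 : A.trace < τ := lt_of_le_of_ne hmA.2 fun h => by
    refine absurd (hA θ hmn A hAp h) (not_lt.2 (hmax' _ hmb _ (hAp.smul (by norm_num)) ?_))
    rw [Matrix.trace_smul, smul_eq_mul, h]
    linarith
  refine ⟨θ, A, hmn, hΘ hmb, hAp, ?_⟩
  -- Near the maximizer both strict inequalities persist, so every positive definite competitor lies
  -- in `K`.
  have n1 : ∀ᶠ w : E × Matrix ι ι ℝ in 𝓝 (θ, A), ‖w.1 - θ₀‖ < ρ :=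
    (by fun_prop : Continuous fun w : E × Matrix ι ι ℝ => ‖w.1 - θ₀‖).continuousAt.eventually_lt
      continuousAt_const hlt1
  have n2 : ∀ᶠ w : E × Matrix ι ι ℝ in 𝓝 (θ, A), w.2.trace < τ :=
    (continuous_snd.matrix_trace).continuousAt.eventually_lt continuousAt_const hlt2
  filter_upwards [mem_nhdsWithin_of_mem_nhds n1, mem_nhdsWithin_of_mem_nhds n2,
    self_mem_nhdsWithin] with w h1 h2 h3
  exact hmax' w.1 (by rw [Metric.mem_closedBall, dist_eq_norm]; exact le_of_lt h1) w.2 h3.2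
    (le_of_lt h2)

end Maximizer

/-! ### Difference penalties. -/

section Difference

theorem sum_choose_le {κ : Type*} (r : ℕ) (s : Finset κ) {φ : κ → ℕ} (hφ : Set.InjOn φ s) :
    ∑ k ∈ s, (r.choose (φ k) : ℝ) ≤ 2 ^ r := by
  have h : ∑ k ∈ s, r.choose (φ k) ≤ 2 ^ r := by
    rw [← Finset.sum_image (f := fun t => r.choose t) (g := φ) hφ, ← Nat.sum_range_choose]
    refine Finset.sum_le_sum_of_ne_zero fun t _ ht => ?_
    rw [Finset.mem_range]
    by_contra h
    exact ht (Nat.choose_eq_zero_of_lt (by omega))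
  exact_mod_cast h

theorem abs_diffMatrix (r m : ℕ) (i : Fin (m - r)) (k : Fin m) :
    |diffMatrix r m i k| = if (i : ℕ) ≤ k then (r.choose ((k : ℕ) - i) : ℝ) else 0 := by
  unfold diffMatrix
  split_ifs
  · simp [abs_mul, abs_pow]
  · simp

/-- Schur's test: all absolute row and column sums are sums of distinct binomial coefficients, at
most $2^r$. The bound on the norm therefore depends on the order only and not on the number of basis
functions. -/
theorem sum_sq_diffMatrix_mulVec_le (r m : ℕ) (w : Fin m → ℝ) :
    ∑ i, (diffMatrix r m *ᵥ w) i ^ 2 ≤ 4 ^ r * ∑ k, w k ^ 2 := by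
  have hrow : ∀ i, ∑ k, |diffMatrix r m i k| ≤ 2 ^ r := fun i => by
    simp only [abs_diffMatrix]
    rw [← Finset.sum_filter]
    refine sum_choose_le r _ fun a ha b hb hab => ?_
    simp only [Finset.coe_filter, Finset.mem_univ, true_and, Set.mem_ofPred_eq] at ha hb
    have hab' : (a : ℕ) - i = b - i := hab
    ext
    omega
  have hcol : ∀ k, ∑ i, |diffMatrix r m i k| ≤ 2 ^ r := fun k => by
    simp only [abs_diffMatrix]
    rw [← Finset.sum_filter]
    refine sum_choose_le r _ fun a ha b hb hab => ?_
    simp only [Finset.coe_filter, Finset.mem_univ, true_and, Set.mem_ofPred_eq] at ha hb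
    have hab' : (k : ℕ) - a = k - b := hab
    ext
    omega
  have hi : ∀ i, (diffMatrix r m *ᵥ w) i ^ 2 ≤ 2 ^ r * ∑ k, |diffMatrix r m i k| * w k ^ 2 :=
    fun i => by
    have h1 : |(diffMatrix r m *ᵥ w) i| ≤ ∑ k, |diffMatrix r m i k| * |w k| := by
      simp only [← abs_mul]
      exact Finset.abs_sum_le_sum_abs (fun k => diffMatrix r m i k * w k) Finset.univ
    have h2 : (∑ k, |diffMatrix r m i k| * |w k|) ^ 2 ≤
        (∑ k, |diffMatrix r m i k|) * ∑ k, |diffMatrix r m i k| * w k ^ 2 := by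
      refine Finset.sum_sq_le_sum_mul_sum_of_sq_le_mul _ (fun _ _ => abs_nonneg _)
        (fun _ _ => by positivity) fun k _ => ?_
      rw [mul_pow, sq_abs (w k)]
      exact le_of_eq (by ring)
    calc (diffMatrix r m *ᵥ w) i ^ 2 = |(diffMatrix r m *ᵥ w) i| ^ 2 := (sq_abs _).symm
      _ ≤ (∑ k, |diffMatrix r m i k| * |w k|) ^ 2 := by gcongr
      _ ≤ _ := h2.trans (mul_le_mul_of_nonneg_right (hrow i)
          (Finset.sum_nonneg fun _ _ => by positivity))
  calc ∑ i, (diffMatrix r m *ᵥ w) i ^ 2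
      ≤ ∑ i, 2 ^ r * ∑ k, |diffMatrix r m i k| * w k ^ 2 := Finset.sum_le_sum fun i _ => hi i
    _ = 2 ^ r * ∑ k, (∑ i, |diffMatrix r m i k|) * w k ^ 2 := by
        rw [← Finset.mul_sum, Finset.sum_comm]
        simp only [Finset.sum_mul]
    _ ≤ 2 ^ r * ∑ k, 2 ^ r * w k ^ 2 := by
        gcongr with k
        exact hcol k
    _ = _ := by
        rw [← Finset.mul_sum, ← mul_assoc, ← mul_pow]
        norm_num

/-- The form is the squared norm of a linear image. Expanding it around $a_0$, the square of the
increment has the favourable sign and is dropped; the cross term is linear in $\rho$. -/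
theorem IsDifferencePenalty.neg_le_quadForm_sub {r k : ℕ} {S : Matrix (Fin k) (Fin k) ℝ}
    (hS : IsDifferencePenalty r S) {a a₀ : Fin k → ℝ} {ρ B : ℝ} (hρ : 0 ≤ ρ) (hB : 0 ≤ B)
    (ha : ∑ i, (a i - a₀ i) ^ 2 ≤ ρ ^ 2) (ha₀ : ∑ i, a₀ i ^ 2 ≤ B ^ 2) :
    -(2 * 4 ^ r * ρ * B) ≤ a ⬝ᵥ (S *ᵥ a) - a₀ ⬝ᵥ (S *ᵥ a₀) := by
  obtain ⟨-, m, Q, hQ, rfl⟩ := hS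
  set g : (Fin k → ℝ) → Fin (m - r) → ℝ := fun v => diffMatrix r m *ᵥ (Q *ᵥ v) with hg
  have hquad : ∀ v, v ⬝ᵥ (((diffMatrix r m * Q)ᵀ * (diffMatrix r m * Q)) *ᵥ v) = ∑ i, g v i ^ 2 := by
    intro v
    rw [← Matrix.mulVec_mulVec, Matrix.dotProduct_mulVec, Matrix.vecMul_transpose,
      ← Matrix.mulVec_mulVec]
    simp only [dotProduct, sq]
    rfl
  have hbound : ∀ v, ∑ i, g v i ^ 2 ≤ 4 ^ r * ∑ i, v i ^ 2 := fun v => by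
    refine (sum_sq_diffMatrix_mulVec_le r m (Q *ᵥ v)).trans_eq ?_
    congr 1
    have : (Q *ᵥ v) ⬝ᵥ (Q *ᵥ v) = v ⬝ᵥ v := by
      rw [Matrix.dotProduct_mulVec, Matrix.vecMul_mulVec, hQ, Matrix.vecMul_one]
    simpa [dotProduct, sq] using this
  have hlin : g a = g (a - a₀) + g a₀ := by
    simp only [hg]
    rw [← Matrix.mulVec_add, ← Matrix.mulVec_add, sub_add_cancel]
  have h1 : ∑ i, g (a - a₀) i ^ 2 ≤ 4 ^ r * ρ ^ 2 := by
    refine (hbound _).trans ?_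
    gcongr
    simpa using ha
  have h2 : ∑ i, g a₀ i ^ 2 ≤ 4 ^ r * B ^ 2 := (hbound _).trans (by gcongr)
  have h3 : |∑ i, g (a - a₀) i * g a₀ i| ≤ 4 ^ r * ρ * B := by
    refine abs_le_of_sq_le_sq ?_ (by positivity)
    calc _ ≤ (∑ i, g (a - a₀) i ^ 2) * ∑ i, g a₀ i ^ 2 := Finset.sum_mul_sq_le_sq_mul_sq _ _ _
      _ ≤ (4 ^ r * ρ ^ 2) * (4 ^ r * B ^ 2) := by
          gcongr
      _ = _ := by ring
  rw [hquad, hquad]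
  have h4 : ∑ i, g a i ^ 2 = ∑ i, g (a - a₀) i ^ 2 + 2 * ∑ i, g (a - a₀) i * g a₀ i +
      ∑ i, g a₀ i ^ 2 := by
    rw [hlin, Finset.mul_sum, ← Finset.sum_add_distrib, ← Finset.sum_add_distrib]
    exact Finset.sum_congr rfl fun i _ => by simp only [Pi.add_apply]; ring
  have h5 : 0 ≤ ∑ i, g (a - a₀) i ^ 2 := Finset.sum_nonneg fun _ _ => sq_nonneg _
  have h6 := neg_abs_le (∑ i, g (a - a₀) i * g a₀ i)
  rw [h4]
  linarith

end Difference

end GAM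
end

/-! ### Deterministic bounds for the smoothing term and the log-likelihood. -/

noncomputable section

namespace GAM

section CauchySchwarz

theorem sum_mul_le_of_sum_sq_le {κ : Type*} (s : Finset κ) {a b : κ → ℝ} {α β : ℝ} (hα : 0 ≤ α)
    (hβ : 0 ≤ β) (ha : ∑ k ∈ s, a k ^ 2 ≤ α ^ 2) (hb : ∑ k ∈ s, b k ^ 2 ≤ β ^ 2) :
    ∑ k ∈ s, a k * b k ≤ α * β := by
  refine le_of_sq_le_sq ?_ (by positivity)
  calc _ ≤ (∑ k ∈ s, a k ^ 2) * ∑ k ∈ s, b k ^ 2 := Finset.sum_mul_sq_le_sq_mul_sq _ _ _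
    _ ≤ α ^ 2 * β ^ 2 := by
        gcongr
    _ = _ := by ring

variable {ι : Type*} [Fintype ι]

theorem sum_sum_mul_le {a b : ι → ι → ℝ} {α β : ℝ} (hα : 0 ≤ α) (hβ : 0 ≤ β)
    (ha : ∑ r, ∑ s, a r s ^ 2 ≤ α ^ 2) (hb : ∑ r, ∑ s, b r s ^ 2 ≤ β ^ 2) :
    ∑ r, ∑ s, a r s * b r s ≤ α * β := by
  have := sum_mul_le_of_sum_sq_le (Finset.univ : Finset (ι × ι)) (a := fun k => a k.1 k.2)
    (b := fun k => b k.1 k.2) hα hβ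
    (by rwa [Fintype.sum_prod_type]) (by rwa [Fintype.sum_prod_type])
  rwa [Fintype.sum_prod_type] at this

theorem quadratic_le {u : ι → ℝ} {b : ι → ι → ℝ} {ρ β : ℝ} (hβ : 0 ≤ β)
    (hu : ∑ r, u r ^ 2 ≤ ρ ^ 2) (hb : ∑ r, ∑ s, b r s ^ 2 ≤ β ^ 2) :
    ∑ r, ∑ s, u r * u s * b r s ≤ ρ ^ 2 * β := by
  refine sum_sum_mul_le (sq_nonneg ρ) hβ ?_ hb
  calc ∑ r, ∑ s, (u r * u s) ^ 2 = (∑ r, u r ^ 2) * ∑ r, u r ^ 2 := by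
        rw [Finset.sum_mul_sum]; simp only [mul_pow]
    _ ≤ ρ ^ 2 * ρ ^ 2 := by gcongr
    _ = _ := by ring

theorem cubic_le {u : ι → ℝ} {b : ι → ι → ι → ℝ} {ρ β : ℝ} (hρ : 0 ≤ ρ) (hβ : 0 ≤ β)
    (hu : ∑ r, u r ^ 2 ≤ ρ ^ 2) (hb : ∑ r, ∑ s, ∑ t, b r s t ^ 2 ≤ β ^ 2) :
    ∑ r, ∑ s, ∑ t, |u r| * |u s| * |u t| * b r s t ≤ ρ ^ 3 * β := by
  have := sum_mul_le_of_sum_sq_le (Finset.univ : Finset (ι × ι × ι))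
    (a := fun k => |u k.1| * |u k.2.1| * |u k.2.2|) (b := fun k => b k.1 k.2.1 k.2.2)
    (pow_nonneg hρ 3) hβ ?_ (by simpa only [Fintype.sum_prod_type] using hb)
  · simpa only [Fintype.sum_prod_type] using this
  · simp only [Fintype.sum_prod_type]
    calc ∑ r, ∑ s, ∑ t, (|u r| * |u s| * |u t|) ^ 2
        = (∑ r, u r ^ 2) * ((∑ r, u r ^ 2) * ∑ r, u r ^ 2) := by
          simp only [Finset.mul_sum, mul_pow, sq_abs, Finset.sum_mul]
          exact Finset.sum_congr rfl fun r _ => Finset.sum_congr rfl fun s _ =>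
            Finset.sum_congr rfl fun t _ => by ring
      _ ≤ ρ ^ 2 * (ρ ^ 2 * ρ ^ 2) := by
          gcongr
      _ = _ := by ring

end CauchySchwarz

namespace GAMSeq

variable {p q : ℕ} (M : GAMSeq p q) {e n : ℕ}

/-- A bound for the difference of one summand of `smoothing` and its quadratic approximation at the
true parameter. -/
theorem exists_smoothing_summand_bound (hM : M.Regular) (R : ℝ) (hφ : 0 < M.phi0) :
    ∃ K, 0 ≤ K ∧ ∀ y m m₀ ψ v vmax κ : ℝ, |m| ≤ R → |m₀| ≤ R → M.phi0 / 2 ≤ ψ → 0 ≤ v →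
      v ≤ vmax → vmax ≤ 1 / 4 → |m - m₀| ≤ κ → |ψ - M.phi0| ≤ κ →
      |ψ⁻¹ * (y * gaussExcess M.fam.omega m v - gaussExcess M.cumul m v) -
        1 / 2 * (v * (M.phi0⁻¹ * (y * deriv (deriv M.fam.omega) m₀ - deriv (deriv M.cumul) m₀)))| ≤
      K * (vmax * (√vmax + κ)) * (1 + |y|) := by
  obtain ⟨K1, hK1, hb1⟩ := exists_gaussExcess_bound hM.omega hM.int_omega R
  obtain ⟨K2, hK2, hb2⟩ := exists_gaussExcess_bound hM.cumul hM.int_cumul R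
  obtain ⟨L1, hL1, hl1⟩ := exists_lipschitz_of_continuous_deriv
    (fun x => (ContDiff.hasDerivAt_three hM.omega x).2.2)
    (ContDiff.continuous_deriv_three hM.omega).2.2 R
  obtain ⟨L2, hL2, hl2⟩ := exists_lipschitz_of_continuous_deriv
    (fun x => (ContDiff.hasDerivAt_three hM.cumul x).2.2)
    (ContDiff.continuous_deriv_three hM.cumul).2.2 R
  obtain ⟨S1, hS1, hs1⟩ := exists_bound_of_continuous
    (ContDiff.continuous_deriv_three hM.omega).2.1 R
  obtain ⟨S2, hS2, hs2⟩ := exists_bound_of_continuous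
    (ContDiff.continuous_deriv_three hM.cumul).2.1 R
  set φ := M.phi0 with hφdef
  set a : ℝ := 2 / φ with ha
  have ha0 : 0 < a := by positivity
  refine ⟨a * (K1 + K2) + (1 / 2 * (a * (L1 + L2)) + 1 / 2 * (a * φ⁻¹ * (S1 + S2))), by positivity,
    fun y m m₀ ψ v vmax κ hm hm₀ hψ hv hvm hvm' hmm hψφ => ?_⟩
  have hψ0 : 0 < ψ := by linarith
  have hvm0 : 0 ≤ vmax := hv.trans hvm
  have hκ : 0 ≤ κ := (abs_nonneg _).trans hmm
  have hinv : |ψ⁻¹| ≤ a := by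
    rw [abs_of_pos (inv_pos.2 hψ0), ha]
    rw [inv_le_comm₀ hψ0 (by positivity), inv_div]
    exact hψ
  have hinv2 : |ψ⁻¹ - φ⁻¹| ≤ a * φ⁻¹ * κ := by
    have e : ψ⁻¹ - φ⁻¹ = ψ⁻¹ * φ⁻¹ * (φ - ψ) := by field_simp
    rw [e, abs_mul, abs_mul, abs_of_pos (inv_pos.2 hφ), abs_sub_comm]
    gcongr
  have lin : ∀ s t α β : ℝ, |s| ≤ α → |t| ≤ β → |y * s - t| ≤ (α + β) * (1 + |y|) := by
    intro s t α β hs ht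
    calc |y * s - t| ≤ |y * s| + |t| := abs_sub _ _
      _ = |y| * |s| + |t| := by rw [abs_mul]
      _ ≤ |y| * α + β := by gcongr
      _ ≤ _ := by nlinarith [abs_nonneg y, (abs_nonneg s).trans hs, (abs_nonneg t).trans ht]
  have hsq : v * √v ≤ vmax * √vmax := by gcongr
  set w := fun x => deriv (deriv M.fam.omega) x
  set b := fun x => deriv (deriv M.cumul) x
  -- Three errors add up: the Gaussian expansion at $m$, of order $v_{\max}^{3/2}$; the shift of the
  -- second derivatives from $m$ to $m_0$; and the change of the dispersion. The last two are of
  -- order $v_{\max}\kappa$.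
  have t1 : |ψ⁻¹ * (y * (gaussExcess M.fam.omega m v - v / 2 * w m) -
      (gaussExcess M.cumul m v - v / 2 * b m))| ≤
      a * ((K1 * (vmax * √vmax) + K2 * (vmax * √vmax)) * (1 + |y|)) := by
    rw [abs_mul]
    gcongr
    refine lin _ _ _ _ ((hb1 m v hm hv (hvm.trans hvm')).trans ?_)
      ((hb2 m v hm hv (hvm.trans hvm')).trans ?_) <;> gcongr
  have t2 : |v / 2 * (ψ⁻¹ * (y * (w m - w m₀) - (b m - b m₀)))| ≤
      vmax / 2 * (a * ((L1 * κ + L2 * κ) * (1 + |y|))) := by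
    rw [abs_mul, abs_mul, abs_of_nonneg (by positivity : 0 ≤ v / 2)]
    gcongr
    refine lin _ _ _ _ ((hl1 m m₀ hm hm₀).trans ?_) ((hl2 m m₀ hm hm₀).trans ?_) <;> gcongr
  have t3 : |v / 2 * ((ψ⁻¹ - φ⁻¹) * (y * w m₀ - b m₀))| ≤
      vmax / 2 * (a * φ⁻¹ * κ * ((S1 + S2) * (1 + |y|))) := by
    rw [abs_mul, abs_mul, abs_of_nonneg (by positivity : 0 ≤ v / 2)]
    gcongr
    exact lin _ _ _ _ (hs1 m₀ hm₀) (hs2 m₀ hm₀)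
  have e : ψ⁻¹ * (y * gaussExcess M.fam.omega m v - gaussExcess M.cumul m v) -
      1 / 2 * (v * (φ⁻¹ * (y * w m₀ - b m₀))) =
      ψ⁻¹ * (y * (gaussExcess M.fam.omega m v - v / 2 * w m) -
        (gaussExcess M.cumul m v - v / 2 * b m)) +
      v / 2 * (ψ⁻¹ * (y * (w m - w m₀) - (b m - b m₀))) +
      v / 2 * ((ψ⁻¹ - φ⁻¹) * (y * w m₀ - b m₀)) := by ring
  rw [e]
  refine ((abs_add_three _ _ _).trans (add_le_add (add_le_add t1 t2) t3)).trans ?_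
  have n1 : 0 ≤ a * (K1 + K2) * (vmax * κ) * (1 + |y|) := by positivity
  have n2 : 0 ≤ (1 / 2 * (a * (L1 + L2)) + 1 / 2 * (a * φ⁻¹ * (S1 + S2))) * (vmax * √vmax)
    * (1 + |y|) := by positivity
  linarith

theorem linVar_nonneg (i : Fin n) {A : Matrix (BasisIdx (M.dim n)) (BasisIdx (M.dim n)) ℝ}
    (hA : A.PosSemidef) : 0 ≤ M.linVar i A := by
  have h := hA.dotProduct_mulVec_nonneg (M.z n i)
  simp only [star_trivial] at h
  exact h

/-- The quadratic approximation is taken at $\theta^0$ for every $\theta$, so it cancels when two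
parameters are compared at the same $A$. -/
theorem exists_smoothing_bound (hM : M.Regular) (R : ℝ) (hφ : 0 < M.phi0) :
    ∃ K, 0 ≤ K ∧ ∀ (n : ℕ) (y : Fin n → ℝ) (θ : Param p e (M.dim n))
      (A : Matrix (BasisIdx (M.dim n)) (BasisIdx (M.dim n)) ℝ) (vmax κ : ℝ),
      (∀ i, |M.eta i θ| ≤ R) → (∀ i, |M.eta i (M.theta0 e n)| ≤ R) →
      M.phi0 / 2 ≤ dispersion M.phi0 θ → A.PosSemidef → (∀ i, M.linVar i A ≤ vmax) →
      vmax ≤ 1 / 4 → (∀ i, |M.eta i θ - M.eta i (M.theta0 e n)| ≤ κ) →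
      |dispersion M.phi0 θ - M.phi0| ≤ κ →
      |M.smoothing y θ A - 1 / 2 * ∑ i, M.linVar i A * M.curv i (y i) (M.theta0 e n)| ≤
        K * (vmax * (√vmax + κ)) * ∑ i, (1 + |y i|) := by
  obtain ⟨K, hK, hb⟩ := M.exists_smoothing_summand_bound hM R hφ
  refine ⟨K, hK, fun n y θ A vmax κ h1 h2 h3 hA h4 h5 h6 h7 => ?_⟩
  rw [smoothing, Finset.mul_sum, ← Finset.sum_sub_distrib, Finset.mul_sum]
  refine (Finset.abs_sum_le_sum_abs _ _).trans (Finset.sum_le_sum fun i _ => ?_)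
  have := hb (y i) _ _ _ (M.linVar i A) _ _ (h1 i) (h2 i) h3
    (M.linVar_nonneg i hA) (h4 i) h5 (h6 i) h7
  rw [curv, dispersion_theta0]
  exact this

theorem linVar_smul (i : Fin n) (A : Matrix (BasisIdx (M.dim n)) (BasisIdx (M.dim n)) ℝ) (c : ℝ) :
    M.linVar i (c • A) = c * M.linVar i A := by
  simp [linVar, Matrix.smul_mulVec]

theorem card_basisIdx : (Fintype.card (BasisIdx (M.dim n)) : ℝ) = M.d n := by
  simp [d]

theorem linVar_le {C : ℝ} (i : Fin n) {A : Matrix (BasisIdx (M.dim n)) (BasisIdx (M.dim n)) ℝ}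
    (hA : A.PosSemidef) (hz : ∀ k, |M.z n i k| ≤ C) :
    M.linVar i A ≤ M.d n * C ^ 2 * A.trace := by
  refine (PosSemidef.quadForm_le hA _).trans ?_
  have := hA.trace_nonneg
  gcongr
  calc M.z n i ⬝ᵥ M.z n i ≤ ∑ _k : BasisIdx (M.dim n), C ^ 2 := by
        refine Finset.sum_le_sum fun k _ => ?_
        rw [← sq, ← sq_abs]
        have := hz k
        gcongr
    _ = _ := by
        rw [Finset.sum_const, Finset.card_univ, nsmul_eq_mul, card_basisIdx]

theorem abs_eta_sub_le {C : ℝ} (hC : 0 ≤ C) (i : Fin n) (hx : ∀ j, |M.x n i j| ≤ C)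
    (hz : ∀ k, |M.z n i k| ≤ C) (θ θ' : Param p e (M.dim n)) :
    |M.eta i θ - M.eta i θ'| ≤ C * √(Fintype.card (ParamIdx p e (M.dim n))) * ‖θ - θ'‖ := by
  have e1 : M.eta i θ - M.eta i θ' = ∑ r, M.coords e i r * (θ - θ') r := by
    simp only [eta, linPred_eq_sum, coords, ← Finset.sum_sub_distrib, PiLp.sub_apply, mul_sub]
  have hc : ∀ r, |M.coords e i r| ≤ C := by
    rintro (j | l | k)
    · exact hx j
    · simpa [coords, design] using hC
    · exact hz k
  rw [e1]
  refine abs_le_of_sq_le_sq ?_ (by positivity)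
  refine (Finset.sum_mul_sq_le_sq_mul_sq _ _ _).trans ?_
  rw [mul_pow, mul_pow, Real.sq_sqrt (by positivity), EuclideanSpace.real_norm_sq_eq]
  gcongr
  calc ∑ r, M.coords e i r ^ 2 ≤ ∑ _r : ParamIdx p e (M.dim n), C ^ 2 := by
        refine Finset.sum_le_sum fun r _ => ?_
        rw [← sq_abs]
        have := hc r
        gcongr
    _ = _ := by
        rw [Finset.sum_const, Finset.card_univ, nsmul_eq_mul, mul_comm]

/-- The deviation of the Hessian of the log-likelihood at the true parameter from its mean. -/
def hessDev (y : Fin n → ℝ) (r s : ParamIdx p e (M.dim n)) : ℝ :=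
  ∑ i, (partialDeriv r (partialDeriv s (M.logf i (y i))) (M.theta0 e n) -
    ∫ t, partialDeriv r (partialDeriv s (M.logf i t)) (M.theta0 e n) ∂(M.trueLaw e n i))

theorem sum_hessian_eq (hn : 0 < n) (y : Fin n → ℝ) (r s : ParamIdx p e (M.dim n)) :
    ∑ i, partialDeriv r (partialDeriv s (M.logf i (y i))) (M.theta0 e n) =
      M.hessDev y r s - n * M.fisherInfo e n r s := by
  have hn' : (n : ℝ) ≠ 0 := by positivity
  rw [hessDev, fisherInfo, mul_inv_cancel_left₀ hn', Finset.sum_sub_distrib]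
  simp only [integral_neg, Finset.sum_neg_distrib]
  ring

/-- Every Taylor term is estimated by Cauchy–Schwarz over all index tuples. Hence moment bounds for
single entries suffice; the price is powers of $d$, for which the growth condition pays. -/
theorem logLik_sub_le (hn : 0 < n) {y : Fin n → ℝ} {U : Set (Param p e (M.dim n))} (hU : IsOpen U)
    (hsm : ∀ i, ContDiffOn ℝ 3 (M.logf i (y i)) U) {ρ : ℝ}
    (hball : Metric.closedBall (M.theta0 e n) ρ ⊆ U)
    {G : Fin n → ParamIdx p e (M.dim n) → ParamIdx p e (M.dim n) → ParamIdx p e (M.dim n) → ℝ}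
    (hG : ∀ i r s t, ∀ θ ∈ U,
      |partialDeriv r (partialDeriv s (partialDeriv t (M.logf i (y i)))) θ| ≤ G i r s t)
    {g w T c : ℝ} (hg : 0 ≤ g) (hw : 0 ≤ w) (hT : 0 ≤ T)
    (h1 : ∑ r, (∑ i, partialDeriv r (M.logf i (y i)) (M.theta0 e n)) ^ 2 ≤ g ^ 2)
    (h2 : ∑ r : ParamIdx p e (M.dim n), ∑ s, M.hessDev y r s ^ 2 ≤ w ^ 2)
    (h3 : ∑ r, ∑ s, ∑ t, (∑ i, G i r s t) ^ 2 ≤ T ^ 2)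
    (hc : ∀ v : ParamIdx p e (M.dim n) → ℝ, c * (v ⬝ᵥ v) ≤ v ⬝ᵥ (M.fisherInfo e n *ᵥ v))
    {θ : Param p e (M.dim n)} (hθ : ‖θ - M.theta0 e n‖ = ρ) :
    ∑ i, M.logf i (y i) θ - ∑ i, M.logf i (y i) (M.theta0 e n) ≤
      ρ * g + 1 / 2 * (w - n * c) * ρ ^ 2 + ρ ^ 3 * T := by
  set θ₀ := M.theta0 e n
  set u := θ - θ₀ with hu
  have hρ : 0 ≤ ρ := hθ ▸ norm_nonneg _
  have husq : ∑ r, u r ^ 2 = ρ ^ 2 := by rw [← hθ, EuclideanSpace.real_norm_sq_eq]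
  have hmem : ∀ t ∈ Set.Icc (0 : ℝ) 1, θ₀ + t • u ∈ U := fun t ht => hball (by
    rw [Metric.mem_closedBall, dist_eq_norm, add_sub_cancel_left, norm_smul, hθ,
      Real.norm_of_nonneg ht.1]
    nlinarith [ht.2])
  have htaylor : ∀ i, M.logf i (y i) θ - M.logf i (y i) θ₀ ≤
      ∑ r, u r * partialDeriv r (M.logf i (y i)) θ₀ +
      (∑ r, ∑ s, u r * u s * partialDeriv s (partialDeriv r (M.logf i (y i))) θ₀) / 2 +
      ∑ r, ∑ s, ∑ t, |u r| * |u s| * |u t| * G i t s r := fun i => by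
    have := (abs_le.1 (abs_taylor_two_le (hsm i) hU hmem (hG i))).2
    rw [hu, add_sub_cancel] at this
    linarith
  have hsum : ∑ i, M.logf i (y i) θ - ∑ i, M.logf i (y i) θ₀ ≤
      ∑ r, u r * (∑ i, partialDeriv r (M.logf i (y i)) θ₀) +
      (∑ r, ∑ s, u r * u s * (∑ i, partialDeriv s (partialDeriv r (M.logf i (y i))) θ₀)) / 2 +
      ∑ r, ∑ s, ∑ t, |u r| * |u s| * |u t| * ∑ i, G i t s r := by
    rw [← Finset.sum_sub_distrib]
    refine (Finset.sum_le_sum fun i _ => htaylor i).trans_eq ?_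
    rw [Finset.sum_add_distrib, Finset.sum_add_distrib, ← Finset.sum_div]
    simp only [Finset.mul_sum]
    congr 1
    · congr 1
      · exact Finset.sum_comm
      · congr 1
        rw [Finset.sum_comm]
        exact Finset.sum_congr rfl fun r _ => Finset.sum_comm
    · rw [Finset.sum_comm]
      refine Finset.sum_congr rfl fun r _ => ?_
      rw [Finset.sum_comm]
      exact Finset.sum_congr rfl fun s _ => Finset.sum_comm
  have b1 : ∑ r, u r * (∑ i, partialDeriv r (M.logf i (y i)) θ₀) ≤ ρ * g :=
    sum_mul_le_of_sum_sq_le _ hρ hg husq.le h1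
  have b3 : ∑ r, ∑ s, ∑ t, |u r| * |u s| * |u t| * ∑ i, G i t s r ≤ ρ ^ 3 * T := by
    refine cubic_le hρ hT husq.le (le_trans (le_of_eq ?_) h3)
    -- The three sums are reordered to undo the reversed indices of the Taylor remainder.
    rw [Finset.sum_comm' (t' := Finset.univ) (s' := fun _ => Finset.univ) (by simp)]
    rw [Finset.sum_congr rfl fun s _ => Finset.sum_comm]
    rw [Finset.sum_comm]
  have b2 : ∑ r, ∑ s, u r * u s * (∑ i, partialDeriv s (partialDeriv r (M.logf i (y i))) θ₀) ≤
      ρ ^ 2 * w - n * (c * ρ ^ 2) := by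
    have e1 : ∑ r, ∑ s, u r * u s * (∑ i, partialDeriv s (partialDeriv r (M.logf i (y i))) θ₀) =
        ∑ s, ∑ r, u s * u r * M.hessDev y s r - n * ((u : ParamIdx p e (M.dim n) → ℝ) ⬝ᵥ
          (M.fisherInfo e n *ᵥ u)) := by
      rw [Finset.sum_comm]
      have hs : ∀ r s, ∑ i, partialDeriv r (partialDeriv s (M.logf i (y i))) θ₀ =
          M.hessDev y r s - n * M.fisherInfo e n r s := M.sum_hessian_eq hn y
      simp only [hs]
      simp only [dotProduct, Matrix.mulVec, Finset.mul_sum,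
        ← Finset.sum_sub_distrib]
      exact Finset.sum_congr rfl fun r _ => Finset.sum_congr rfl fun s _ => by ring
    have e2 := quadratic_le hw husq.le h2
    have e3 := hc u
    have e4 : (u : ParamIdx p e (M.dim n) → ℝ) ⬝ᵥ u = ρ ^ 2 := by
      rw [← husq]; simp only [dotProduct, sq]
    rw [e4] at e3
    rw [e1]
    have := mul_le_mul_of_nonneg_left e3 (Nat.cast_nonneg (α := ℝ) n)
    linarith
  linarith

/-- The sum is the inner product of $A$ with the coefficient block of the Hessian of the
log-likelihood. The mean of that block contributes at most $-nc\operatorname{tr}A$, and the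
deviation at most its Frobenius norm times that of $A$. -/
theorem sum_linVar_curv_le (hM : M.Regular) (hn : 0 < n) {y : Fin n → ℝ}
    {U : Set (Param p e (M.dim n))} (hU : IsOpen U) (hU0 : M.theta0 e n ∈ U)
    (hsm : ∀ i, ContDiffOn ℝ 3 (M.logf i (y i)) U) {w c : ℝ} (hw : 0 ≤ w)
    (h2 : ∑ r : ParamIdx p e (M.dim n), ∑ s, M.hessDev y r s ^ 2 ≤ w ^ 2)
    (hc : ∀ v : ParamIdx p e (M.dim n) → ℝ, c * (v ⬝ᵥ v) ≤ v ⬝ᵥ (M.fisherInfo e n *ᵥ v))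
    {A : Matrix (BasisIdx (M.dim n)) (BasisIdx (M.dim n)) ℝ} (hA : A.PosSemidef) :
    ∑ i, M.linVar i A * M.curv i (y i) (M.theta0 e n) ≤ -((n * c - w) * A.trace) := by
  set J : BasisIdx (M.dim n) → ParamIdx p e (M.dim n) := fun k => Sum.inr (Sum.inr k) with hJ
  have e1 : ∑ i, M.linVar i A * M.curv i (y i) (M.theta0 e n) =
      ∑ k, ∑ l, A k l * (M.hessDev y (J k) (J l)) -
        n * ∑ k, ∑ l, A k l * M.fisherInfo e n (J k) (J l) := by
    have : ∀ k l, A k l * M.hessDev y (J k) (J l) - n * (A k l * M.fisherInfo e n (J k) (J l)) =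
        ∑ i, A k l * (M.z n i k * M.z n i l) * M.curv i (y i) (M.theta0 e n) := fun k l => by
      have h3 := M.sum_hessian_eq hn y (J k) (J l)
      rw [show A k l * M.hessDev y (J k) (J l) - n * (A k l * M.fisherInfo e n (J k) (J l)) =
        A k l * (M.hessDev y (J k) (J l) - n * M.fisherInfo e n (J k) (J l)) by ring, ← h3,
        Finset.mul_sum]
      refine Finset.sum_congr rfl fun i _ => ?_
      rw [M.partialDeriv_partialDeriv_logf hM hU (hsm i) hU0 (by simp [hJ]) (by simp [hJ])]
      simp only [coords, design, hJ, Sum.elim_inr]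
      ring
    simp only [Finset.mul_sum, ← Finset.sum_sub_distrib, this]
    simp only [linVar, quadForm_eq_sum, Finset.sum_mul]
    rw [Finset.sum_comm]
    exact Finset.sum_congr rfl fun k _ => Finset.sum_comm
  have e2 : ∑ k, ∑ l, A k l * (M.hessDev y (J k) (J l)) ≤ A.trace * w := by
    refine sum_sum_mul_le hA.trace_nonneg hw (PosSemidef.sum_sq_le hA) (le_trans ?_ h2)
    have hinner : ∀ r : ParamIdx p e (M.dim n), ∑ l, M.hessDev y r (J l) ^ 2 ≤
        ∑ s, M.hessDev y r s ^ 2 := fun r => by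
      rw [Fintype.sum_sum_type, Fintype.sum_sum_type]
      have n1 := Finset.sum_nonneg fun (a : Fin p) (_ : a ∈ Finset.univ) =>
        sq_nonneg (M.hessDev y r (Sum.inl a))
      have n2 := Finset.sum_nonneg fun (a : Fin e) (_ : a ∈ Finset.univ) =>
        sq_nonneg (M.hessDev y r (Sum.inr (Sum.inl a)))
      linarith
    calc ∑ k, ∑ l, M.hessDev y (J k) (J l) ^ 2 ≤ ∑ k, ∑ s, M.hessDev y (J k) s ^ 2 :=
          Finset.sum_le_sum fun k _ => hinner _
      _ ≤ _ := by
          rw [Fintype.sum_sum_type, Fintype.sum_sum_type (α₁ := Fin e)]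
          have n1 := Finset.sum_nonneg fun (a : Fin p) (_ : a ∈ Finset.univ) =>
            Finset.sum_nonneg fun (s : ParamIdx p e (M.dim n)) (_ : s ∈ Finset.univ) =>
              sq_nonneg (M.hessDev y (Sum.inl a) s)
          have n2 := Finset.sum_nonneg fun (a : Fin e) (_ : a ∈ Finset.univ) =>
            Finset.sum_nonneg fun (s : ParamIdx p e (M.dim n)) (_ : s ∈ Finset.univ) =>
              sq_nonneg (M.hessDev y (Sum.inr (Sum.inl a)) s)
          linarith
  have e3 : c * A.trace ≤ ∑ k, ∑ l, A k l * M.fisherInfo e n (J k) (J l) := by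
    refine PosSemidef.le_sum_mul hA (J := fun k l => M.fisherInfo e n (J k) (J l)) fun v => ?_
    have := hc (Sum.elim (fun _ => 0) (Sum.elim (fun _ => 0) v))
    simpa [dotProduct, Matrix.mulVec, Fintype.sum_sum_type] using this
  rw [e1]
  have := mul_le_mul_of_nonneg_left e3 (Nat.cast_nonneg (α := ℝ) n)
  linarith

end GAMSeq

end GAM
end

/-! ### Variational estimates for samples with explicit bounds, and the norm of the true
coefficients. -/

noncomputable section

namespace GAM

namespace GAMSeq

variable {p q : ℕ} (M : GAMSeq p q) {e n : ℕ}

theorem continuous_eta (i : Fin n) : Continuous fun θ : Param p e (M.dim n) => M.eta i θ := by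
  unfold eta linPred
  fun_prop

theorem continuous_linVar (i : Fin n) :
    Continuous fun A : Matrix (BasisIdx (M.dim n)) (BasisIdx (M.dim n)) ℝ => M.linVar i A := by
  unfold linVar
  exact continuous_const.dotProduct (continuous_id.matrix_mulVec continuous_const)

theorem continuous_penalty : Continuous fun w : Param p e (M.dim n) ×
    Matrix (BasisIdx (M.dim n)) (BasisIdx (M.dim n)) ℝ => M.penalty w.1 w.2 := by
  unfold penalty
  refine continuous_const.mul (continuous_finsetSum _ fun j _ => ?_)
  have hc : Continuous fun w : Param p e (M.dim n) ×
      Matrix (BasisIdx (M.dim n)) (BasisIdx (M.dim n)) ℝ =>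
        fun k => coef w.1 (⟨j, k⟩ : BasisIdx (M.dim n)) := by
    unfold coef
    fun_prop
  refine (continuous_const.sub (continuous_const.mul ?_)).sub (continuous_const.mul ?_)
  · exact hc.dotProduct (continuous_const.matrix_mulVec hc)
  · exact (continuous_const.matrix_mul (continuous_snd.matrix_submatrix _ _)).matrix_trace

theorem continuousOn_smoothing (hM : M.Regular) (y : Fin n → ℝ) {V : Set (Param p e (M.dim n))}
    (hV : V ⊆ M.paramSpace e n) :
    ContinuousOn (fun w : Param p e (M.dim n) ×
      Matrix (BasisIdx (M.dim n)) (BasisIdx (M.dim n)) ℝ => M.smoothing y w.1 w.2)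
      (V ×ˢ {A | A.PosSemidef}) := by
  unfold smoothing
  refine continuousOn_finsetSum _ fun i _ => ?_
  have hm : ContinuousOn (fun w : Param p e (M.dim n) ×
      Matrix (BasisIdx (M.dim n)) (BasisIdx (M.dim n)) ℝ => (M.eta i w.1, M.linVar i w.2))
      (V ×ˢ {A | A.PosSemidef}) :=
    (((M.continuous_eta i).comp continuous_fst).prodMk
      ((M.continuous_linVar i).comp continuous_snd)).continuousOn
  have hmaps : Set.MapsTo (fun w : Param p e (M.dim n) ×
      Matrix (BasisIdx (M.dim n)) (BasisIdx (M.dim n)) ℝ => (M.eta i w.1, M.linVar i w.2))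
      (V ×ˢ {A | A.PosSemidef}) {w : ℝ × ℝ | 0 ≤ w.2} := fun w hw => M.linVar_nonneg i hw.2
  refine ContinuousOn.mul (ContinuousOn.inv₀ ?_ ?_) ?_
  · exact ((continuous_dispersion M.phi0).comp continuous_fst).continuousOn
  · exact fun w hw => (M.fam.disp_pos _ (hV hw.1)).ne'
  · exact (continuousOn_const.mul
      ((continuousOn_gaussExcess hM.omega hM.int_omega).comp hm hmaps)).sub
      ((continuousOn_gaussExcess hM.cumul hM.int_cumul).comp hm hmaps)

/-- Both penalties share $A$, so the trace terms cancel and only the quadratic forms in the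
coefficients are compared. -/
theorem penalty_sub_le {r : Fin q → ℕ} (hS : ∀ j, IsDifferencePenalty (r j) (M.S n j))
    (hlam : ∀ j, 0 < M.lam n j) {B : ℝ} (hB : 0 ≤ B)
    (hcoef : ∑ k, coef (M.theta0 e n) k ^ 2 ≤ B ^ 2) (θ : Param p e (M.dim n))
    (A : Matrix (BasisIdx (M.dim n)) (BasisIdx (M.dim n)) ℝ) :
    M.penalty θ A - M.penalty (M.theta0 e n) A ≤
      ‖θ - M.theta0 e n‖ * B * ∑ j, M.lam n j * 4 ^ r j := by
  rw [penalty, penalty, ← mul_sub, ← Finset.sum_sub_distrib, Finset.mul_sum, Finset.mul_sum]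
  refine Finset.sum_le_sum fun j _ => ?_
  have hsub : ∀ a : BasisIdx (M.dim n) → ℝ, ∑ k, a ⟨j, k⟩ ^ 2 ≤ ∑ k, a k ^ 2 := fun a => by
    rw [Fintype.sum_sigma]
    exact Finset.single_le_sum (f := fun j => ∑ k, a ⟨j, k⟩ ^ 2)
      (fun _ _ => Finset.sum_nonneg fun _ _ => sq_nonneg _) (Finset.mem_univ j)
  have h1 : ∑ k, (coef θ ⟨j, k⟩ - coef (M.theta0 e n) ⟨j, k⟩) ^ 2 ≤ ‖θ - M.theta0 e n‖ ^ 2 := by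
    refine (hsub fun k => coef θ k - coef (M.theta0 e n) k).trans ?_
    rw [EuclideanSpace.real_norm_sq_eq, Fintype.sum_sum_type, Fintype.sum_sum_type]
    have n1 := Finset.sum_nonneg fun (a : Fin p) (_ : a ∈ Finset.univ) =>
      sq_nonneg ((θ - M.theta0 e n) (Sum.inl a))
    have n2 := Finset.sum_nonneg fun (a : Fin e) (_ : a ∈ Finset.univ) =>
      sq_nonneg ((θ - M.theta0 e n) (Sum.inr (Sum.inl a)))
    have e1 : ∑ k, (coef θ k - coef (M.theta0 e n) k) ^ 2 =
      ∑ k, (θ - M.theta0 e n) (Sum.inr (Sum.inr k)) ^ 2 := rfl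
    linarith
  have h2 := (hS j).neg_le_quadForm_sub (norm_nonneg (θ - M.theta0 e n)) hB h1
    ((hsub _).trans hcoef)
  nlinarith [hlam j, mul_le_mul_of_nonneg_left h2 (hlam j).le]

theorem penalty_le_half {r : Fin q → ℕ} (hS : ∀ j, IsDifferencePenalty (r j) (M.S n j))
    (hlam : ∀ j, 0 < M.lam n j) (θ : Param p e (M.dim n))
    {A : Matrix (BasisIdx (M.dim n)) (BasisIdx (M.dim n)) ℝ} (hA : A.PosSemidef) :
    M.penalty θ A ≤ M.penalty θ ((1 / 2 : ℝ) • A) := by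
  rw [penalty, penalty]
  gcongr with j
  · exact (hlam j).le
  · have h := trace_mul_nonneg (hA.submatrix (Sigma.mk j)) (hS j).1.posSemidef
    have e1 : (M.S n j * ((1 / 2 : ℝ) • A).submatrix (Sigma.mk j) (Sigma.mk j)).trace =
        1 / 2 * (M.S n j * A.submatrix (Sigma.mk j) (Sigma.mk j)).trace := by
      rw [show ((1 / 2 : ℝ) • A).submatrix (Sigma.mk j) (Sigma.mk j) =
        (1 / 2 : ℝ) • A.submatrix (Sigma.mk j) (Sigma.mk j) from rfl, Matrix.mul_smul,
        Matrix.trace_smul, smul_eq_mul]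
    rw [e1]
    linarith

theorem log_det_half {A : Matrix (BasisIdx (M.dim n)) (BasisIdx (M.dim n)) ℝ} (hA : A.PosDef) :
    Real.log ((1 / 2 : ℝ) • A).det = Real.log A.det - M.d n * Real.log 2 := by
  rw [Matrix.det_smul, Real.log_mul (by positivity) hA.det_pos.ne', Real.log_pow, card_basisIdx,
    one_div, Real.log_inv]
  ring

/-- The existence of a variational estimate in the ball with radius `ρ` around the true parameter,
for a sample that satisfies explicit bounds. -/
theorem exists_isVAEstimate_of_bounds (hM : M.Regular) (hint : M.VariationalIntegrable e)
    [Nonempty (BasisIdx (M.dim n))] {r : Fin q → ℕ}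
    (hS : ∀ j, IsDifferencePenalty (r j) (M.S n j)) (hlam : ∀ j, 0 < M.lam n j)
    (hn : 0 < n) {y : Fin n → ℝ} {U : Set (Param p e (M.dim n))} (hU : IsOpen U)
    (hUs : U ⊆ M.paramSpace e n) (hsm : ∀ i, ContDiffOn ℝ 3 (M.logf i (y i)) U) {ρ τ : ℝ}
    (hρ : 0 < ρ) (hτ : 0 < τ) (hball : Metric.closedBall (M.theta0 e n) ρ ⊆ U)
    {G : Fin n → ParamIdx p e (M.dim n) → ParamIdx p e (M.dim n) → ParamIdx p e (M.dim n) → ℝ}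
    (hG : ∀ i r s t, ∀ θ ∈ U,
      |partialDeriv r (partialDeriv s (partialDeriv t (M.logf i (y i)))) θ| ≤ G i r s t)
    {g w T c B err : ℝ} (hg : 0 ≤ g) (hw : 0 ≤ w) (hT : 0 ≤ T) (hB : 0 ≤ B)
    (h1 : ∑ r, (∑ i, partialDeriv r (M.logf i (y i)) (M.theta0 e n)) ^ 2 ≤ g ^ 2)
    (h2 : ∑ r : ParamIdx p e (M.dim n), ∑ s, M.hessDev y r s ^ 2 ≤ w ^ 2)
    (h3 : ∑ r, ∑ s, ∑ t, (∑ i, G i r s t) ^ 2 ≤ T ^ 2)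
    (hc : ∀ v : ParamIdx p e (M.dim n) → ℝ, c * (v ⬝ᵥ v) ≤ v ⬝ᵥ (M.fisherInfo e n *ᵥ v))
    (hcoef : ∑ k, coef (M.theta0 e n) k ^ 2 ≤ B ^ 2)
    (herr : ∀ θ : Param p e (M.dim n), ‖θ - M.theta0 e n‖ ≤ ρ →
      ∀ A : Matrix (BasisIdx (M.dim n)) (BasisIdx (M.dim n)) ℝ, A.PosSemidef → A.trace ≤ τ →
      |M.smoothing y θ A - 1 / 2 * ∑ i, M.linVar i A * M.curv i (y i) (M.theta0 e n)| ≤ err)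
    (hnum1 : ρ * g + 1 / 2 * (w - n * c) * ρ ^ 2 + ρ ^ 3 * T + 2 * err +
      ρ * B * ∑ j, M.lam n j * 4 ^ r j < 0)
    (hnum2 : 1 / 2 * (M.d n * Real.log 2) + 2 * err < 1 / 4 * ((n * c - w) * τ)) :
    ∃ (θ : Param p e (M.dim n)) (A : Matrix (BasisIdx (M.dim n)) (BasisIdx (M.dim n)) ℝ),
      ‖θ - M.theta0 e n‖ ≤ ρ ∧ M.IsVAEstimate y θ A := by
  have hbs := hball.trans hUs
  have h0 : M.theta0 e n ∈ Metric.closedBall (M.theta0 e n) ρ := Metric.mem_closedBall_self hρ.le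
  have hmem : ∀ θ : Param p e (M.dim n), ‖θ - M.theta0 e n‖ ≤ ρ →
      θ ∈ Metric.closedBall (M.theta0 e n) ρ := fun θ h => by
    rwa [Metric.mem_closedBall, dist_eq_norm]
  have hℓ : ∀ θ ∈ Metric.closedBall (M.theta0 e n) ρ,
      ∀ A : Matrix (BasisIdx (M.dim n)) (BasisIdx (M.dim n)) ℝ, A.PosDef →
      M.varLogLik y θ A = (∑ i, M.logf i (y i) θ + M.smoothing y θ A + M.penalty θ A) +
        2⁻¹ * Real.log A.det := fun θ hθ A hA => M.varLogLik_eq hM hint y (hbs hθ) hA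
  refine Exists.imp (fun θ => Exists.imp fun A h => ⟨h.1, h.2.1, h.2.2.1, h.2.2.2⟩)
    (exists_isLocalMaxOn_of_boundary (Θ := M.paramSpace e n) (ℓ := M.varLogLik y)
      (R := fun θ A => ∑ i, M.logf i (y i) θ + M.smoothing y θ A + M.penalty θ A)
      hρ hτ hbs ?_ hℓ ?_ ?_)
  · refine (ContinuousOn.add ?_ (M.continuousOn_smoothing hM y hbs)).add
      M.continuous_penalty.continuousOn
    refine continuousOn_finsetSum _ fun i _ => ?_
    exact ((hsm i).continuousOn.mono hball).comp continuousOn_fst fun w hw => hw.1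
  -- The sphere: $A$ is kept, so the determinants cancel, and the two smoothing terms have the same
  -- main part and differ by at most `2 * err`.
  · intro θ hθ A hA hAτ
    rw [hℓ θ (hmem θ hθ.le) A hA, hℓ _ h0 A hA]
    have b1 := M.logLik_sub_le hn hU hsm hball hG hg hw hT h1 h2 h3 hc hθ
    have b2 := M.penalty_sub_le hS hlam hB hcoef θ A
    have b3 := (abs_le.1 (herr θ hθ.le A hA.posSemidef hAτ)).2
    have b4 := (abs_le.1 (herr (M.theta0 e n) (by simpa using hρ.le) A hA.posSemidef hAτ)).1
    rw [hθ] at b2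
    linarith
  -- The face: halving $A$ lowers half the log-determinant by $\frac12d\ln2$, while half of the
  -- negative curvature term disappears, a gain of at least $\frac14(nc-w)\tau$ up to `2 * err`.
  · intro θ hθ A hA hAτ
    have hA2 : ((1 / 2 : ℝ) • A).PosDef := hA.smul (by norm_num)
    have htr : ((1 / 2 : ℝ) • A).trace ≤ τ := by
      rw [Matrix.trace_smul, smul_eq_mul, hAτ]
      linarith
    rw [hℓ θ (hmem θ hθ) A hA, hℓ θ (hmem θ hθ) _ hA2, M.log_det_half hA]
    have b1 := M.penalty_le_half hS hlam θ hA.posSemidef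
    have b2 := M.sum_linVar_curv_le hM hn hU (hball h0) hsm hw h2 hc hA.posSemidef
    have b3 := (abs_le.1 (herr θ hθ A hA.posSemidef hAτ.le)).2
    have b4 := (abs_le.1 (herr θ hθ _ hA2.posSemidef htr)).1
    simp only [linVar_smul, mul_assoc, ← Finset.mul_sum] at b4
    rw [hAτ] at b2
    linarith

/-- For $v=\theta^0$ with the dispersion coordinate set to zero, the information form is the average
of $J_i\eta_i^2$ and is bounded because the $\eta_i$ are. The lower eigenvalue bound turns this into
a bound for the norm of $v$. -/
theorem exists_coef_bound (hM : M.Regular) (h1 : M.CondC1 e) (h3 : M.CondC3 e)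
    (h4 : M.CondC4 e) : ∃ B, 0 ≤ B ∧ ∀ᶠ n in atTop, ∑ k, coef (M.theta0 e n) k ^ 2 ≤ B ^ 2 := by
  obtain ⟨K, hK, hmom⟩ := M.exists_abs_moment_bound hM h3
  obtain ⟨C2, hC2⟩ := h3.2.2
  obtain ⟨S1, hS1, hs1⟩ := exists_bound_of_continuous
    (ContDiff.continuous_deriv_three hM.omega).2.1 C2
  obtain ⟨S2, hS2, hs2⟩ := exists_bound_of_continuous
    (ContDiff.continuous_deriv_three hM.cumul).2.1 C2
  have h0 := fun n => interior_subset (h3.1 n)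
  have hφ : 0 < M.phi0 := M.fam.disp_pos _ (M.phi0_mem (h0 0))
  obtain ⟨c, hc, hev⟩ := h4.2
  set Jm := M.phi0⁻¹ * (K * S1 + S2) with hJm
  have hJm0 : 0 ≤ Jm := by positivity
  refine ⟨√(Jm * C2 ^ 2 / c), Real.sqrt_nonneg _, hev.mono fun n hn => ?_⟩
  rw [Real.sq_sqrt (by positivity), le_div_iff₀ hc, mul_comm]
  set J : Fin n → ℝ := fun i => ∫ y, -M.curv i y (M.theta0 e n) ∂(M.trueLaw e n i) with hJ
  have hJb : ∀ i, J i ≤ Jm := fun i => by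
    have := M.isProbabilityMeasure_trueLaw (h0 n) i
    have hb : ∀ y, |-M.curv i y (M.theta0 e n)| ≤ M.phi0⁻¹ * (|y| * S1 + S2) := fun y => by
      rw [curv, dispersion_theta0, abs_neg, abs_mul, abs_of_pos (inv_pos.2 hφ)]
      gcongr
      refine (abs_sub _ _).trans ?_
      rw [abs_mul]
      gcongr
      · exact hs1 _ (hC2 n i).le
      · exact hs2 _ (hC2 n i).le
    have hi : Integrable (fun y => M.phi0⁻¹ * (|y| * S1 + S2)) (M.trueLaw e n i) :=
      (((hmom n i).1.mul_const _).add (integrable_const _)).const_mul _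
    calc J i ≤ |J i| := le_abs_self _
      _ ≤ ∫ y, |-M.curv i y (M.theta0 e n)| ∂(M.trueLaw e n i) := abs_integral_le_integral_abs
      _ ≤ ∫ y, M.phi0⁻¹ * (|y| * S1 + S2) ∂(M.trueLaw e n i) :=
          integral_mono_of_nonneg (Eventually.of_forall fun y => abs_nonneg _) hi
            (Eventually.of_forall hb)
      _ ≤ _ := by
          rw [integral_const_mul, integral_add ((hmom n i).1.mul_const _) (integrable_const _),
            integral_mul_const]
          simp only [integral_const, probReal_univ, smul_eq_mul, one_mul]
          have := (hmom n i).2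
          rw [hJm]
          gcongr
  set v : ParamIdx p e (M.dim n) → ℝ := fun s =>
    Sum.elim (fun j => M.theta0 e n (Sum.inl j)) (Sum.elim (fun _ => 0) fun k =>
      M.theta0 e n (Sum.inr (Sum.inr k))) s with hv
  have hfish : ∀ r s, v r * (M.fisherInfo e n r s * v s) =
      (n : ℝ)⁻¹ * ∑ i, J i * ((M.coords e i r * v r) * (M.coords e i s * v s)) := by
    intro r s
    by_cases hr : ∃ l, r = Sum.inr (Sum.inl l)
    · obtain ⟨l, rfl⟩ := hr
      simp [hv]
    by_cases hs : ∃ l, s = Sum.inr (Sum.inl l)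
    · obtain ⟨l, rfl⟩ := hs
      simp [hv]
    push Not at hr hs
    have hint : ∀ i : Fin n,
        ∫ y, -partialDeriv r (partialDeriv s (M.logf i y)) (M.theta0 e n) ∂(M.trueLaw e n i) =
        M.coords e i r * M.coords e i s * J i := fun i => by
      rw [hJ, ← integral_const_mul]
      refine integral_congr_ae ?_
      filter_upwards [(M.trueLaw_absolutelyContinuous (e := e) i).ae_le (h1.1 n i)] with y hy
      rw [M.partialDeriv_partialDeriv_logf hM isOpen_interior (M.contDiffOn_logf hy) (h3.1 n) hr hs]
      ring
    rw [fisherInfo]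
    simp only [hint, Finset.mul_sum, Finset.sum_mul]
    exact Finset.sum_congr rfl fun i _ => by ring
  have heta : ∀ i, ∑ r, M.coords e i r * v r = M.eta i (M.theta0 e n) := fun i => by
    rw [eta, linPred_eq_sum]
    refine Finset.sum_congr rfl fun r _ => ?_
    rcases r with j | l | k <;> simp [coords, design, hv]
  have hquad : v ⬝ᵥ (M.fisherInfo e n *ᵥ v) =
      (n : ℝ)⁻¹ * ∑ i, J i * M.eta i (M.theta0 e n) ^ 2 := by
    simp only [dotProduct, Matrix.mulVec, Finset.mul_sum, hfish]
    have e1 : ∀ i, (n : ℝ)⁻¹ * (J i * M.eta i (M.theta0 e n) ^ 2) =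
        ∑ r, ∑ s, (n : ℝ)⁻¹ * (J i * ((M.coords e i r * v r) * (M.coords e i s * v s))) := fun i => by
      rw [← heta, sq, Finset.sum_mul_sum]
      simp only [Finset.mul_sum]
    simp only [e1]
    rw [Finset.sum_comm (s := (Finset.univ : Finset (Fin n)))]
    exact Finset.sum_congr rfl fun r _ => Finset.sum_comm
  have hle : v ⬝ᵥ (M.fisherInfo e n *ᵥ v) ≤ Jm * C2 ^ 2 := by
    rw [hquad]
    calc (n : ℝ)⁻¹ * ∑ i, J i * M.eta i (M.theta0 e n) ^ 2
        ≤ (n : ℝ)⁻¹ * ∑ _i : Fin n, Jm * C2 ^ 2 := by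
          have hsq : ∀ i, M.eta i (M.theta0 e n) ^ 2 ≤ C2 ^ 2 := fun i =>
            sq_le_sq' (abs_le.1 (hC2 n i).le).1 (abs_le.1 (hC2 n i).le).2
          exact mul_le_mul_of_nonneg_left (Finset.sum_le_sum fun i _ =>
            mul_le_mul (hJb i) (hsq i) (sq_nonneg _) hJm0) (by positivity)
      _ = ((n : ℝ)⁻¹ * n) * (Jm * C2 ^ 2) := by simp [mul_assoc]
      _ ≤ 1 * (Jm * C2 ^ 2) := by
          gcongr
          exact inv_mul_le_one
      _ = _ := one_mul _
  have hvv : ∑ k, coef (M.theta0 e n) k ^ 2 ≤ v ⬝ᵥ v := by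
    simp only [dotProduct, ← sq]
    rw [Fintype.sum_sum_type, Fintype.sum_sum_type]
    have n1 := Finset.sum_nonneg fun (a : Fin p) (_ : a ∈ Finset.univ) => sq_nonneg (v (Sum.inl a))
    have n2 := Finset.sum_nonneg fun (a : Fin e) (_ : a ∈ Finset.univ) =>
      sq_nonneg (v (Sum.inr (Sum.inl a)))
    have e1 : ∑ k, coef (M.theta0 e n) k ^ 2 = ∑ k, v (Sum.inr (Sum.inr k)) ^ 2 := rfl
    linarith
  exact (mul_le_mul_of_nonneg_left hvv hc.le).trans ((hn v).trans hle)

end GAMSeq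

end GAM
end

/-! ### The probability of a good sample. -/

noncomputable section

namespace GAM

section Product

variable {ι κ : Type*} [Fintype ι] [Fintype κ] {ν : ι → Measure ℝ}
  [∀ i, IsProbabilityMeasure (ν i)]

theorem pi_measure_sum_sq_sum_ge_le {X : κ → ι → ℝ → ℝ} (hX : ∀ r i, MemLp (X r i) 2 (ν i))
    (h0 : ∀ r i, ∫ y, X r i y ∂(ν i) = 0) {K T δ : ℝ} (hK : ∀ r i, ∫ y, X r i y ^ 2 ∂(ν i) ≤ K)
    (hT : 0 < T) (hδ : Fintype.card κ * (Fintype.card ι * K) ≤ δ * T) :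
    Measure.pi ν {y | T ≤ ∑ r, (∑ i, X r i (y i)) ^ 2} ≤ ENNReal.ofReal δ :=
  measure_sum_ge_le Finset.univ (fun _ _ => sq_nonneg _)
    (fun r _ => (integral_sum_sq_pi_le (hX r) (h0 r) (hK r)).1)
    (fun r _ => (integral_sum_sq_pi_le (hX r) (h0 r) (hK r)).2) hT hδ

theorem pi_measure_sum_sum_ge_le {X : κ → ι → ℝ → ℝ} (hX : ∀ r i, Integrable (X r i) (ν i))
    (h0 : ∀ r i y, 0 ≤ X r i y) {K T δ : ℝ} (hK : ∀ r i, ∫ y, X r i y ∂(ν i) ≤ K)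
    (hT : 0 < T) (hδ : Fintype.card κ * (Fintype.card ι * K) ≤ δ * T) :
    Measure.pi ν {y | T ≤ ∑ r, ∑ i, X r i (y i)} ≤ ENNReal.ofReal δ :=
  measure_sum_ge_le Finset.univ (fun _ _ => Finset.sum_nonneg fun _ _ => h0 _ _ _)
    (fun r _ => (integral_sum_pi_le (hX r) (hK r)).1)
    (fun r _ => (integral_sum_pi_le (hX r) (hK r)).2) hT hδ

end Product

namespace GAMSeq

variable {p q : ℕ} (M : GAMSeq p q) {e n : ℕ}

/-- The sample satisfies the smoothness condition and the bounds for the third derivatives on `U`,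
and the bounds `a₁`, ..., `a₄` hold for the squared score, the squared deviation of the Hessian, the
squared sums of the envelopes and the sum of the absolute responses. -/
def IsGoodSample (U : Set (Param p e (M.dim n)))
    (G : Fin n → ParamIdx p e (M.dim n) → ParamIdx p e (M.dim n) → ParamIdx p e (M.dim n) → ℝ → ℝ)
    (a₁ a₂ a₃ a₄ : ℝ) (y : Fin n → ℝ) : Prop :=
  ((∀ i, ContDiffOn ℝ 3 (M.logf i (y i)) U) ∧ ∀ i r s t, ∀ θ ∈ U,
      |partialDeriv r (partialDeriv s (partialDeriv t (M.logf i (y i)))) θ| ≤ G i r s t (y i)) ∧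
    ∑ r, (∑ i, partialDeriv r (M.logf i (y i)) (M.theta0 e n)) ^ 2 < a₁ ∧
    ∑ k : ParamIdx p e (M.dim n) × ParamIdx p e (M.dim n), M.hessDev y k.1 k.2 ^ 2 < a₂ ∧
    ∑ k : ParamIdx p e (M.dim n) × ParamIdx p e (M.dim n) × ParamIdx p e (M.dim n),
      (∑ i, G i k.1 k.2.1 k.2.2 (y i)) ^ 2 < a₃ ∧
    ∑ i, (1 + |y i|) < a₄

/-- The smoothness and envelope conditions fail only on a null set. Each of the four numerical
bounds fails with probability at most `δ` by Markov's inequality; independence enters for the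
centered sums of scores and Hessians. -/
theorem exists_measure_not_isGoodSample_le (h0 : M.theta0 e n ∈ interior (M.paramSpace e n))
    (hsm : ∀ i : Fin n, ∀ᵐ y ∂M.fam.base, ContDiffOn ℝ 3 (M.f i y) (interior (M.paramSpace e n)))
    (hscore : ∀ (i : Fin n) (r : ParamIdx p e (M.dim n)),
      Integrable (fun y => partialDeriv r (M.logf i y) (M.theta0 e n)) (M.trueLaw e n i) ∧
      ∫ y, partialDeriv r (M.logf i y) (M.theta0 e n) ∂(M.trueLaw e n i) = 0)
    (hhess : ∀ (i : Fin n) (r s : ParamIdx p e (M.dim n)),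
      Integrable (fun y => partialDeriv r (partialDeriv s (M.logf i y)) (M.theta0 e n))
        (M.trueLaw e n i))
    {U : Set (Param p e (M.dim n))} (hU : IsOpen U) (hU0 : M.theta0 e n ∈ U)
    (hUs : U ⊆ M.paramSpace e n) {C3 C4 Ky : ℝ}
    (henv : ∀ i : Fin n, ∀ r s t : ParamIdx p e (M.dim n), ∃ F G : ℝ → ℝ,
      MemLp F 2 (M.trueLaw e n i) ∧ MemLp G 2 (M.trueLaw e n i) ∧
      ∫ y, F y ^ 2 ∂(M.trueLaw e n i) < C3 ∧ ∫ y, G y ^ 2 ∂(M.trueLaw e n i) < C4 ∧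
      ∀ᵐ y ∂M.fam.base, ∀ theta ∈ U,
        |partialDeriv r (partialDeriv s (M.logf i y)) theta| ≤ F y ∧
        |partialDeriv r (partialDeriv s (partialDeriv t (M.logf i y))) theta| ≤ G y)
    (hmom : ∀ i : Fin n, Integrable (fun y => |y|) (M.trueLaw e n i) ∧
      ∫ y, |y| ∂(M.trueLaw e n i) ≤ Ky)
    {a₁ a₂ a₃ a₄ δ N : ℝ} (hN : N = Fintype.card (ParamIdx p e (M.dim n))) (h₁ : 0 < a₁)
    (h₂ : 0 < a₂) (h₃ : 0 < a₃) (h₄ : 0 < a₄) (hδ : 0 ≤ δ)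
    (hb₁ : N * (n * (1 + C3)) ≤ δ * a₁) (hb₂ : N ^ 2 * (n * C3) ≤ δ * a₂)
    (hb₃ : N ^ 3 * (n * (n * C4)) ≤ δ * a₃) (hb₄ : n * (1 + Ky) ≤ δ * a₄) :
    ∃ G, M.sampleLaw e n {y | ¬ M.IsGoodSample U G a₁ a₂ a₃ a₄ y} ≤ ENNReal.ofReal (4 * δ) := by
  have h0' := interior_subset h0
  have hprob : ∀ i, IsProbabilityMeasure (M.trueLaw e n i) := M.isProbabilityMeasure_trueLaw h0'
  have hac := fun i => M.trueLaw_absolutelyContinuous (e := e) (n := n) i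
  have hUi : U ⊆ interior (M.paramSpace e n) := interior_maximal hUs hU
  have hsmU : ∀ i : Fin n, ∀ᵐ y ∂M.fam.base, ContDiffOn ℝ 3 (M.logf i y) U := fun i =>
    (hsm i).mono fun y hy => (M.contDiffOn_logf hy).mono hUi
  choose F G hF hG hF3 hG4 hle using henv
  have : IsProbabilityMeasure (M.sampleLaw e n) := by unfold sampleLaw; infer_instance
  refine ⟨G, ?_⟩
  set B₀ : Set (Fin n → ℝ) := {y | ¬ ((∀ i, ContDiffOn ℝ 3 (M.logf i (y i)) U) ∧
    ∀ i r s t, ∀ θ ∈ U,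
      |partialDeriv r (partialDeriv s (partialDeriv t (M.logf i (y i)))) θ| ≤ G i r s t (y i))}
  set B₁ : Set (Fin n → ℝ) :=
    {y | a₁ ≤ ∑ r, (∑ i, partialDeriv r (M.logf i (y i)) (M.theta0 e n)) ^ 2}
  set B₂ : Set (Fin n → ℝ) :=
    {y | a₂ ≤ ∑ k : ParamIdx p e (M.dim n) × ParamIdx p e (M.dim n), M.hessDev y k.1 k.2 ^ 2}
  -- The envelopes are not centered, so the square of their sum is replaced by `n` times the sum of
  -- squares, which needs no independence.
  set B₃ : Set (Fin n → ℝ) :=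
    {y | a₃ ≤ ∑ k : ParamIdx p e (M.dim n) × ParamIdx p e (M.dim n) × ParamIdx p e (M.dim n),
      ∑ i, n * G i k.1 k.2.1 k.2.2 (y i) ^ 2}
  set B₄ : Set (Fin n → ℝ) := {y | a₄ ≤ ∑ _k : Unit, ∑ i, (1 + |y i|)}
  have m₀ : M.sampleLaw e n B₀ = 0 := by
    have hae : ∀ᵐ y ∂(M.sampleLaw e n), ∀ i, ContDiffOn ℝ 3 (M.logf i (y i)) U ∧ ∀ r s t, ∀ θ ∈ U,
        |partialDeriv r (partialDeriv s (partialDeriv t (M.logf i (y i)))) θ| ≤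
          G i r s t (y i) := by
      refine eventually_all.2 fun i => ?_
      refine Measure.tendsto_eval_ae_ae.eventually (p := fun t => ContDiffOn ℝ 3 (M.logf i t) U ∧
        ∀ r s k, ∀ θ ∈ U, |partialDeriv r (partialDeriv s (partialDeriv k (M.logf i t))) θ| ≤
          G i r s k t) ?_
      have hle' : ∀ᵐ y ∂M.fam.base, ∀ r s t, ∀ θ ∈ U,
          |partialDeriv r (partialDeriv s (partialDeriv t (M.logf i y))) θ| ≤ G i r s t y := by
        refine ae_all_iff.2 fun r => ae_all_iff.2 fun s => ae_all_iff.2 fun t => ?_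
        exact (hle i r s t).mono fun y hy θ hθ => (hy θ hθ).2
      filter_upwards [(hac i).ae_le (hsmU i), (hac i).ae_le hle'] with t h1 h2 using ⟨h1, h2⟩
    refine measure_mono_null (fun y hy => ?_) hae
    exact fun h => hy ⟨fun i => (h i).1, fun i => (h i).2⟩
  have m₁ : M.sampleLaw e n B₁ ≤ ENNReal.ofReal δ := by
    have hs := fun (r : ParamIdx p e (M.dim n)) (i : Fin n) =>
      M.score_second_moment h0' hU hU0 hUs (hsmU i) (hscore i r).1
      (hscore i r).2 (hF i r r r) (hF3 i r r r).le
      ((hle i r r r).mono fun y hy θ hθ => (hy θ hθ).1)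
    refine pi_measure_sum_sq_sum_ge_le (fun r i => (hs r i).1) (fun r i => (hscore i r).2)
      (fun r i => (hs r i).2) h₁ ?_
    rw [← hN, Fintype.card_fin]
    exact hb₁
  have m₂ : M.sampleLaw e n B₂ ≤ ENNReal.ofReal δ := by
    have hs := fun (k : ParamIdx p e (M.dim n) × ParamIdx p e (M.dim n)) (i : Fin n) =>
      M.hessian_second_moment h0' (hhess i k.1 k.2) (hF i k.1 k.2 k.1) (hF3 i k.1 k.2 k.1).le
      ((hle i k.1 k.2 k.1).mono fun y hy => (hy _ hU0).1)
    refine pi_measure_sum_sq_sum_ge_le (fun k i => (hs k i).1) (fun k i => ?_)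
      (fun k i => (hs k i).2) h₂ ?_
    · rw [integral_sub (hhess i k.1 k.2) (integrable_const _)]
      simp
    · rw [Fintype.card_prod, Nat.cast_mul, ← hN, Fintype.card_fin, ← sq]
      exact hb₂
  have m₃ : M.sampleLaw e n B₃ ≤ ENNReal.ofReal δ := by
    refine pi_measure_sum_sum_ge_le
      (X := fun (k : ParamIdx p e (M.dim n) × ParamIdx p e (M.dim n) × ParamIdx p e (M.dim n))
        i t => n * G i k.1 k.2.1 k.2.2 t ^ 2) (K := n * C4)
      (fun k i => (hG i _ _ _).integrable_sq.const_mul _) (fun _ _ _ => by positivity)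
      (fun k i => ?_) h₃ ?_
    · rw [integral_const_mul]
      exact mul_le_mul_of_nonneg_left (hG4 i k.1 k.2.1 k.2.2).le (Nat.cast_nonneg n)
    · rw [Fintype.card_prod, Fintype.card_prod, Nat.cast_mul, Nat.cast_mul, ← hN,
        Fintype.card_fin]
      linarith
  have m₄ : M.sampleLaw e n B₄ ≤ ENNReal.ofReal δ := by
    refine pi_measure_sum_sum_ge_le (κ := Unit) (X := fun _ _ t => 1 + |t|) (K := 1 + Ky)
      (fun _ i => (integrable_const _).add (hmom i).1) (fun _ _ _ => by positivity)
      (fun _ i => ?_) h₄ ?_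
    · rw [integral_add (integrable_const _) (hmom i).1]
      simpa using (hmom i).2
    · simpa using hb₄
  have hsub : {y | ¬ M.IsGoodSample U G a₁ a₂ a₃ a₄ y} ⊆ B₀ ∪ (B₁ ∪ (B₂ ∪ (B₃ ∪ B₄))) := by
    intro y hy
    by_contra hcon
    simp only [Set.mem_union, not_or] at hcon
    obtain ⟨c0, c1, c2, c3, c4⟩ := hcon
    refine hy ⟨not_not.1 c0, not_le.1 c1, not_le.1 c2, lt_of_le_of_lt ?_ (not_le.1 c3), ?_⟩
    · refine Finset.sum_le_sum fun k _ => ?_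
      rw [← Finset.mul_sum]
      simpa using sq_sum_le_card_mul_sum_sq (s := Finset.univ)
        (f := fun i => G i k.1 k.2.1 k.2.2 (y i))
    · simpa [B₄] using c4
  calc M.sampleLaw e n {y | ¬ M.IsGoodSample U G a₁ a₂ a₃ a₄ y} ≤ M.sampleLaw e n (B₀ ∪ (B₁ ∪ (B₂ ∪ (B₃ ∪ B₄)))) :=
        measure_mono hsub
    _ ≤ M.sampleLaw e n B₀ + (M.sampleLaw e n B₁ + (M.sampleLaw e n B₂ + (M.sampleLaw e n B₃ + M.sampleLaw e n B₄))) := by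
        refine (measure_union_le _ _).trans (add_le_add le_rfl ?_)
        refine (measure_union_le _ _).trans (add_le_add le_rfl ?_)
        refine (measure_union_le _ _).trans (add_le_add le_rfl (measure_union_le _ _))
    _ ≤ 0 + (ENNReal.ofReal δ + (ENNReal.ofReal δ + (ENNReal.ofReal δ + ENNReal.ofReal δ))) := by
        gcongr
        exact m₀.le
    _ = ENNReal.ofReal (4 * δ) := by
        rw [← ENNReal.ofReal_add hδ hδ, ← ENNReal.ofReal_add hδ (by positivity),
          ← ENNReal.ofReal_add hδ (by positivity), zero_add]
        congr 1
        ring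

end GAMSeq

end GAM
end

/-! ### Scaling in $u=\sqrt d$ and $s=\sqrt n$. -/

noncomputable section

namespace GAM

/-- All terms carry the factor $u^2=d$ except the penalty, which carries only $u\le u^2$. Dividing
by $u^2$ leaves a condition whose error terms vanish asymptotically. -/
theorem scaled_drift_neg {u s C G c S E B Λ : ℝ} (hu : 1 ≤ u) (hs : 0 < s) (hCB : 0 ≤ C * B)
    (hΛ : 0 ≤ Λ)
    (h : C * G - c / 4 * C ^ 2 + C ^ 3 * S * (u ^ 4 / s) + 2 * (E * (u ^ 4 / s)) +
      C * B * (Λ / s) < 0) :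
    C * (u / s) * (G * (u * s)) + 1 / 2 * (s ^ 2 * c / 2 - s ^ 2 * c) * (C * (u / s)) ^ 2 +
      (C * (u / s)) ^ 3 * (S * (s ^ 2 * u ^ 3)) + 2 * (E * (u ^ 6 / s)) +
      C * (u / s) * B * Λ < 0 := by
  have h1 : C * (u / s) * (G * (u * s)) +
      1 / 2 * (s ^ 2 * c / 2 - s ^ 2 * c) * (C * (u / s)) ^ 2 +
      (C * (u / s)) ^ 3 * (S * (s ^ 2 * u ^ 3)) + 2 * (E * (u ^ 6 / s)) =
      u ^ 2 * (C * G - c / 4 * C ^ 2 + C ^ 3 * S * (u ^ 4 / s) + 2 * (E * (u ^ 4 / s))) := by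
    field_simp
    ring
  have h2 : C * (u / s) * B * Λ = u * (C * B * (Λ / s)) := by ring
  have h3 : u * (C * B * (Λ / s)) ≤ u ^ 2 * (C * B * (Λ / s)) := by
    gcongr
    nlinarith
  have h4 := mul_neg_of_pos_of_neg (pow_pos (zero_lt_one.trans_le hu) 2) h
  rw [h1, h2]
  linarith

namespace GAMSeq

variable {p q : ℕ} (M : GAMSeq p q) {e n : ℕ}

theorem card_paramIdx_le (he : e ≤ 1) (hd : 1 ≤ M.d n) :
    (Fintype.card (ParamIdx p e (M.dim n)) : ℝ) ≤ (p + 2) * M.d n := by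
  have h1 : (1 : ℝ) ≤ M.d n := by exact_mod_cast hd
  have h2 : (e : ℝ) ≤ 1 := by exact_mod_cast he
  rw [Fintype.card_sum, Fintype.card_sum, Nat.cast_add, Nat.cast_add, M.card_basisIdx,
    Fintype.card_fin, Fintype.card_fin]
  nlinarith [Nat.cast_nonneg (α := ℝ) p]

theorem exists_isVAEstimate_of_isGoodSample (hM : M.Regular) (hint : M.VariationalIntegrable e)
    [Nonempty (BasisIdx (M.dim n))] {r : Fin q → ℕ}
    (hS : ∀ j, IsDifferencePenalty (r j) (M.S n j)) (hlam : ∀ j, 0 < M.lam n j)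
    (hn : 0 < n) {y : Fin n → ℝ} {U : Set (Param p e (M.dim n))} (hU : IsOpen U)
    (hUs : U ⊆ M.paramSpace e n) {u s C k g c Q Y X P B R K : ℝ}
    {G : Fin n → ParamIdx p e (M.dim n) → ParamIdx p e (M.dim n) → ParamIdx p e (M.dim n) → ℝ → ℝ}
    (hu : 1 ≤ u) (hs : 0 < s) (hud : u ^ 2 = M.d n) (hsn : s ^ 2 = n) (hC : 0 < C) (hk : 0 < k)
    (hg : 0 ≤ g) (hc0 : 0 < c) (hQ : 0 ≤ Q) (hX : 0 ≤ X) (hP : 0 ≤ P) (hB : 0 ≤ B) (hK : 0 ≤ K)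
    (hy : M.IsGoodSample U G ((g * (u * s)) ^ 2) ((s ^ 2 * c / 2) ^ 2) ((Q * (s ^ 2 * u ^ 3)) ^ 2)
      (Y * s ^ 2) y)
    (hball : Metric.closedBall (M.theta0 e n) (C * (u / s)) ⊆ U)
    (hc : ∀ v : ParamIdx p e (M.dim n) → ℝ, c * (v ⬝ᵥ v) ≤ v ⬝ᵥ (M.fisherInfo e n *ᵥ v))
    (hcoef : ∑ k, coef (M.theta0 e n) k ^ 2 ≤ B ^ 2)
    (hcard : (Fintype.card (ParamIdx p e (M.dim n)) : ℝ) ≤ P ^ 2 * u ^ 2)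
    (hx : ∀ (i : Fin n) j, |M.x n i j| ≤ X) (hz : ∀ (i : Fin n) k, |M.z n i k| ≤ X)
    (hR : ∀ i : Fin n, |M.eta i (M.theta0 e n)| ≤ R - 1)
    (hsmooth : ∀ (θ : Param p e (M.dim n))
      (A : Matrix (BasisIdx (M.dim n)) (BasisIdx (M.dim n)) ℝ) (vmax κ : ℝ),
      (∀ i : Fin n, |M.eta i θ| ≤ R) → (∀ i : Fin n, |M.eta i (M.theta0 e n)| ≤ R) →
      M.phi0 / 2 ≤ dispersion M.phi0 θ → A.PosSemidef → (∀ i : Fin n, M.linVar i A ≤ vmax) →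
      vmax ≤ 1 / 4 → (∀ i : Fin n, |M.eta i θ - M.eta i (M.theta0 e n)| ≤ κ) →
      |dispersion M.phi0 θ - M.phi0| ≤ κ →
      |M.smoothing y θ A - 1 / 2 * ∑ i, M.linVar i A * M.curv i (y i) (M.theta0 e n)| ≤
        K * (vmax * (√vmax + κ)) * ∑ i, (1 + |y i|))
    (hκ1 : (X * P + 1) * C * (u ^ 2 / s) ≤ 1) (hκ2 : (X * P + 1) * C * (u ^ 2 / s) ≤ M.phi0 / 2)
    (hv : X * k * (u ^ 2 / s) ≤ 1 / 2)
    (hnum1 : C * g - c / 4 * C ^ 2 + C ^ 3 * Q * (u ^ 4 / s) +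
      2 * (K * (X ^ 2 * k ^ 2 * (X * k + (X * P + 1) * C)) * Y * (u ^ 4 / s)) +
      C * B * ((∑ j, M.lam n j * 4 ^ r j) / s) < 0)
    (hnum2 : 1 / 2 * Real.log 2 +
      2 * (K * (X ^ 2 * k ^ 2 * (X * k + (X * P + 1) * C)) * Y * (u ^ 4 / s)) <
        1 / 8 * (c * k ^ 2)) :
    ∃ (θ : Param p e (M.dim n)) (A : Matrix (BasisIdx (M.dim n)) (BasisIdx (M.dim n)) ℝ),
      ‖θ - M.theta0 e n‖ ≤ C * (u / s) ∧ M.IsVAEstimate y θ A := by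
  obtain ⟨⟨hy0, hyG⟩, hy1, hy2, hy3, hy4⟩ := hy
  have hu0 : 0 < u := zero_lt_one.trans_le hu
  -- With $\tau=k^2u^2/s^2$ the variances are at most $(Xku^2/s)^2$. Their square root and `κ` are
  -- both of order $u^2/s$, so multiplication by the sample total $Ys^2$ gives the smoothing error
  -- $Eu^6/s$.
  set E := K * (X ^ 2 * k ^ 2 * (X * k + (X * P + 1) * C)) * Y with hE
  set κ := (X * P + 1) * C * (u ^ 2 / s) with hκ
  refine M.exists_isVAEstimate_of_bounds hM hint hS hlam hn hU hUs hy0 (ρ := C * (u / s))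
    (τ := k ^ 2 * (u ^ 2 / s ^ 2)) (by positivity) (by positivity) hball
    (G := fun i r s t => G i r s t (y i)) hyG (g := g * (u * s)) (w := s ^ 2 * c / 2)
    (T := Q * (s ^ 2 * u ^ 3)) (err := E * (u ^ 6 / s)) (by positivity) (by positivity)
    (by positivity) hB hy1.le ?_ ?_ hc hcoef ?_ ?_ ?_
  · rw [← Fintype.sum_prod_type']
    exact hy2.le
  · simp only [Fintype.sum_prod_type] at hy3
    exact hy3.le
  · intro θ hθ A hA htr
    have hηκ : ∀ i : Fin n, |M.eta i θ - M.eta i (M.theta0 e n)| ≤ κ := fun i => by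
      refine (M.abs_eta_sub_le hX i (hx i) (hz i) θ (M.theta0 e n)).trans ?_
      have h1 : √(Fintype.card (ParamIdx p e (M.dim n)) : ℝ) ≤ P * u :=
        Real.sqrt_le_iff.2 ⟨by positivity, by rw [mul_pow]; exact hcard⟩
      calc _ ≤ X * (P * u) * (C * (u / s)) := by gcongr
        _ = X * P * C * (u ^ 2 / s) := by ring
        _ ≤ κ := by
          rw [hκ, add_mul, add_mul, le_add_iff_nonneg_right]
          positivity
    have hφκ : |dispersion M.phi0 θ - M.phi0| ≤ κ := by
      have h1 := abs_dispersion_sub_le M.phi0 θ (M.theta0 e n)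
      rw [M.dispersion_theta0] at h1
      refine (h1.trans hθ).trans ?_
      rw [hκ, mul_assoc]
      have h2 : C * (u / s) ≤ C * (u ^ 2 / s) := by
        gcongr
        nlinarith
      have h3 : 0 ≤ X * P * (C * (u ^ 2 / s)) := by positivity
      linarith
    have h4 := hsmooth θ A ((X * k * (u ^ 2 / s)) ^ 2) κ (fun i => ?_) (fun i => ?_) ?_ hA
      (fun i => ?_) ?_ hηκ hφκ
    · refine h4.trans ?_
      have hκ0 : 0 ≤ κ := by rw [hκ]; positivity
      rw [Real.sqrt_sq (by positivity)]
      calc _ ≤ K * ((X * k * (u ^ 2 / s)) ^ 2 * (X * k * (u ^ 2 / s) + κ)) * (Y * s ^ 2) := by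
            gcongr
        _ = E * (u ^ 6 / s) := by
            rw [hE, hκ]
            field_simp
    · have h1 := abs_sub_le (M.eta i θ) (M.eta i (M.theta0 e n)) 0
      rw [sub_zero, sub_zero] at h1
      linarith [hηκ i, hR i]
    · linarith [hR i]
    · linarith [(abs_le.1 hφκ).1]
    · refine (M.linVar_le i hA (hz i)).trans ?_
      rw [← hud]
      calc _ ≤ u ^ 2 * X ^ 2 * (k ^ 2 * (u ^ 2 / s ^ 2)) := by gcongr
        _ = _ := by
          field_simp
    · have h0 : 0 ≤ X * k * (u ^ 2 / s) := by positivity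
      refine (pow_le_pow_left₀ h0 hv 2).trans (by norm_num)
  · rw [← hsn]
    exact scaled_drift_neg hu hs (by positivity)
      (Finset.sum_nonneg fun j _ => mul_nonneg (hlam j).le (by positivity)) hnum1
  · rw [← hsn, ← hud]
    have h1 : 1 / 4 * ((s ^ 2 * c - s ^ 2 * c / 2) * (k ^ 2 * (u ^ 2 / s ^ 2))) =
        u ^ 2 * (1 / 8 * (c * k ^ 2)) := by
      field_simp
      ring
    have h2 : 1 / 2 * (u ^ 2 * Real.log 2) + 2 * (E * (u ^ 6 / s)) =
        u ^ 2 * (1 / 2 * Real.log 2 + 2 * (E * (u ^ 4 / s))) := by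
      field_simp
    rw [h1, h2]
    gcongr

end GAMSeq

end GAM
end

/-! ### Asymptotics and the choice of the constants. -/

noncomputable section

namespace GAM

namespace GAMSeq

variable {p q : ℕ} (M : GAMSeq p q) {e : ℕ}

theorem one_le_d (hq : 0 < q) (hdim : ∀ n j, 0 < M.dim n j) (n : ℕ) : 1 ≤ M.d n :=
  (hdim n ⟨0, hq⟩).trans_le (Finset.single_le_sum (f := M.dim n) (fun _ _ => Nat.zero_le _)
    (Finset.mem_univ _))

theorem tendsto_d_sq_div_sqrt (h6 : M.CondC6) :
    Tendsto (fun n : ℕ => √(M.d n : ℝ) ^ 4 / √(n : ℝ)) atTop (𝓝 0) := by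
  have h := (IsLittleO.pow h6 (n := 2) (by norm_num)).tendsto_div_nhds_zero
  refine h.congr fun n => ?_
  congr 1
  · rw [show 4 = 2 * 2 from rfl, pow_mul, Real.sq_sqrt (Nat.cast_nonneg _)]
  · rw [Real.sqrt_eq_rpow, ← Real.rpow_natCast, ← Real.rpow_mul (Nat.cast_nonneg _)]
    norm_num

theorem tendsto_d_div_sqrt (hd : ∀ n, 1 ≤ M.d n) (h6 : M.CondC6) :
    Tendsto (fun n : ℕ => √(M.d n : ℝ) ^ 2 / √(n : ℝ)) atTop (𝓝 0) := by
  refine squeeze_zero (fun n => by positivity) (fun n => ?_) (M.tendsto_d_sq_div_sqrt h6)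
  have h1 : (1 : ℝ) ≤ √(M.d n : ℝ) := Real.one_le_sqrt.2 (by exact_mod_cast hd n)
  gcongr
  norm_num

theorem tendsto_sum_lam_div_sqrt (r : Fin q → ℕ)
    (hlam : ∀ j, (fun n => M.lam n j) =o[atTop] fun n : ℕ => (n : ℝ) ^ (1 / 2 : ℝ)) :
    Tendsto (fun n : ℕ => (∑ j, M.lam n j * 4 ^ r j) / √(n : ℝ)) atTop (𝓝 0) := by
  have h : (fun n => ∑ j, M.lam n j * 4 ^ r j) =o[atTop] fun n : ℕ => (n : ℝ) ^ (1 / 2 : ℝ) :=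
    IsLittleO.fun_sum fun j _ => by
      simpa only [mul_comm] using (hlam j).const_mul_left (4 ^ r j)
  simpa only [Real.sqrt_eq_rpow] using h.tendsto_div_nhds_zero

/-- With high probability there is a variational estimate at a distance of the order
`(d / n) ^ (1 / 2)` from the true parameter. -/
theorem exists_radius (hq : 0 < q) (he : e ≤ 1) (hdim : ∀ n j, 0 < M.dim n j) {r : Fin q → ℕ}
    (hS : ∀ n j, IsDifferencePenalty (r j) (M.S n j)) (hint : M.VariationalIntegrable e)
    (h1 : M.CondC1 e) (h2 : M.CondC2) (h3 : M.CondC3 e) (h4 : M.CondC4 e) (h5 : M.CondC5 e)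
    (h6 : M.CondC6) (hlam_pos : ∀ n j, 0 < M.lam n j)
    (hlam : ∀ j, (fun n => M.lam n j) =o[atTop] fun n : ℕ => (n : ℝ) ^ (1 / 2 : ℝ)) {δ : ℝ}
    (hδ : 0 < δ) :
    ∃ C, 0 < C ∧ ∀ᶠ n in atTop, M.sampleLaw e n {y | ¬ ∃ θ A,
      ‖θ - M.theta0 e n‖ ≤ C * √((M.d n : ℝ) / n) ∧ M.IsVAEstimate y θ A} ≤
        ENNReal.ofReal (4 * δ) := by
  have hM := M.regular_of_conditions hq hdim hint h1 h3
  have hd := M.one_le_d hq hdim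
  have hφ : 0 < M.phi0 := M.fam.disp_pos _ (M.phi0_mem (interior_subset (h3.1 0)))
  obtain ⟨B, hB, hcoef⟩ := M.exists_coef_bound hM h1 h3 h4
  obtain ⟨Ky, hKy, hmom⟩ := M.exists_abs_moment_bound hM h3
  obtain ⟨X', hX'⟩ := h2
  obtain ⟨-, hscore, C2, hC2⟩ := id h3
  obtain ⟨hhess, c, hc0, hc⟩ := h4
  obtain ⟨K, hK, hsmooth⟩ := M.exists_smoothing_bound (e := e) hM (C2 + 1) hφ
  obtain ⟨U, C3', C4', hU, hball, henv'⟩ := h5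
  obtain ⟨C3, C4, hC3, hC4, henv⟩ : ∃ C3 C4 : ℝ, 0 < C3 ∧ 0 < C4 ∧
      ∀ n (i : Fin n), ∀ r s t : ParamIdx p e (M.dim n), ∃ F G : ℝ → ℝ,
        MemLp F 2 (M.trueLaw e n i) ∧ MemLp G 2 (M.trueLaw e n i) ∧
        ∫ y, F y ^ 2 ∂(M.trueLaw e n i) < C3 ∧ ∫ y, G y ^ 2 ∂(M.trueLaw e n i) < C4 ∧
        ∀ᵐ y ∂M.fam.base, ∀ theta ∈ U n,
          |partialDeriv r (partialDeriv s (M.logf i y)) theta| ≤ F y ∧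
          |partialDeriv r (partialDeriv s (partialDeriv t (M.logf i y))) theta| ≤ G y :=
    ⟨max C3' 1, max C4' 1, by positivity, by positivity, fun n i r s t => by
      obtain ⟨F, G, hF, hG, hF3, hG4, hle⟩ := henv' n i r s t
      exact ⟨F, G, hF, hG, lt_max_of_lt_left hF3, lt_max_of_lt_left hG4, hle⟩⟩
  set X := max X' 0
  have hX : 0 ≤ X := le_max_right _ _
  -- $P^2d$ bounds the number of parameters, since $e\le1\le d$.
  set P := √((p : ℝ) + 2) with hP
  have hP2 : P ^ 2 = p + 2 := Real.sq_sqrt (by positivity)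
  have hP0 : 0 < P := by positivity
  -- `g`, `Q` and `Y` are chosen to spend exactly the probability `δ` in the Markov bounds for the
  -- score, the third derivatives and the responses. The Hessian needs no such constant: its
  -- deviation is below $nc/2$ because $d^2/n\to0$.
  set g := √(P ^ 2 * (1 + C3) / δ)
  have hg2 : δ * g ^ 2 = P ^ 2 * (1 + C3) := by
    rw [Real.sq_sqrt (by positivity), mul_div_cancel₀ _ hδ.ne']
  have hg : 0 < g := by positivity
  set Q := √(P ^ 6 * C4 / δ)
  have hQ2 : δ * Q ^ 2 = P ^ 6 * C4 := by
    rw [Real.sq_sqrt (by positivity), mul_div_cancel₀ _ hδ.ne']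
  have hQ : 0 < Q := by positivity
  set Y := (1 + Ky) / δ
  have hY2 : δ * Y = 1 + Ky := mul_div_cancel₀ _ hδ.ne'
  have hY : 0 < Y := by positivity
  -- The gain from halving $A$ becomes $\frac18ck^2=1$ per dimension, more than the cost
  -- $\frac12\ln2$.
  set k := √(8 / c)
  have hk2 : c * k ^ 2 = 8 := by rw [Real.sq_sqrt (by positivity), mul_div_cancel₀ _ hc0.ne']
  have hk : 0 < k := by positivity
  -- This makes $Cg-\frac c4C^2=-C$, the limit of the drift on the sphere.
  set C := 4 * (g + 1) / c with hCdef
  have hC : 0 < C := by positivity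
  have hCc : c * C = 4 * (g + 1) := mul_div_cancel₀ _ hc0.ne'
  have t1 := M.tendsto_d_sq_div_sqrt h6
  have t2 := M.tendsto_d_div_sqrt hd h6
  have t3 := M.tendsto_sum_lam_div_sqrt r hlam
  have l1 : Tendsto (fun n : ℕ => (X * P + 1) * C * (√(M.d n : ℝ) ^ 2 / √(n : ℝ))) atTop (𝓝 0) := by
    simpa using t2.const_mul ((X * P + 1) * C)
  have l2 : Tendsto (fun n : ℕ => X * k * (√(M.d n : ℝ) ^ 2 / √(n : ℝ))) atTop (𝓝 0) := by
    simpa using t2.const_mul (X * k)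
  have l3 : Tendsto (fun n : ℕ => P ^ 4 * C3 * (√(M.d n : ℝ) ^ 2 / √(n : ℝ)) ^ 2) atTop (𝓝 0) := by
    simpa using (t2.pow 2).const_mul (P ^ 4 * C3)
  set E := K * (X ^ 2 * k ^ 2 * (X * k + (X * P + 1) * C)) * Y
  have l4 : Tendsto (fun n : ℕ => C * g - c / 4 * C ^ 2 +
      C ^ 3 * Q * (√(M.d n : ℝ) ^ 4 / √(n : ℝ)) + 2 * (E * (√(M.d n : ℝ) ^ 4 / √(n : ℝ))) +
      C * B * ((∑ j, M.lam n j * 4 ^ r j) / √(n : ℝ))) atTop (𝓝 (-C)) := by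
    have := (((t1.const_mul (C ^ 3 * Q)).const_add (C * g - c / 4 * C ^ 2)).add
      ((t1.const_mul E).const_mul 2)).add (t3.const_mul (C * B))
    refine this.trans (le_of_eq ?_)
    congr 1
    linear_combination (-C / 4) * hCc
  have l5 : Tendsto (fun n : ℕ => 1 / 2 * Real.log 2 + 2 * (E * (√(M.d n : ℝ) ^ 4 / √(n : ℝ))))
      atTop (𝓝 (1 / 2 * Real.log 2)) := by
    simpa using ((t1.const_mul E).const_mul 2).const_add (1 / 2 * Real.log 2)
  refine ⟨C, hC, ?_⟩
  filter_upwards [eventually_gt_atTop 0, hcoef, hc, hball C, l1.eventually_le_const one_pos,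
    l1.eventually_le_const (half_pos hφ), l2.eventually_le_const one_half_pos,
    l3.eventually_le_const (show 0 < δ * (c / 2) ^ 2 by positivity),
    l4.eventually_lt_const (neg_neg_of_pos hC),
    l5.eventually_lt_const (show 1 / 2 * Real.log 2 < 1 / 8 * (c * k ^ 2) by
      rw [hk2]; linarith [Real.log_two_lt_d9])]
    with n hn hcoefn hcn hballn b1 b2 b3 b4 b5 b6
  have hu : 1 ≤ √(M.d n : ℝ) := Real.one_le_sqrt.2 (by exact_mod_cast hd n)
  have hs : 0 < √(n : ℝ) := Real.sqrt_pos.2 (by exact_mod_cast hn)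
  have hud : √(M.d n : ℝ) ^ 2 = M.d n := Real.sq_sqrt (by positivity)
  have hsn : √(n : ℝ) ^ 2 = n := Real.sq_sqrt (by positivity)
  rw [Real.sqrt_div (by positivity)] at hballn ⊢
  have hcard := M.card_paramIdx_le he (hd n)
  rw [← hP2, ← hud] at hcard
  set u := √(M.d n : ℝ)
  set s := √(n : ℝ)
  have hu0 : 0 < u := zero_lt_one.trans_le hu
  have : Nonempty (BasisIdx (M.dim n)) := ⟨⟨⟨0, hq⟩, ⟨0, hdim n _⟩⟩⟩
  set N := (Fintype.card (ParamIdx p e (M.dim n)) : ℝ) with hN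
  obtain ⟨G, hG⟩ := M.exists_measure_not_isGoodSample_le (h3.1 n) (h1.1 n) (hscore n) (hhess n)
    (hU n).1 (hU n).2.1 (hU n).2.2 (henv n) (hmom n) (a₁ := (g * (u * s)) ^ 2)
    (a₂ := (s ^ 2 * c / 2) ^ 2) (a₃ := (Q * (s ^ 2 * u ^ 3)) ^ 2) (a₄ := Y * s ^ 2) hN
    (by positivity) (by positivity) (by positivity) (by positivity) hδ.le
    (by
      rw [← hsn]
      calc _ ≤ P ^ 2 * u ^ 2 * (s ^ 2 * (1 + C3)) := by gcongr
        _ = δ * (g * (u * s)) ^ 2 := by linear_combination (-u ^ 2 * s ^ 2) * hg2)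
    (by
      rw [← hsn]
      calc _ ≤ (P ^ 2 * u ^ 2) ^ 2 * (s ^ 2 * C3) := by gcongr
        _ = P ^ 4 * C3 * (u ^ 2 / s) ^ 2 * s ^ 4 := by field_simp
        _ ≤ δ * (c / 2) ^ 2 * s ^ 4 := by gcongr
        _ = _ := by ring)
    (by
      rw [← hsn]
      calc _ ≤ (P ^ 2 * u ^ 2) ^ 3 * (s ^ 2 * (s ^ 2 * C4)) := by gcongr
        _ = δ * (Q * (s ^ 2 * u ^ 3)) ^ 2 := by linear_combination (-s ^ 4 * u ^ 6) * hQ2)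
    (by
      rw [← hsn]
      exact le_of_eq (by linear_combination (-s ^ 2) * hY2))
  refine (measure_mono fun y hy => ?_).trans hG
  refine fun hgood => hy ?_
  exact M.exists_isVAEstimate_of_isGoodSample hM hint (hS n) (hlam_pos n) hn (hU n).1 (hU n).2.2
    hu hs hud hsn hC hk hg.le hc0 hQ.le hX hP0.le hB hK hgood hballn hcn hcoefn hcard
    (fun i j => ((hX' n i).1 j).le.trans (le_max_left _ _))
    (fun i j => ((hX' n i).2 j).le.trans (le_max_left _ _)) (R := C2 + 1)
    (fun i => by rw [add_sub_cancel_right]; exact (hC2 n i).le) (hsmooth n y) b1 b2 b3 b5 b6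

end GAMSeq

end GAM
end

/-! ### Selection of one estimator for all error probabilities. -/

noncomputable section

namespace GAM

/-- A selection from the points with property `p` that nearly minimizes `f`. -/
theorem exists_select {α β : Type*} [Nonempty β] (p : α → β → Prop) {f : β → ℝ}
    (hf : ∀ b, 0 ≤ f b) {τ : ℝ} (hτ : 0 < τ) :
    ∃ s : α → β, ∀ a b, p a b → p a (s a) ∧ f (s a) ≤ f b + τ := by
  have key : ∀ a, ∃ c, ∀ b, p a b → p a c ∧ f c ≤ f b + τ := by
    intro a
    by_cases h : ∃ b, p a b
    · have hne : (f '' {b | p a b}).Nonempty := by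
        obtain ⟨b, hb⟩ := h
        exact ⟨f b, b, hb, rfl⟩
      have hbdd : BddBelow (f '' {b | p a b}) := ⟨0, by
        rintro _ ⟨b, -, rfl⟩
        exact hf b⟩
      obtain ⟨_, ⟨c, hc, rfl⟩, hlt⟩ := exists_lt_of_csInf_lt hne (lt_add_of_pos_right _ hτ)
      refine ⟨c, fun b hb => ⟨hc, hlt.le.trans ?_⟩⟩
      gcongr
      exact csInf_le hbdd ⟨b, hb, rfl⟩
    · exact ⟨Classical.arbitrary β, fun b hb => absurd ⟨b, hb⟩ h⟩
  choose s hs using key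
  exact ⟨s, hs⟩

end GAM

end

theorem theorem1 (p q e : ℕ) (hq : 0 < q) (he : e ≤ 1) (M : GAM.GAMSeq p q)
    (hdim : ∀ n j, 0 < M.dim n j)
    (r : Fin q → ℕ) (hS : ∀ n j, GAM.IsDifferencePenalty (r j) (M.S n j))
    (hint : M.VariationalIntegrable e)
    (h1 : M.CondC1 e) (h2 : M.CondC2) (h3 : M.CondC3 e) (h4 : M.CondC4 e) (h5 : M.CondC5 e)
    (h6 : M.CondC6)
    (hlam_pos : ∀ n j, 0 < M.lam n j)
    (hlam : ∀ j, (fun n => M.lam n j) =o[atTop] fun n : ℕ => (n : ℝ) ^ (1 / 2 : ℝ)) :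
    ∃ est : ∀ n, (Fin n → ℝ) →
        GAM.Param p e (M.dim n) × Matrix (GAM.BasisIdx (M.dim n)) (GAM.BasisIdx (M.dim n)) ℝ,
      Tendsto (fun n => M.sampleLaw e n {y | ¬ M.IsVAEstimate y (est n y).1 (est n y).2})
        atTop (𝓝 0) ∧
      ∀ ε : ENNReal, 0 < ε → ∃ C : ℝ, ∀ᶠ n in atTop,
        M.sampleLaw e n {y | C * ((M.d n : ℝ) ^ (1 / 2 : ℝ) * (n : ℝ) ^ (-(1 / 2) : ℝ)) <
          ‖(est n y).1 - M.theta0 e n‖} ≤ ε := by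
  have hd := M.one_le_d hq hdim
  have hsel : ∀ n, ∃ est : (Fin n → ℝ) →
      GAM.Param p e (M.dim n) × Matrix (GAM.BasisIdx (M.dim n)) (GAM.BasisIdx (M.dim n)) ℝ,
      ∀ y (w : GAM.Param p e (M.dim n) × Matrix (GAM.BasisIdx (M.dim n))
        (GAM.BasisIdx (M.dim n)) ℝ), M.IsVAEstimate y w.1 w.2 → M.IsVAEstimate y (est y).1 (est y).2 ∧
        (0 < n → ‖(est y).1 - M.theta0 e n‖ ≤ ‖w.1 - M.theta0 e n‖ + √((M.d n : ℝ) / n)) := by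
    intro n
    -- The infimum of the distances need not be attained, and a slack of the order of the rate is
    -- harmless. For `n = 0` the quotient `d / n` is zero by convention, so a positive default is
    -- inserted.
    have hτ : 0 < if n = 0 then 1 else √((M.d n : ℝ) / n) := by
      have : (0 : ℝ) < M.d n := by exact_mod_cast hd n
      split_ifs with hn
      · exact one_pos
      · have : 0 < n := Nat.pos_of_ne_zero hn
        positivity
    obtain ⟨s, hs⟩ := GAM.exists_select
      (fun (y : Fin n → ℝ) (w : GAM.Param p e (M.dim n) × Matrix (GAM.BasisIdx (M.dim n))
        (GAM.BasisIdx (M.dim n)) ℝ) => M.IsVAEstimate y w.1 w.2)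
      (f := fun w => ‖w.1 - M.theta0 e n‖) (fun _ => norm_nonneg _) hτ
    refine ⟨s, fun y w hw => ⟨(hs y w hw).1, fun hn => ?_⟩⟩
    have := (hs y w hw).2
    rwa [if_neg hn.ne'] at this
  choose est hest using hsel
  have main : ∀ ε : ENNReal, 0 < ε → ∃ C : ℝ, ∀ᶠ n in atTop, M.sampleLaw e n {y | ¬ ∃ θ A,
      ‖θ - M.theta0 e n‖ ≤ C * √((M.d n : ℝ) / n) ∧ M.IsVAEstimate y θ A} ≤ ε := by
    intro ε hε
    obtain ⟨x, hx, hxε⟩ := ENNReal.lt_iff_exists_nnreal_btwn.1 hε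
    have hx0 : 0 < (x : ℝ) := by exact_mod_cast hx
    obtain ⟨C, -, hC⟩ := M.exists_radius hq he hdim hS hint h1 h2 h3 h4 h5 h6 hlam_pos hlam
      (δ := x / 4) (by positivity)
    refine ⟨C, hC.mono fun n hn => hn.trans ?_⟩
    rw [mul_div_cancel₀ _ (by norm_num), ENNReal.ofReal_coe_nnreal]
    exact hxε.le
  refine ⟨est, ?_, fun ε hε => ?_⟩
  · refine ENNReal.tendsto_nhds_zero.2 fun ε hε => ?_
    obtain ⟨C, hC⟩ := main ε hε
    filter_upwards [hC] with n hn
    refine (measure_mono fun y hy => ?_).trans hn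
    rintro ⟨θ, A, -, h⟩
    exact hy (hest n y (θ, A) h).1
  · obtain ⟨C, hC⟩ := main ε hε
    -- The additional 1 is the slack of the selection.
    refine ⟨C + 1, ?_⟩
    filter_upwards [hC, eventually_gt_atTop 0] with n hn hn0
    refine (measure_mono fun y hy => ?_).trans hn
    rintro ⟨θ, A, hθ, h⟩
    have h' := (hest n y (θ, A) h).2 hn0
    have hr : (M.d n : ℝ) ^ (1 / 2 : ℝ) * (n : ℝ) ^ (-(1 / 2) : ℝ) = √((M.d n : ℝ) / n) := by
      rw [Real.rpow_neg (Nat.cast_nonneg _), ← Real.sqrt_eq_rpow, ← Real.sqrt_eq_rpow,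
        Real.sqrt_div (Nat.cast_nonneg _), div_eq_mul_inv]
    rw [Set.mem_ofPred_eq, hr] at hy
    simp only at h'
    linarith
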